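/- Let $d\ge 1$, let $\Omega\subset\mathbb R^d$ be a bounded Lipschitz domain, $I=(0,T)$ with $T>0$, and $U:=L^2(I\times\Omega)$. Let $s\in(0,1)$ and let $W$ be one of the following Hilbert spaces (with its own inner product $(\cdot,\cdot)_W$ and norm $\|\cdot\|_W$): - $H^s(\Omega)=\{w\in L^2(\Omega): \frac{|w(x)-w(y)|}{|x-y|^{d/2+s}}\in L^2(\Omega\times\Omega)\}$ with $(u,w)_{H^s(\Omega)}=\int_\Omega uw\,dx+\frac{c_{d,s}}2\int_\Omega\int_\Omega\frac{(u(x)-u(y))(w(x)-w(y))}{|x-y|^{d+2s}}\,dy\,dx$, where $c_{d,s}=\frac{s2^{2s}\Gamma(s+d/2)}{\pi^{d/2}\Gamma(1-s)}$; - $H^s_0(\Omega)$, the closure of $C_c^\infty(\Omega)$ in $H^s(\Omega)$, with the same inner product; - $\tilde H^s(\Omega)=\{w\in H^s(\mathbb R^d): w=0 \text{ a.e. outside }\Omega\}$ with the $H^s(\mathbb R^d)$-inner product; - $\mathbb H^s(\Omega)=\{w\in L^2(\Omega):\sum_n\lambda_n^s w_n^2<\infty\}$ with $(u,w)_{\mathbb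 H^s(\Omega)}=\sum_n\lambda_n^s u_nw_n$, where $u_n=\int_\Omega u\phi_n\,dx$, $w_n=\int_\Omega w\phi_n\,dx$ and $(\phi_n)$ is an $L^2(\Omega)$-orthonormal basis of eigenfunctions of the Laplacian $-\Delta$ with zero Dirichlet boundary conditions, with eigenvalues $\lambda_n$. Let $f:U\to\mathbb R$ be weakly lower semicontinuous, bounded from below by a continuous affine function, and continuously Fréchet differentiable; identify $f'(u)$ with its Riesz representative in $U$. Let $\alpha,\beta,\gamma>0$ and $p\in(0,1)$. Consider the problem of minimizing $$\Phi(u,w)=f(u)+\frac\alpha2\|u\|_U^2+\frac\beta2\|w\|_W^2+\gamma\int_\Omega|w|^p\,dx$$ over $K=\{(u,w)\in U\times W: |u(t,x)|\le w(x)\text{ for a.a. }(t,x)\in I\times\Omega\}$. Let $(\bar u,\bar w)\in K$ be a local solution, i.e. there is $\rho>0$ with $\Phi(\bar u,\bar w)\le\Phi(u,w)$ for all $(u,w)\in K$ with $\|u-\bar u\|_U\le\rho$ and $\|w-\bar w\|_W\le\rho$. Let $1<r\le\infty$ and $2<q\le\infty$ be such that $\frac1r+\frac2q<1$ (with $1/\infty=0$)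 and $W$ is continuously embedded in $L^q(\Omega)$, and suppose that the map $x\mapsto\|f'(\bar u)(\cdot,x)\|_{L^1(I)}$ belongs to $L^r(\Omega)$. Then $\bar w\in L^\infty(\Omega)$ and $\bar u\in L^\infty(I\times\Omega)$. -/

import Mathlib

open MeasureTheory Set Filter Topology
open scoped ENNReal NNReal ContDiff InnerProductSpace

noncomputable section

namespace FracControl

/-- The Euclidean space `ℝ^d`. -/
abbrev E (d : ℕ) := EuclideanSpace ℝ (Fin d)

/-- A bounded Lipschitz domain: a bounded, nonempty, connected open set which, near each of its
boundary points, is the set of points lying strictly below the graph of a Lipschitz function, with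
respect to some unit vector `ν` taken as the vertical direction (`y - ⟪ν, y⟫ ν` is the horizontal
part of `y`). -/
structure IsBoundedLipschitzDomain {d : ℕ} (Ω : Set (E d)) : Prop where
  isOpen : IsOpen Ω
  isConnected : IsConnected Ω
  isBounded : Bornology.IsBounded Ω
  lipschitz_boundary : ∀ x₀ ∈ frontier Ω, ∃ V : Set (E d), IsOpen V ∧ x₀ ∈ V ∧
    ∃ ν : E d, ‖ν‖ = 1 ∧ ∃ (L : ℝ≥0) (h : E d → ℝ), LipschitzWith L h ∧
      Ω ∩ V = {y ∈ V | ⟪ν, y⟫_ℝ < h (y - ⟪ν, y⟫_ℝ • ν)}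

/-- `L²(Ω)`. -/
abbrev L2 {d : ℕ} (Ω : Set (E d)) := Lp ℝ 2 ((volume : Measure (E d)).restrict Ω)

/-- Lebesgue measure on the cylinder `I × Ω` with `I = (0, T)`. -/
abbrev cylMeasure {d : ℕ} (T : ℝ) (Ω : Set (E d)) : Measure (ℝ × E d) :=
  ((volume : Measure ℝ).restrict (Ioo 0 T)).prod ((volume : Measure (E d)).restrict Ω)

/-- `U = L²(I × Ω)`. -/
abbrev U {d : ℕ} (T : ℝ) (Ω : Set (E d)) := Lp ℝ 2 (cylMeasure T Ω)

/-- `v ∈ C_c^∞(Ω)`. -/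
structure IsTestFunction {d : ℕ} (Ω : Set (E d)) (v : E d → ℝ) : Prop where
  contDiff : ContDiff ℝ ∞ v
  hasCompactSupport : HasCompactSupport v
  tsupport_subset : tsupport v ⊆ Ω

/-! ### Fractional Sobolev spaces defined through the double integral -/

/-- The constant `c_{d,s}`. -/
def cds (d : ℕ) (s : ℝ) : ℝ :=
  s * 2 ^ (2 * s) * Real.Gamma (s + d / 2) / (Real.pi ^ ((d : ℝ) / 2) * Real.Gamma (1 - s))

/-- `w ∈ H^s(A)`. -/
def MemHs {d : ℕ} (A : Set (E d)) (s : ℝ) (w : E d → ℝ) : Prop :=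
  MemLp w 2 (volume.restrict A) ∧
  MemLp (fun z : E d × E d => |w z.1 - w z.2| / ‖z.1 - z.2‖ ^ ((d : ℝ) / 2 + s)) 2
    ((volume.restrict A).prod (volume.restrict A))

/-- The inner product of `H^s(A)`. -/
def hsInner {d : ℕ} (A : Set (E d)) (s : ℝ) (u w : E d → ℝ) : ℝ :=
  (∫ x in A, u x * w x) +
    cds d s / 2 * ∫ z : E d × E d,
      (u z.1 - u z.2) * (w z.1 - w z.2) / ‖z.1 - z.2‖ ^ ((d : ℝ) + 2 * s)
      ∂((volume.restrict A).prod (volume.restrict A))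

/-- The norm of `H^s(A)`. -/
def hsNorm {d : ℕ} (A : Set (E d)) (s : ℝ) (w : E d → ℝ) : ℝ :=
  Real.sqrt (hsInner A s w w)

/-! ### The spectral fractional Sobolev space -/

/-- `φ ∈ H_0^1(Ω)` with weak gradient `G`: the pair `(φ, G)` is an `L²`-limit of pairs `(v, ∇v)`
with `v ∈ C_c^∞(Ω)`. -/
def MemH01 {d : ℕ} (Ω : Set (E d)) (φ : E d → ℝ) (G : E d → E d) : Prop :=
  MemLp φ 2 (volume.restrict Ω) ∧ MemLp G 2 (volume.restrict Ω) ∧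
  ∀ ε : ℝ≥0∞, 0 < ε → ∃ v, IsTestFunction Ω v ∧
    eLpNorm (fun x => φ x - v x) 2 (volume.restrict Ω) < ε ∧
    eLpNorm (fun x => G x - gradient v x) 2 (volume.restrict Ω) < ε

/-- `φ ∈ H_0^1(Ω)` and `-Δ φ = l φ` weakly in `Ω`. -/
def IsDirichletEigen {d : ℕ} (Ω : Set (E d)) (l : ℝ) (φ : L2 Ω) : Prop :=
  ∃ G : E d → E d, MemH01 Ω φ G ∧ ∀ v, IsTestFunction Ω v →
    ∫ x in Ω, ⟪G x, gradient v x⟫_ℝ = l * ∫ x in Ω, φ x * v x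

/-- The (closed) eigenspace in `L²(Ω)` of the Dirichlet Laplacian `-Δ` to the number `l`
(the zero space unless `l` is an eigenvalue, in particular for all `l ≤ 0`). The weak
eigenfunctions to `l` already form a closed subspace, so passing to the closed span adds
nothing. -/
def eigenspace {d : ℕ} (Ω : Set (E d)) (l : ℝ) : Submodule ℝ (L2 Ω) :=
  (Submodule.span ℝ {φ : L2 Ω | IsDirichletEigen Ω l φ}).topologicalClosure

instance {d : ℕ} (Ω : Set (E d)) (l : ℝ) : CompleteSpace (eigenspace Ω l) :=
  Submodule.topologicalClosure.completeSpace _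

/-- The `L²(Ω)`-orthogonal projection onto the eigenspace to `l`. For an orthonormal basis `φ_n` of
eigenfunctions with eigenvalues `λ_n` it is `w ↦ ∑_{n : λ_n = l} w_n φ_n`, `w_n = ∫ w φ_n`. -/
def eigenProj {d : ℕ} (Ω : Set (E d)) (l : ℝ) (w : L2 Ω) : L2 Ω :=
  (eigenspace Ω l).starProjection w

/-- `w ∈ ℍ^s(Ω)`: `∑_n λ_n^s w_n² < ∞`, the sum being grouped by eigenvalues. -/
def MemSpectral {d : ℕ} (Ω : Set (E d)) (s : ℝ) (w : L2 Ω) : Prop :=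
  Summable fun l : ℝ => l ^ s * ‖eigenProj Ω l w‖ ^ 2

/-- The inner product `∑_n λ_n^s u_n w_n` of `ℍ^s(Ω)`, the sum being grouped by eigenvalues. -/
def spectralInner {d : ℕ} (Ω : Set (E d)) (s : ℝ) (u w : L2 Ω) : ℝ :=
  ∑' l : ℝ, l ^ s * ⟪eigenProj Ω l u, eigenProj Ω l w⟫_ℝ

/-! ### The space `W` -/

/-- The four choices of the space `W`: `H^s(Ω)`, `H_0^s(Ω)`, `H̃^s(Ω)`, `ℍ^s(Ω)`. -/
inductive FracSpace
  | Hs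
  | Hs0
  | HsTilde
  | spectral

/-- The elements of `W`, as a set of functions in `L²(Ω)`. An element of `H̃^s(Ω)`, which is a
function in `H^s(ℝ^d)` vanishing outside `Ω`, is identified with its restriction to `Ω`. -/
def FracSpace.carrier {d : ℕ} (Ω : Set (E d)) (s : ℝ) : FracSpace → Set (L2 Ω)
  | .Hs => {w | MemHs Ω s w}
  | .Hs0 => {w | MemHs Ω s w ∧
      ∀ ε : ℝ, 0 < ε → ∃ v, IsTestFunction Ω v ∧ hsNorm Ω s (fun x => w x - v x) < ε}
  | .HsTilde => {w | MemHs univ s (Ω.indicator w)}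
  | .spectral => {w | MemSpectral Ω s w}

/-- The inner product `(u, w)_W`. -/
def FracSpace.inner {d : ℕ} (Ω : Set (E d)) (s : ℝ) : FracSpace → L2 Ω → L2 Ω → ℝ
  | .Hs, u, w => hsInner Ω s u w
  | .Hs0, u, w => hsInner Ω s u w
  | .HsTilde, u, w => hsInner univ s (Ω.indicator u) (Ω.indicator w)
  | .spectral, u, w => spectralInner Ω s u w

/-- The norm `‖w‖_W`. -/
def FracSpace.norm {d : ℕ} (W : FracSpace) (Ω : Set (E d)) (s : ℝ) (w : L2 Ω) : ℝ :=
  Real.sqrt (W.inner Ω s w w)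

/-- The continuous embedding `W ↪ L^q(Ω)`. -/
def FracSpace.EmbedsLp {d : ℕ} (W : FracSpace) (Ω : Set (E d)) (s : ℝ) (q : ℝ≥0∞) : Prop :=
  ∃ C : ℝ, ∀ w ∈ W.carrier Ω s,
    eLpNorm w q (volume.restrict Ω) ≤ ENNReal.ofReal (C * W.norm Ω s w)

/-! ### The optimization problem -/

/-- The admissible set `K`. -/
def admissible {d : ℕ} (W : FracSpace) (Ω : Set (E d)) (s T : ℝ) : Set (U T Ω × L2 Ω) :=
  {z | z.2 ∈ W.carrier Ω s ∧ ∀ᵐ y ∂(cylMeasure T Ω), |z.1 y| ≤ z.2 y.2}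

/-- The objective
`f(u) + α/2 ‖u‖_U² + β/2 ‖w‖_W² + γ ∫_Ω |w|^p dx`. -/
def objective {d : ℕ} (W : FracSpace) (Ω : Set (E d)) (s T : ℝ) (f : U T Ω → ℝ)
    (α β γ p : ℝ) (u : U T Ω) (w : L2 Ω) : ℝ :=
  f u + α / 2 * ‖u‖ ^ 2 + β / 2 * W.norm Ω s w ^ 2 + γ * ∫ x in Ω, |w x| ^ p

/-- `(u₀, w₀)` is a local solution of the problem of minimizing the objective over `K`. -/
def IsLocalSolution {d : ℕ} (W : FracSpace) (Ω : Set (E d)) (s T : ℝ) (f : U T Ω → ℝ)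
    (α β γ p : ℝ) (u₀ : U T Ω) (w₀ : L2 Ω) : Prop :=
  (u₀, w₀) ∈ admissible W Ω s T ∧
  ∃ ρ : ℝ, 0 < ρ ∧ ∀ u w, (u, w) ∈ admissible W Ω s T →
    ‖u - u₀‖ ≤ ρ → W.norm Ω s (w - w₀) ≤ ρ →
    objective W Ω s T f α β γ p u₀ w₀ ≤ objective W Ω s T f α β γ p u w

/-- (Sequential) weak lower semicontinuity on a real Hilbert space: `u_n ⇀ u` implies
`f(u) ≤ liminf f(u_n)`. -/
def WeaklyLSC {H : Type*} [NormedAddCommGroup H] [InnerProductSpace ℝ H] (f : H → ℝ) : Prop :=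
  ∀ (u : ℕ → H) (u₀ : H), (∀ v : H, Tendsto (fun n => ⟪v, u n⟫_ℝ) atTop (𝓝 ⟪v, u₀⟫_ℝ)) →
    ∀ c < f u₀, ∀ᶠ n in atTop, c < f (u n)

end FracControl

end

noncomputable section

namespace FracControl

variable {d : ℕ} {Ω : Set (E d)} {s T : ℝ}

/-! ### Truncation -/

/-! The argument is Stampacchia's truncation method. For a level `k` let `g = w₀ - min(w₀, k)` be
the excess and let `v` be `u₀` minus its clamp to `[-k, k]`. The pair `(u₀ - t v, w₀ - t g)` is
admissible for `0 ≤ t ≤ 1`, and it is close to the solution for small `t`. Moving along it does not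
increase `∫ |w|^p`, because `|w|` shrinks pointwise; the singular nonconvex term therefore never has
to be differentiated. The quadratic term in `u` has the right sign at first order, since `⟪u₀, v⟫ ≥
0`. The `W`-energy drops by at least `(2t - t²)` times the energy of `g`, which is the property
`SplitsTruncation`; it amounts to `(g, w₀ - g)_W ≥ 0`. Dividing by `t` and letting `t → 0` gives `β
‖g‖_W² ≤ -f'(u₀) v ≤ ∫ F |g|` with `F(x) = ‖f'(u₀)(·, x)‖_{L¹(I)}`, because `|v| ≤ g`.

The embedding into `L^q` and Hölder's inequality with `F ∈ L^r` turn this into `(j - k) μ{w₀ > j} ≤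
C μ{w₀ > k}^(1 + δ)` for `j > k ≥ 0`, where `δ = 1 - 1/r - 2/q > 0`. De Giorgi's iteration
(`exists_eq_zero_of_levelset_decay`) makes some level set null. As `|u₀| ≤ w₀`, both functions are
bounded.

What remains is `SplitsTruncation` for the four spaces. For `H^s(Ω)` and `H̃^s(Ω)` the energy is a
double integral and the inequality holds pointwise, since truncation and excess are both
nondecreasing. For `H_0^s(Ω)` one must also see that truncation preserves limits of test functions;
this uses smooth truncations and Vitali's theorem (`memHs0_comp`).

For `ℍ^s(Ω)` the energy has no such pointwise form. There `l^s` is an integral over `t > 0` of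
`t^(s-1) l/(t + l)`, and the quadratic form with weights `l/(t + l)` is the infimum over `z ∈
H_0^1(Ω)` of `‖w - z‖² + t⁻¹ ‖∇z‖²`. If `η` is a smooth truncation, `η(z)` and `z - η(z)` compete
for `η(w)` and `w - η(w)`, and their two costs add up to at most the cost of `z`. Thus the weighted
forms split, and after integration in `t` so does the spectral energy. The infimum formula rests on
completeness of the Dirichlet eigenspaces, which comes from Rellich's theorem and the spectral
theorem for the compact operator `ι ι*`, the inverse of `1 - Δ`. -/

lemma lipschitzWith_min_const (k : ℝ) : LipschitzWith 1 (fun x : ℝ => min x k) :=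
  LipschitzWith.id.min_const k

lemma lipschitzWith_clamp (k : ℝ) : LipschitzWith 1 (fun x : ℝ => max (-k) (min x k)) :=
  (lipschitzWith_min_const k).const_max (-k)

lemma clamp_zero (k : ℝ≥0) : max (-(k : ℝ)) (min 0 k) = 0 := by
  rw [min_eq_left k.coe_nonneg]; exact max_eq_right (neg_nonpos.2 k.coe_nonneg)

/-- The upper truncation `min(w, k)` in `L²(Ω)`. -/
def truncAbove (k : ℝ≥0) (w : L2 Ω) : L2 Ω :=
  (lipschitzWith_min_const (k : ℝ)).compLp (min_eq_left k.coe_nonneg) w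

/-- The excess `w - min(w, k)` in `L²(Ω)`. -/
def excess (k : ℝ≥0) (w : L2 Ω) : L2 Ω := w - truncAbove k w

lemma coeFn_truncAbove (k : ℝ≥0) (w : L2 Ω) :
    truncAbove k w =ᵐ[volume.restrict Ω] fun x => min (w x) k :=
  (lipschitzWith_min_const (k : ℝ)).coeFn_compLp _ _

lemma coeFn_excess (k : ℝ≥0) (w : L2 Ω) :
    excess k w =ᵐ[volume.restrict Ω] fun x => w x - min (w x) k := by
  filter_upwards [Lp.coeFn_sub w (truncAbove k w), coeFn_truncAbove k w] with x h1 h2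
  rw [excess, h1, Pi.sub_apply, h2]

/-- The two-sided truncation of `u` at height `k` in `L²(I × Ω)`. -/
def clampCyl (k : ℝ≥0) (u : U T Ω) : U T Ω :=
  (lipschitzWith_clamp (k : ℝ)).compLp
    (clamp_zero k) u

lemma coeFn_sub_clampCyl (k : ℝ≥0) (u : U T Ω) :
    (u - clampCyl k u : U T Ω) =ᵐ[cylMeasure T Ω] fun y => u y - max (-(k : ℝ)) (min (u y) k) := by
  filter_upwards [Lp.coeFn_sub u (clampCyl k u),
    (lipschitzWith_clamp (k : ℝ)).coeFn_compLp
      (clamp_zero k) u] with x h1 h2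
  rw [h1, Pi.sub_apply, clampCyl, h2]; rfl

/-- The truncation property of the space `W` used in the regularity proof: cutting off a part of
the excess of `w` above the level `k` stays in `W` and lowers the energy. -/
structure SplitsTruncation (W : FracSpace) (Ω : Set (E d)) (s : ℝ) (w : L2 Ω) (k : ℝ≥0) :
    Prop where
  excess_mem : excess k w ∈ W.carrier Ω s
  sub_smul_mem : ∀ t : ℝ, 0 ≤ t → t ≤ 1 → w - t • excess k w ∈ W.carrier Ω s
  inner_le : ∀ t : ℝ, 0 ≤ t → t ≤ 1 →
    W.inner Ω s (w - t • excess k w) (w - t • excess k w)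
      + (2 * t - t ^ 2) * W.inner Ω s (excess k w) (excess k w) ≤ W.inner Ω s w w

/-! ### Elementary properties of the energy -/

lemma cds_nonneg (d : ℕ) {s : ℝ} (hs0 : 0 < s) (hs1 : s < 1) : 0 ≤ cds d s := by
  unfold cds
  have h1 : 0 < Real.Gamma (s + d / 2) := Real.Gamma_pos_of_pos (by positivity)
  have h2 : 0 < Real.Gamma (1 - s) := Real.Gamma_pos_of_pos (by linarith)
  positivity

lemma hsInner_self_nonneg (A : Set (E d)) (hs0 : 0 < s) (hs1 : s < 1) (w : E d → ℝ) :
    0 ≤ hsInner A s w w := by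
  unfold hsInner
  have h := cds_nonneg d hs0 hs1
  have h1 : 0 ≤ ∫ x in A, w x * w x := integral_nonneg fun x => mul_self_nonneg _
  have h2 : 0 ≤ ∫ z : E d × E d,
      (w z.1 - w z.2) * (w z.1 - w z.2) / ‖z.1 - z.2‖ ^ ((d : ℝ) + 2 * s)
      ∂((volume.restrict A).prod (volume.restrict A)) :=
    integral_nonneg fun z => div_nonneg (mul_self_nonneg _) (by positivity)
  positivity

lemma hsInner_congr {A : Set (E d)} {u u' w w' : E d → ℝ}
    (hu : u =ᵐ[volume.restrict A] u') (hw : w =ᵐ[volume.restrict A] w') :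
    hsInner A s u w = hsInner A s u' w' := by
  have hu1 := Measure.quasiMeasurePreserving_fst (μ := (volume.restrict A))
    (ν := (volume.restrict A)) |>.ae hu
  have hu2 := Measure.quasiMeasurePreserving_snd (μ := (volume.restrict A))
    (ν := (volume.restrict A)) |>.ae hu
  have hw1 := Measure.quasiMeasurePreserving_fst (μ := (volume.restrict A))
    (ν := (volume.restrict A)) |>.ae hw
  have hw2 := Measure.quasiMeasurePreserving_snd (μ := (volume.restrict A))
    (ν := (volume.restrict A)) |>.ae hw
  unfold hsInner
  congr 1
  · apply integral_congr_ae
    filter_upwards [hu, hw] with x h1 h2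
    rw [h1, h2]
  · congr 1
    apply integral_congr_ae
    filter_upwards [hu1, hu2, hw1, hw2] with x h1 h2 h3 h4
    rw [h1, h2, h3, h4]

lemma hsInner_smul_self (A : Set (E d)) (t : ℝ) (w : E d → ℝ) :
    hsInner A s (fun x => t * w x) (fun x => t * w x) = t ^ 2 * hsInner A s w w := by
  unfold hsInner
  have h1 : ∫ x in A, t * w x * (t * w x) = t ^ 2 * ∫ x in A, w x * w x := by
    rw [← integral_const_mul]; congr 1; ext x; ring
  have h2 : ∫ z : E d × E d,
      (t * w z.1 - t * w z.2) * (t * w z.1 - t * w z.2) / ‖z.1 - z.2‖ ^ ((d : ℝ) + 2 * s)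
      ∂((volume.restrict A).prod (volume.restrict A)) = t ^ 2 * ∫ z : E d × E d,
      (w z.1 - w z.2) * (w z.1 - w z.2) / ‖z.1 - z.2‖ ^ ((d : ℝ) + 2 * s)
      ∂((volume.restrict A).prod (volume.restrict A)) := by
    rw [← integral_const_mul]; congr 1; ext x; ring
  rw [h1, h2]; ring

lemma indicator_smul_ae (hΩ : MeasurableSet Ω) (t : ℝ) (w : L2 Ω) :
    Ω.indicator (t • w : L2 Ω) =ᵐ[volume.restrict univ] fun x => t * Ω.indicator w x := by
  have h := Lp.coeFn_smul t w
  rw [Filter.EventuallyEq, ae_restrict_iff' hΩ] at h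
  rw [Measure.restrict_univ]
  filter_upwards [h] with x hx
  by_cases hxΩ : x ∈ Ω
  · simp [indicator_of_mem hxΩ, hx hxΩ]
  · simp [indicator_of_notMem hxΩ]

lemma eigenProj_smul (l t : ℝ) (w : L2 Ω) : eigenProj Ω l (t • w) = t • eigenProj Ω l w :=
  map_smul _ _ _

lemma FracSpace.inner_smul_self (W : FracSpace) (hΩ : MeasurableSet Ω) (t : ℝ) (w : L2 Ω) :
    W.inner Ω s (t • w) (t • w) = t ^ 2 * W.inner Ω s w w := by
  cases W
  · exact (hsInner_congr (Lp.coeFn_smul t w) (Lp.coeFn_smul t w)).trans (hsInner_smul_self _ _ _)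
  · exact (hsInner_congr (Lp.coeFn_smul t w) (Lp.coeFn_smul t w)).trans (hsInner_smul_self _ _ _)
  · exact (hsInner_congr (indicator_smul_ae hΩ t w) (indicator_smul_ae hΩ t w)).trans
      (hsInner_smul_self _ _ _)
  · simp only [FracSpace.inner, spectralInner]
    rw [← tsum_mul_left]
    congr 1; ext l
    rw [eigenProj_smul, real_inner_smul_left, real_inner_smul_right]; ring

/-! ### The variational inequality for the excess -/

/-- The constraint `|a| ≤ b` survives truncating both sides at `k`, and it defines a convex set; the
new pair is a convex combination of the old one and the truncated one. -/
lemma abs_sub_smul_excess_le {a b k t : ℝ} (hk : 0 ≤ k) (hab : |a| ≤ b) (ht0 : 0 ≤ t)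
    (ht1 : t ≤ 1) :
    |a - t * (a - max (-k) (min a k))| ≤ b - t * (b - min b k) := by
  have h1 : |max (-k) (min a k)| ≤ min b k := by
    rw [abs_le] at hab ⊢
    constructor
    · rw [neg_le]
      rcases min_cases b k with h | h <;> rcases min_cases a k with h' | h' <;>
      rcases max_cases (-k) (min a k) with h'' | h'' <;> linarith
    · rcases min_cases b k with h | h <;> rcases min_cases a k with h' | h' <;>
      rcases max_cases (-k) (min a k) with h'' | h'' <;> linarith
  calc |a - t * (a - max (-k) (min a k))| = |(1 - t) * a + t * max (-k) (min a k)| := by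
        congr 1; ring
    _ ≤ |(1 - t) * a| + |t * max (-k) (min a k)| := abs_add_le _ _
    _ = (1 - t) * |a| + t * |max (-k) (min a k)| := by
        rw [abs_mul, abs_mul, abs_of_nonneg ht0, abs_of_nonneg (sub_nonneg.2 ht1)]
    _ ≤ (1 - t) * b + t * min b k := by
        have := sub_nonneg.2 ht1
        gcongr
    _ = _ := by ring

/-- The left side is `(|a| - k)⁺` and the right side is `(b - k)⁺`. This transfers the estimate from
the control to the excess of its bound. -/
lemma abs_sub_clamp_le {a b k : ℝ} (hk : 0 ≤ k) (hab : |a| ≤ b) :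
    |a - max (-k) (min a k)| ≤ b - min b k := by
  rw [abs_le] at hab ⊢
  constructor <;>
  · rcases min_cases b k with h | h <;> rcases min_cases a k with h' | h' <;>
    rcases max_cases (-k) (min a k) with h'' | h'' <;> linarith

lemma mul_sub_clamp_nonneg {a k : ℝ} (hk : 0 ≤ k) : 0 ≤ a * (a - max (-k) (min a k)) := by
  rcases min_cases a k with h' | h' <;>
  rcases max_cases (-k) (min a k) with h'' | h'' <;> nlinarith

lemma abs_sub_smul_excess_le_abs {b k t : ℝ} (hk : 0 ≤ k) (ht0 : 0 ≤ t) (ht1 : t ≤ 1) :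
    |b - t * (b - min b k)| ≤ |b| := by
  rcases min_cases b k with h | h
  · rw [h.1]; simp
  · rw [h.1, abs_of_nonneg (by nlinarith), abs_of_nonneg (by linarith)]
    nlinarith

/-- For `0 < p < 1` one has `|w|^p ≤ 1 + |w|`, which is integrable on a finite measure space. -/
lemma integrable_abs_rpow [IsFiniteMeasure ((volume : Measure (E d)).restrict Ω)] {p : ℝ}
    (hp0 : 0 < p) (hp1 : p < 1) (w : L2 Ω) :
    Integrable (fun x => |w x| ^ p) (volume.restrict Ω) := by
  have h2 : Integrable (fun x => 1 + |w x|) (volume.restrict Ω) :=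
    (integrable_const _).add ((Lp.memLp w).integrable (by norm_num)).abs
  refine h2.mono' ?_ (ae_of_all _ fun x => ?_)
  · exact ((Lp.aestronglyMeasurable w).aemeasurable.abs.pow_const p).aestronglyMeasurable
  · rw [Real.norm_of_nonneg (by positivity)]
    rcases le_total (|w x|) 1 with h | h
    · have := Real.rpow_le_one (abs_nonneg _) h hp0.le
      linarith [abs_nonneg (w x)]
    · have := Real.rpow_le_rpow_of_exponent_le h hp1.le
      rw [Real.rpow_one] at this
      linarith

lemma coeFn_sub_smul_excess (k : ℝ≥0) (t : ℝ) (w : L2 Ω) :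
    (w - t • excess k w : L2 Ω) =ᵐ[volume.restrict Ω] fun x => w x - t * (w x - min (w x) k) := by
  filter_upwards [Lp.coeFn_sub w (t • excess k w), Lp.coeFn_smul t (excess k w),
    coeFn_excess k w] with x h1 h2 h3
  rw [h1, Pi.sub_apply, h2, Pi.smul_apply, h3, smul_eq_mul]

lemma coeFn_sub_smul_sub_clampCyl (k : ℝ≥0) (t : ℝ) (u : U T Ω) :
    (u - t • (u - clampCyl k u) : U T Ω) =ᵐ[cylMeasure T Ω]
      fun y => u y - t * (u y - max (-(k : ℝ)) (min (u y) k)) := by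
  filter_upwards [Lp.coeFn_sub u (t • (u - clampCyl k u)), Lp.coeFn_smul t (u - clampCyl k u),
    coeFn_sub_clampCyl k u] with x h1 h2 h3
  rw [h1, Pi.sub_apply, h2, Pi.smul_apply, h3, smul_eq_mul]

lemma ae_cyl_of_ae {P : E d → Prop} (h : ∀ᵐ x ∂(volume.restrict Ω), P x) :
    ∀ᵐ y ∂(cylMeasure T Ω), P y.2 :=
  Measure.quasiMeasurePreserving_snd.ae h

lemma admissible_sub_smul {W : FracSpace} {k : ℝ≥0} {u₀ : U T Ω} {w₀ : L2 Ω}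
    (hadm : (u₀, w₀) ∈ admissible W Ω s T) (hW : SplitsTruncation W Ω s w₀ k) {t : ℝ}
    (ht0 : 0 ≤ t) (ht1 : t ≤ 1) :
    (u₀ - t • (u₀ - clampCyl k u₀), w₀ - t • excess k w₀) ∈ admissible W Ω s T := by
  refine ⟨hW.sub_smul_mem t ht0 ht1, ?_⟩
  filter_upwards [hadm.2, coeFn_sub_smul_sub_clampCyl k t u₀,
    ae_cyl_of_ae (T := T) (coeFn_sub_smul_excess k t w₀)] with y h1 h2 h3
  rw [h2, h3]
  exact abs_sub_smul_excess_le k.coe_nonneg h1 ht0 ht1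

/-- Only monotonicity of `x ↦ x^p` on `[0, ∞)` enters, so neither convexity nor differentiability of
the penalty is needed. -/
lemma integral_rpow_sub_smul_excess_le
    [IsFiniteMeasure ((volume : Measure (E d)).restrict Ω)] {p : ℝ}
    (hp0 : 0 < p) (hp1 : p < 1) (k : ℝ≥0) (w : L2 Ω) {t : ℝ} (ht0 : 0 ≤ t) (ht1 : t ≤ 1) :
    ∫ x in Ω, |(w - t • excess k w : L2 Ω) x| ^ p ≤ ∫ x in Ω, |w x| ^ p := by
  apply integral_mono_ae (integrable_abs_rpow hp0 hp1 _) (integrable_abs_rpow hp0 hp1 _)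
  filter_upwards [coeFn_sub_smul_excess k t w] with x h
  simp only [h]
  exact Real.rpow_le_rpow (abs_nonneg _) (abs_sub_smul_excess_le_abs k.coe_nonneg ht0 ht1) hp0.le

lemma inner_sub_clampCyl_nonneg (k : ℝ≥0) (u : U T Ω) : 0 ≤ ⟪u, u - clampCyl k u⟫_ℝ := by
  rw [L2.inner_def]
  apply integral_nonneg_of_ae
  filter_upwards [coeFn_sub_clampCyl k u] with y hy
  rw [hy, real_inner_comm]
  exact mul_sub_clamp_nonneg k.coe_nonneg

lemma FracSpace.norm_sq {W : FracSpace} (hW : ∀ w : L2 Ω, 0 ≤ W.inner Ω s w w) (w : L2 Ω) :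
    W.norm Ω s w ^ 2 = W.inner Ω s w w := Real.sq_sqrt (hW w)

/-- First order condition at a local solution, in the direction of the truncation. -/
lemma fderiv_add_inner_excess_nonpos
    [IsFiniteMeasure ((volume : Measure (E d)).restrict Ω)] (hΩ : MeasurableSet Ω)
    {W : FracSpace} (hpos : ∀ w : L2 Ω, 0 ≤ W.inner Ω s w w)
    {f : U T Ω → ℝ} {α β γ p : ℝ} (hα : 0 < α) (hβ : 0 < β) (hγ : 0 < γ) (hp0 : 0 < p)
    (hp1 : p < 1) {u₀ : U T Ω} {w₀ : L2 Ω} (hf : DifferentiableAt ℝ f u₀)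
    (hsol : IsLocalSolution W Ω s T f α β γ p u₀ w₀) {k : ℝ≥0}
    (hW : SplitsTruncation W Ω s w₀ k) :
    β * W.inner Ω s (excess k w₀) (excess k w₀) ≤ -fderiv ℝ f u₀ (u₀ - clampCyl k u₀) := by
  obtain ⟨hadm, ρ, hρ, hmin⟩ := hsol
  set g := excess k w₀ with hg
  set v := u₀ - clampCyl k u₀ with hv
  set N := W.inner Ω s g g with hN
  have hNn : 0 ≤ N := hpos g
  have hsmall : ∀ᶠ t : ℝ in 𝓝[>] 0, t ≤ 1 ∧ t * ‖v‖ ≤ ρ ∧ t * W.norm Ω s g ≤ ρ := by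
    have h1 : ∀ c : ℝ, ∀ᶠ t : ℝ in 𝓝[>] 0, t * c ≤ ρ := fun c => by
      have : Tendsto (fun t : ℝ => t * c) (𝓝[>] 0) (𝓝 (0 * c)) :=
        ((continuous_id.mul continuous_const).tendsto _).mono_left nhdsWithin_le_nhds
      rw [zero_mul] at this
      exact (this.eventually (gt_mem_nhds hρ)).mono fun t ht => le_of_lt ht
    have h2 : ∀ᶠ t : ℝ in 𝓝[>] 0, t ≤ 1 :=
      eventually_nhdsWithin_of_eventually_nhds
        ((gt_mem_nhds one_pos).mono fun t ht => le_of_lt ht)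
    exact h2.and ((h1 _).and (h1 _))
  -- Minimality divided by `t`: the penalty term and the first-order part of the `α`-term have a
  -- favourable sign and are dropped, so besides the difference quotient of `f` only a remainder of
  -- order `t` is left.
  have hineq : ∀ᶠ t : ℝ in 𝓝[>] 0,
      β * N ≤ t⁻¹ * (f (u₀ - t • v) - f u₀) + t * (α / 2 * ‖v‖ ^ 2 + β / 2 * N) := by
    filter_upwards [hsmall, self_mem_nhdsWithin] with t ht (ht0 : 0 < t)
    obtain ⟨ht1, hu, hw⟩ := ht
    have hm := hmin _ _ (admissible_sub_smul hadm hW ht0.le ht1)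
      (by rw [sub_sub_cancel_left, norm_neg, norm_smul, Real.norm_of_nonneg ht0.le]; exact hu)
      (by
        rw [sub_sub_cancel_left, ← neg_smul, FracSpace.norm, W.inner_smul_self hΩ, neg_sq,
          Real.sqrt_mul (sq_nonneg t), Real.sqrt_sq ht0.le]
        exact hw)
    unfold objective at hm
    rw [FracSpace.norm_sq hpos, FracSpace.norm_sq hpos] at hm
    have hi := hW.inner_le t ht0.le ht1
    have hP := integral_rpow_sub_smul_excess_le hp0 hp1 k w₀ ht0.le ht1
    have hun : ‖u₀ - t • v‖ ^ 2 = ‖u₀‖ ^ 2 - 2 * (t * ⟪u₀, v⟫_ℝ) + t ^ 2 * ‖v‖ ^ 2 := by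
      rw [norm_sub_sq_real, real_inner_smul_right, norm_smul, mul_pow, Real.norm_eq_abs, sq_abs]
    have hin := inner_sub_clampCyl_nonneg k u₀
    rw [← hv] at hin hm
    rw [← hg] at hm hP hi
    rw [hun] at hm
    have h3 : β / 2 * (W.inner Ω s (w₀ - t • g) (w₀ - t • g) + (2 * t - t ^ 2) * N)
        ≤ β / 2 * W.inner Ω s w₀ w₀ := by gcongr
    have h4 : γ * ∫ x in Ω, |(w₀ - t • g : L2 Ω) x| ^ p ≤ γ * ∫ x in Ω, |w₀ x| ^ p := by gcongr
    have h5 : 0 ≤ α * (t * ⟪u₀, v⟫_ℝ) := by positivity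
    have h6 : t * (β * N) ≤ t * (t⁻¹ * (f (u₀ - t • v) - f u₀)
        + t * (α / 2 * ‖v‖ ^ 2 + β / 2 * N)) := by
      rw [mul_add, ← mul_assoc t t⁻¹, mul_inv_cancel₀ ht0.ne']
      nlinarith
    exact le_of_mul_le_mul_left h6 ht0
  have hder : HasDerivAt (fun t : ℝ => f (u₀ - t • v)) (-fderiv ℝ f u₀ v) 0 := by
    have h1 : HasDerivAt (fun t : ℝ => u₀ - t • v) (-v) 0 := by
      simpa using ((hasDerivAt_id (0 : ℝ)).smul_const v).const_sub u₀
    have h2 : HasFDerivAt f (fderiv ℝ f u₀) (u₀ - (0 : ℝ) • v) := by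
      rw [zero_smul, sub_zero]; exact hf.hasFDerivAt
    have := h2.comp_hasDerivAt (0 : ℝ) h1
    rwa [map_neg] at this
  have hlim := (hasDerivAt_iff_tendsto_slope_zero.1 hder).mono_left
    (nhdsWithin_mono (0 : ℝ) (fun t (ht : t ∈ Ioi 0) => ne_of_gt ht))
  have hlim2 : Tendsto (fun t : ℝ => t * (α / 2 * ‖v‖ ^ 2 + β / 2 * N)) (𝓝[>] 0) (𝓝 0) := by
    have hc : Continuous fun t : ℝ => t * (α / 2 * ‖v‖ ^ 2 + β / 2 * N) := by fun_prop
    have := (hc.tendsto 0).mono_left (nhdsWithin_le_nhds (s := Ioi 0))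
    simpa using this
  have := ge_of_tendsto (hlim.add hlim2) (hineq.mono fun t ht => by
    simpa only [zero_add, zero_smul, sub_zero, smul_eq_mul] using ht)
  simpa using this

/-- The energy of the excess is controlled by the derivative of `f`. -/
lemma inner_excess_le_integral
    [IsFiniteMeasure ((volume : Measure (E d)).restrict Ω)] (hΩ : MeasurableSet Ω)
    {W : FracSpace} (hpos : ∀ w : L2 Ω, 0 ≤ W.inner Ω s w w)
    {f : U T Ω → ℝ} {α β γ p : ℝ} (hα : 0 < α) (hβ : 0 < β) (hγ : 0 < γ) (hp0 : 0 < p)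
    (hp1 : p < 1) {u₀ : U T Ω} {w₀ : L2 Ω} (hf : DifferentiableAt ℝ f u₀)
    (hsol : IsLocalSolution W Ω s T f α β γ p u₀ w₀) {k : ℝ≥0}
    (hW : SplitsTruncation W Ω s w₀ k) :
    β * W.inner Ω s (excess k w₀) (excess k w₀) ≤
      ∫ x in Ω, (∫ t in Ioo 0 T, |gradient f u₀ (t, x)|) * |excess k w₀ x| := by
  have h := fderiv_add_inner_excess_nonpos hΩ hpos hα hβ hγ hp0 hp1 hf hsol hW
  refine h.trans ?_
  have hG : MemLp (fun y => |gradient f u₀ y|) 2 (cylMeasure T Ω) := (Lp.memLp _).abs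
  have hg : MemLp (fun y : ℝ × E d => |excess k w₀ y.2|) 2 (cylMeasure T Ω) :=
    (Lp.memLp (excess k w₀)).abs.comp_snd _
  have hint : Integrable (fun y : ℝ × E d => |gradient f u₀ y| * |excess k w₀ y.2|)
    (cylMeasure T Ω) := hG.integrable_mul hg
  calc -fderiv ℝ f u₀ (u₀ - clampCyl k u₀)
      = -⟪gradient f u₀, u₀ - clampCyl k u₀⟫_ℝ := by rw [inner_gradient_left]
    _ ≤ ∫ y, |gradient f u₀ y| * |excess k w₀ y.2| ∂(cylMeasure T Ω) := by
        rw [L2.inner_def, ← integral_neg]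
        refine integral_mono_ae (L2.integrable_inner _ _).neg hint ?_
        filter_upwards [hsol.1.2, coeFn_sub_clampCyl k u₀,
          ae_cyl_of_ae (T := T) (coeFn_excess k w₀)] with y h1 h2 h3
        have h4 := abs_sub_clamp_le k.coe_nonneg h1
        have h5 : -⟪gradient f u₀ y, (u₀ - clampCyl k u₀ : U T Ω) y⟫_ℝ ≤
          |gradient f u₀ y| * |(u₀ - clampCyl k u₀ : U T Ω) y| := by
          rw [← abs_mul]
          refine (neg_le_abs _).trans (le_of_eq ?_)
          rw [real_inner_comm]; rfl
        refine h5.trans (mul_le_mul_of_nonneg_left ?_ (abs_nonneg _))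
        rw [h2, h3]
        exact h4.trans (le_abs_self _)
    -- Fubini with time innermost, since the excess does not depend on time.
    _ = ∫ x in Ω, ∫ t in Ioo 0 T, |gradient f u₀ (t, x)| * |excess k w₀ x| :=
        integral_prod_symm _ hint
    _ = _ := by
        congr 1; ext x
        rw [integral_mul_const]

/-! ### Boundedness by De Giorgi iteration -/

/-- De Giorgi's iteration: a level set function with superlinear decay vanishes eventually. -/
lemma exists_eq_zero_of_levelset_decay {m : ℝ → ℝ} (hm : ∀ k, 0 ≤ m k) (hanti : Antitone m)
    {C δ : ℝ} (hδ : 0 < δ)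
    (h : ∀ k j, 0 ≤ k → k < j → (j - k) * m j ≤ C * m k ^ (1 + δ)) :
    ∃ M, 0 ≤ M ∧ m M = 0 := by
  rcases (hm 0).eq_or_lt with h0 | h0
  · exact ⟨0, le_rfl, h0.symm⟩
  -- The ratio with `b ^ δ = 1/2`: the gain `b ^ (i δ)` from the superlinear exponent then balances
  -- exactly the halving of the level increments.
  set b : ℝ := (1 / 2 : ℝ) ^ (1 / δ) with hb
  have hb0 : 0 < b := by positivity
  have hb1 : b < 1 := Real.rpow_lt_one (by norm_num) (by norm_num) (by positivity)
  have hbδ : b ^ δ = 1 / 2 := by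
    rw [hb, ← Real.rpow_mul (by norm_num), one_div_mul_cancel hδ.ne', Real.rpow_one]
  -- The induction needs `|C| * m 0 ^ δ ≤ M * b`; the summand `1` keeps `M` positive when `C = 0`.
  set M : ℝ := 2 * |C| * m 0 ^ δ / b + 1 with hM
  have hM0 : 0 < M := by positivity
  have hMb : 2 * |C| * m 0 ^ δ ≤ M * b := by
    rw [hM, add_mul, div_mul_cancel₀ _ hb0.ne']; linarith
  -- The levels increase to `2 * M` by steps `M * (1/2) ^ i`, while `m` decays geometrically along
  -- them.
  have key : ∀ i : ℕ, m (M * (2 - 2 * (1 / 2) ^ i)) ≤ m 0 * b ^ i := by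
    intro i
    induction i with
    | zero => simp
    | succ i ih =>
      have hi : (0 : ℝ) < (1 / 2) ^ i := by positivity
      have hi1 : ((1 : ℝ) / 2) ^ i ≤ 1 := pow_le_one₀ (by norm_num) (by norm_num)
      have h1 := h (M * (2 - 2 * (1 / 2) ^ i)) (M * (2 - 2 * (1 / 2) ^ (i + 1)))
        (mul_nonneg hM0.le (by linarith)) (by
          apply mul_lt_mul_of_pos_left _ hM0
          rw [pow_succ]; linarith)
      have h2 : M * (2 - 2 * (1 / 2 : ℝ) ^ (i + 1)) - M * (2 - 2 * (1 / 2) ^ i)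
          = M * (1 / 2) ^ i := by rw [pow_succ]; ring
      rw [h2] at h1
      have h3 : m (M * (2 - 2 * (1 / 2) ^ i)) ^ (1 + δ) ≤ (m 0 * b ^ i) ^ (1 + δ) :=
        Real.rpow_le_rpow (hm _) ih (by positivity)
      have h4 : (m 0 * b ^ i) ^ (1 + δ) = m 0 * b ^ i * (m 0 ^ δ * (1 / 2) ^ i) := by
        rw [Real.rpow_add (by positivity), Real.rpow_one, Real.mul_rpow h0.le (by positivity),
          ← Real.rpow_natCast b i, ← Real.rpow_mul hb0.le, mul_comm (i : ℝ) δ,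
          Real.rpow_mul hb0.le, hbδ, Real.rpow_natCast, Real.rpow_natCast]
      rw [h4] at h3
      have h5 : M * (1 / 2) ^ i * m (M * (2 - 2 * (1 / 2) ^ (i + 1)))
          ≤ |C| * (m 0 * b ^ i * (m 0 ^ δ * (1 / 2) ^ i)) :=
        h1.trans ((mul_le_mul_of_nonneg_right (le_abs_self C)
          (Real.rpow_nonneg (hm _) _)).trans (mul_le_mul_of_nonneg_left h3 (abs_nonneg _)))
      have h6 : |C| * (m 0 * b ^ i * (m 0 ^ δ * (1 / 2) ^ i))
          ≤ M * (1 / 2) ^ i * (m 0 * b ^ (i + 1)) := by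
        have h7 : |C| * m 0 ^ δ ≤ M * b := by
          have : 0 ≤ |C| * m 0 ^ δ := by positivity
          linarith
        calc _ = (|C| * m 0 ^ δ) * (m 0 * b ^ i * (1 / 2) ^ i) := by ring
          _ ≤ (M * b) * (m 0 * b ^ i * (1 / 2) ^ i) := by gcongr
          _ = _ := by ring
      exact le_of_mul_le_mul_left (h5.trans h6) (by positivity)
  refine ⟨M * 2, by positivity, le_antisymm ?_ (hm _)⟩
  have hlim : Tendsto (fun i : ℕ => m 0 * b ^ i) atTop (𝓝 0) := by
    simpa using (tendsto_pow_atTop_nhds_zero_of_lt_one hb0.le hb1).const_mul (m 0)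
  refine ge_of_tendsto' hlim fun i => (hanti ?_).trans (key i)
  have : (0 : ℝ) < (1 / 2) ^ i := by positivity
  nlinarith

section Lebesgue

variable {X : Type*} [MeasurableSpace X] {μ : Measure X} [IsFiniteMeasure μ]

/-- An energy inequality for a function supported on `A` gives a superlinear bound of its integral
by the measure of `A`. -/
lemma lintegral_enorm_le_of_energy {F g : X → ℝ} {A : Set X} (hA : MeasurableSet A)
    (hgA : ∀ᵐ x ∂μ, x ∉ A → g x = 0) {r q : ℝ≥0∞} (hq : 2 < q) (hrq : 1 / r + 2 / q < 1)
    (hF : AEStronglyMeasurable F μ) (hg : AEStronglyMeasurable g μ) (hgq : eLpNorm g q μ ≠ ⊤)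
    {c : ℝ≥0∞} (hE : eLpNorm g q μ ^ 2 ≤ c * ∫⁻ x, ‖F x‖ₑ * ‖g x‖ₑ ∂μ) :
    ∫⁻ x, ‖g x‖ₑ ∂μ ≤ c * eLpNorm F r μ * μ A ^ (1 + (1 - r⁻¹.toReal - 2 * q⁻¹.toReal)) := by
  have hq1 : 1 ≤ q := one_le_two.trans hq.le
  have hqinv : q⁻¹ ≤ 1 := by simpa using hq1
  rw [one_div, div_eq_mul_inv] at hrq
  have hqr : q⁻¹ + r⁻¹ ≤ 1 := by
    refine le_trans ?_ hrq.le
    rw [add_comm, two_mul]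
    exact add_le_add le_rfl le_self_add
  -- The dual exponent of `q`. The assumption on `r` and `q` gives `q' ≤ r`, so `F` can be measured
  -- in `L^{q'}` on `A` at the cost of a power of `μ A`.
  set q' : ℝ≥0∞ := (1 - q⁻¹)⁻¹ with hq'
  have hconj : ENNReal.HolderConjugate q q' := ENNReal.HolderConjugate.inv_one_sub_inv' hq1
  have hq'r : q' ≤ r := by
    rw [hq', ENNReal.inv_le_iff_inv_le]
    exact ENNReal.le_sub_of_add_le_left (ne_top_of_le_ne_top ENNReal.one_ne_top hqinv) hqr
  have hq't : q'.toReal⁻¹ = 1 - q⁻¹.toReal := by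
    rw [hq', ENNReal.toReal_inv, inv_inv, ENNReal.toReal_sub_of_le hqinv ENNReal.one_ne_top,
      ENNReal.toReal_one]
  set ν := μ.restrict A with hν
  have hνu : ν univ = μ A := by simp [hν]
  have hcompl : ∀ᵐ x ∂(μ.restrict Aᶜ), g x = 0 := by
    rw [ae_restrict_iff' hA.compl]; exact hgA
  have hrestr : ∀ G : X → ℝ≥0∞, ∫⁻ x, G x * ‖g x‖ₑ ∂μ = ∫⁻ x, G x * ‖g x‖ₑ ∂ν := by
    intro G
    rw [← lintegral_add_compl _ hA]
    have : ∫⁻ x in Aᶜ, G x * ‖g x‖ₑ ∂μ = 0 := by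
      rw [lintegral_congr_ae (g := fun _ => 0) (hcompl.mono fun x hx => by simp [hx])]; simp
    rw [this, add_zero]
  have hFν : AEStronglyMeasurable F ν := hF.restrict
  have hgν : AEStronglyMeasurable g ν := hg.restrict
  have hX : eLpNorm g q ν ≤ eLpNorm g q μ := eLpNorm_restrict_le _ _ _ _
  set Y := eLpNorm g q μ with hY
  have hm : μ A ≠ ⊤ := measure_ne_top _ _
  -- the energy estimate
  have h1 : ∫⁻ x, ‖F x‖ₑ * ‖g x‖ₑ ∂μ
      ≤ eLpNorm F r μ * μ A ^ (1 - q⁻¹.toReal - r⁻¹.toReal) * Y := by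
    rw [hrestr]
    have h2 : ∫⁻ x, ‖F x‖ₑ * ‖g x‖ₑ ∂ν ≤ eLpNorm F q' ν * eLpNorm g q ν := by
      have : ENNReal.HolderTriple q' q 1 := hconj.symm
      have := eLpNorm_smul_le_mul_eLpNorm (p := q') (q := q) (r := 1) hgν hFν
      rw [eLpNorm_one_eq_lintegral_enorm] at this
      simpa [enorm_mul] using this
    refine h2.trans (mul_le_mul' ?_ hX)
    refine (eLpNorm_le_eLpNorm_mul_rpow_measure_univ hq'r hFν).trans ?_
    rw [hνu, one_div, one_div, hq't, ← ENNReal.toReal_inv]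
    exact mul_le_mul' (eLpNorm_restrict_le _ _ _ _) le_rfl
  -- The energy inequality is quadratic in `Y` on the left and linear on the right; cancelling `Y`
  -- requires it to be nonzero and finite.
  have h3 : Y ≤ c * eLpNorm F r μ * μ A ^ (1 - q⁻¹.toReal - r⁻¹.toReal) := by
    rcases eq_or_ne Y 0 with h0 | h0
    · rw [h0]; exact zero_le
    have h4 : Y * Y ≤ (c * eLpNorm F r μ * μ A ^ (1 - q⁻¹.toReal - r⁻¹.toReal)) * Y := by
      rw [← sq]
      refine hE.trans ((mul_le_mul_right h1 c).trans (le_of_eq ?_))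
      ring
    exact (ENNReal.mul_le_mul_iff_left h0 hgq).1 h4
  -- A second Hölder step, from `L^q` to `L¹` on `A`. It supplies the other power of `μ A` that
  -- lifts the total exponent above `1`.
  have h5 : ∫⁻ x, ‖g x‖ₑ ∂μ ≤ Y * μ A ^ (1 - q⁻¹.toReal) := by
    have h6 := hrestr 1
    simp only [Pi.one_apply, one_mul] at h6
    rw [h6, ← eLpNorm_one_eq_lintegral_enorm]
    refine (eLpNorm_le_eLpNorm_mul_rpow_measure_univ hq1 hgν).trans ?_
    rw [hνu, one_div, one_div, ENNReal.toReal_one, inv_one, ← ENNReal.toReal_inv]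
    exact mul_le_mul' hX le_rfl
  have hqle : q⁻¹.toReal ≤ 1 := by
    simpa using ENNReal.toReal_mono ENNReal.one_ne_top hqinv
  have hqrle : q⁻¹.toReal + r⁻¹.toReal ≤ 1 := by
    have hr' : r⁻¹ ≠ ⊤ :=
      ne_top_of_le_ne_top ENNReal.one_ne_top (le_trans le_add_self hqr)
    rw [← ENNReal.toReal_add (ne_top_of_le_ne_top ENNReal.one_ne_top hqinv) hr']
    simpa using ENNReal.toReal_mono ENNReal.one_ne_top hqr
  calc ∫⁻ x, ‖g x‖ₑ ∂μ ≤ Y * μ A ^ (1 - q⁻¹.toReal) := h5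
    _ ≤ c * eLpNorm F r μ * μ A ^ (1 - q⁻¹.toReal - r⁻¹.toReal) * μ A ^ (1 - q⁻¹.toReal) :=
        mul_le_mul' h3 le_rfl
    _ = c * eLpNorm F r μ *
        μ A ^ ((1 - q⁻¹.toReal - r⁻¹.toReal) + (1 - q⁻¹.toReal)) := by
        rw [mul_assoc, ENNReal.rpow_add_of_nonneg _ _ (by linarith) (by linarith)]
    _ = _ := by congr 2; ring

/-- If the excesses of `w` over all levels satisfy an energy inequality with an integrable enough
right-hand side, then `w` is bounded above. -/
lemma exists_ae_le_of_excess_energy {F w : X → ℝ} (hw : Measurable w)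
    {r q : ℝ≥0∞} (hq : 2 < q) (hrq : 1 / r + 2 / q < 1)
    (hF : MemLp F r μ) (hgq : ∀ k : ℝ≥0, eLpNorm (fun x => w x - min (w x) k) q μ ≠ ⊤)
    {c : ℝ≥0∞} (hc : c ≠ ⊤)
    (hE : ∀ k : ℝ≥0, eLpNorm (fun x => w x - min (w x) k) q μ ^ 2 ≤
      c * ∫⁻ x, ‖F x‖ₑ * ‖w x - min (w x) k‖ₑ ∂μ) :
    ∃ M : ℝ, 0 ≤ M ∧ ∀ᵐ x ∂μ, w x ≤ M := by
  set δ : ℝ := 1 - r⁻¹.toReal - 2 * q⁻¹.toReal with hδdef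
  have hδ : 0 < δ := by
    rw [one_div, div_eq_mul_inv] at hrq
    have h1 : r⁻¹ ≠ ⊤ := ne_top_of_lt (lt_of_le_of_lt le_self_add hrq)
    have h2 : 2 * q⁻¹ ≠ ⊤ := ne_top_of_lt (lt_of_le_of_lt le_add_self hrq)
    have h3 := (ENNReal.toReal_lt_toReal (ENNReal.add_ne_top.2 ⟨h1, h2⟩) ENNReal.one_ne_top).2 hrq
    rw [ENNReal.toReal_add h1 h2, ENNReal.toReal_mul] at h3
    simp only [ENNReal.toReal_ofNat, ENNReal.toReal_one] at h3
    linarith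
  have hmeas : ∀ k : ℝ, MeasurableSet {x | k < w x} := fun k => measurableSet_lt measurable_const hw
  have hdecay : ∀ k j : ℝ, 0 ≤ k → k < j → (j - k) * (μ {x | j < w x}).toReal ≤
      (c * eLpNorm F r μ).toReal * (μ {x | k < w x}).toReal ^ (1 + δ) := by
    intro k j hk hkj
    lift k to ℝ≥0 using hk
    have h1 := lintegral_enorm_le_of_energy (μ := μ) (F := F) (A := {x | (k : ℝ) < w x})
      (g := fun x => w x - min (w x) k) (hmeas k)
      (ae_of_all _ fun x hx => by
        rw [mem_ofPred_eq, not_lt] at hx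
        rw [min_eq_left hx, sub_self]) hq hrq hF.1
      (hw.sub (hw.min measurable_const)).aestronglyMeasurable (hgq k) (hE k)
    -- Chebyshev: the excess over `k` exceeds `j - k` where `w > j`.
    have h2 : ENNReal.ofReal (j - k) * μ {x | j < w x} ≤ ∫⁻ x, ‖w x - min (w x) k‖ₑ ∂μ := by
      refine le_trans ?_ (mul_meas_ge_le_lintegral₀
        (hw.sub (hw.min measurable_const)).enorm.aemeasurable (ENNReal.ofReal (j - k)))
      gcongr with x
      intro hx
      rw [Real.enorm_eq_ofReal_abs]
      apply ENNReal.ofReal_le_ofReal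
      change j - k ≤ |w x - min (w x) k|
      rw [min_eq_right (hkj.trans hx).le]
      exact (sub_le_sub_right hx.le _).trans (le_abs_self _)
    have h3 := ENNReal.toReal_mono (by
      refine ENNReal.mul_ne_top (ENNReal.mul_ne_top hc hF.2.ne) ?_
      exact ENNReal.rpow_ne_top_of_nonneg (by linarith) (measure_ne_top _ _)) (h2.trans h1)
    rwa [ENNReal.toReal_mul, ENNReal.toReal_ofReal (by linarith), ENNReal.toReal_mul,
      ← ENNReal.toReal_rpow] at h3
  obtain ⟨M, hM0, hM⟩ := exists_eq_zero_of_levelset_decay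
    (m := fun k => (μ {x | k < w x}).toReal) (fun _ => ENNReal.toReal_nonneg)
    (fun a b hab => ENNReal.toReal_mono (measure_ne_top _ _)
      (measure_mono fun x (hx : b < w x) => hab.trans_lt hx)) hδ hdecay
  refine ⟨M, hM0, ?_⟩
  rw [ae_iff]
  simp only [not_le]
  exact ((ENNReal.toReal_eq_zero_iff _).1 hM).resolve_right (measure_ne_top _ _)

end Lebesgue

/-! ### From the excess estimate to boundedness of the solution -/

/-- Since `T > 0`, the time interval has positive measure, so almost every time slice carries the
property and at least one such slice exists. -/
lemma ae_of_ae_cyl (hT : 0 < T) {P : E d → Prop}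
    (h : ∀ᵐ y ∂(cylMeasure T Ω), P y.2) : ∀ᵐ x ∂(volume.restrict Ω), P x := by
  have h1 := Measure.ae_ae_of_ae_prod h
  have : NeBot (ae ((volume : Measure ℝ).restrict (Ioo 0 T))) := by
    rw [ae_neBot, Ne, Measure.restrict_eq_zero, Real.volume_Ioo]
    simp [hT]
  obtain ⟨t, ht⟩ := h1.exists
  exact ht

lemma FracSpace.norm_nonneg (W : FracSpace) (w : L2 Ω) : 0 ≤ W.norm Ω s w := Real.sqrt_nonneg _

/-- Local solutions are bounded, provided that `W` has the truncation property. -/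
theorem memLp_top_of_splitsTruncation
    [IsFiniteMeasure ((volume : Measure (E d)).restrict Ω)] (hΩ : MeasurableSet Ω) (hT : 0 < T)
    {W : FracSpace} (hpos : ∀ w : L2 Ω, 0 ≤ W.inner Ω s w w)
    (hW : ∀ w ∈ W.carrier Ω s, ∀ k : ℝ≥0, SplitsTruncation W Ω s w k)
    {f : U T Ω → ℝ} {α β γ p : ℝ} (hα : 0 < α) (hβ : 0 < β) (hγ : 0 < γ) (hp0 : 0 < p)
    (hp1 : p < 1) {u₀ : U T Ω} {w₀ : L2 Ω} (hf : DifferentiableAt ℝ f u₀)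
    (hsol : IsLocalSolution W Ω s T f α β γ p u₀ w₀) {r q : ℝ≥0∞} (hq : 2 < q)
    (hrq : 1 / r + 2 / q < 1) (hemb : W.EmbedsLp Ω s q)
    (hreg : MemLp (fun x => ∫ t in Ioo 0 T, |gradient f u₀ (t, x)|) r (volume.restrict Ω)) :
    MemLp w₀ ∞ (volume.restrict Ω) ∧ MemLp u₀ ∞ (cylMeasure T Ω) := by
  obtain ⟨C, hC⟩ := hemb
  set F : E d → ℝ := fun x => ∫ t in Ioo 0 T, |gradient f u₀ (t, x)| with hF
  have hsplit := hW w₀ hsol.1.1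
  have hgq : ∀ k : ℝ≥0, eLpNorm (fun x => w₀ x - min (w₀ x) k) q (volume.restrict Ω) ≤
      ENNReal.ofReal (C * W.norm Ω s (excess k w₀)) := fun k => by
    rw [← eLpNorm_congr_ae (coeFn_excess k w₀)]
    exact hC _ (hsplit k).excess_mem
  obtain ⟨M, hM0, hM⟩ := exists_ae_le_of_excess_energy
    (Lp.stronglyMeasurable w₀).measurable hq hrq hreg
    (fun k => ne_top_of_le_ne_top ENNReal.ofReal_ne_top (hgq k))
    -- `C ^ 2` comes from squaring the embedding inequality and `1 / β` from the energy estimate of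
    -- the excess.
    (c := ENNReal.ofReal (C ^ 2 / β)) ENNReal.ofReal_ne_top (by
      intro k
      have h1 := inner_excess_le_integral hΩ hpos hα hβ hγ hp0 hp1 hf hsol (hsplit k)
      have h2 : eLpNorm (fun x => w₀ x - min (w₀ x) k) q (volume.restrict Ω) ^ 2 ≤
          ENNReal.ofReal (C ^ 2 * W.inner Ω s (excess k w₀) (excess k w₀)) := by
        refine (pow_le_pow_left' (hgq k) 2).trans ?_
        -- The embedding constant is not assumed nonnegative; for `C ≤ 0` the embedding bound is
        -- zero.
        rcases le_total 0 C with h0 | h0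
        · rw [← ENNReal.ofReal_pow (mul_nonneg h0 (W.norm_nonneg _)), mul_pow,
            FracSpace.norm_sq hpos]
        · rw [ENNReal.ofReal_of_nonpos
            (mul_nonpos_of_nonpos_of_nonneg h0 (W.norm_nonneg _))]
          simp
      refine h2.trans ?_
      have h3 : C ^ 2 * W.inner Ω s (excess k w₀) (excess k w₀) ≤
          C ^ 2 / β * ∫ x in Ω, F x * |excess k w₀ x| := by
        rw [div_mul_eq_mul_div, mul_div_assoc]
        refine mul_le_mul_of_nonneg_left ?_ (sq_nonneg C)
        rw [le_div_iff₀ hβ, mul_comm]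
        exact h1
      refine (ENNReal.ofReal_le_ofReal h3).trans ?_
      rw [ENNReal.ofReal_mul (by positivity)]
      refine mul_le_mul_right ?_ _
      have h4 := (enorm_integral_le_lintegral_enorm (μ := volume.restrict Ω)
        (fun x => F x * |excess k w₀ x|))
      rw [Real.enorm_eq_ofReal_abs] at h4
      refine (ENNReal.ofReal_le_ofReal (le_abs_self _)).trans (h4.trans (le_of_eq ?_))
      apply lintegral_congr_ae
      filter_upwards [coeFn_excess k w₀] with x hx
      rw [enorm_mul, Real.enorm_abs, hx])
  have hcyl := hsol.1.2
  -- Admissibility forces `w₀ ≥ |u₀| ≥ 0`, so a bound from above suffices.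
  have hw0 : ∀ᵐ x ∂(volume.restrict Ω), 0 ≤ w₀ x :=
    ae_of_ae_cyl hT (hcyl.mono fun y hy => (abs_nonneg _).trans hy)
  refine ⟨memLp_top_of_bound (Lp.aestronglyMeasurable w₀) M ?_,
    memLp_top_of_bound (Lp.aestronglyMeasurable u₀) M ?_⟩
  · filter_upwards [hM, hw0] with x h1 h2
    rwa [Real.norm_of_nonneg h2]
  · filter_upwards [ae_cyl_of_ae (T := T) hM, hcyl] with y h1 h2
    exact h2.trans h1

/-! ### Smooth truncations -/

/-- A smooth nondecreasing function that fixes `0` and has derivative at most `1`. -/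
structure IsSmoothTruncation (η : ℝ → ℝ) : Prop where
  contDiff : ContDiff ℝ ∞ η
  map_zero : η 0 = 0
  deriv_nonneg : ∀ x, 0 ≤ deriv η x
  deriv_le_one : ∀ x, deriv η x ≤ 1

namespace IsSmoothTruncation

variable {η : ℝ → ℝ}

lemma differentiable (h : IsSmoothTruncation η) : Differentiable ℝ η :=
  h.contDiff.differentiable (by simp)

lemma monotone (h : IsSmoothTruncation η) : Monotone η :=
  monotone_of_deriv_nonneg h.differentiable h.deriv_nonneg

lemma monotone_sub (h : IsSmoothTruncation η) : Monotone fun x => x - η x := by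
  refine monotone_of_deriv_nonneg (differentiable_id.sub h.differentiable) fun x => ?_
  rw [deriv_fun_sub differentiableAt_fun_id (h.differentiable x)]
  simpa using h.deriv_le_one x

/-- Both `η` and `id - η` are nondecreasing, so their increments have the same sign. Hence the
squares of the two increments add up to at most `(x - y)²`. -/
lemma mul_sub_nonneg (h : IsSmoothTruncation η) (x y : ℝ) :
    0 ≤ (η x - η y) * ((x - y) - (η x - η y)) := by
  rcases le_total x y with hxy | hxy
  · have h1 := h.monotone hxy
    have h2 := h.monotone_sub hxy
    simp only at h2
    nlinarith
  · have h1 := h.monotone hxy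
    have h2 := h.monotone_sub hxy
    simp only at h2
    nlinarith

lemma abs_sub_le (h : IsSmoothTruncation η) (x y : ℝ) : |η x - η y| ≤ |x - y| := by
  rcases le_total x y with hxy | hxy
  · have h1 := h.monotone hxy
    have h2 := h.monotone_sub hxy
    simp only at h2
    rw [abs_of_nonpos (by linarith), abs_of_nonpos (by linarith)]
    linarith
  · have h1 := h.monotone hxy
    have h2 := h.monotone_sub hxy
    simp only at h2
    rw [abs_of_nonneg (by linarith), abs_of_nonneg (by linarith)]
    linarith

lemma lipschitzWith (h : IsSmoothTruncation η) : LipschitzWith 1 η :=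
  LipschitzWith.of_dist_le_mul fun x y => by
    simpa [Real.dist_eq] using h.abs_sub_le x y

end IsSmoothTruncation

/-- A smooth approximation of `x ↦ min(x, k)`. -/
def softMin (k ε x : ℝ) : ℝ :=
  (x + k - √((x - k) ^ 2 + ε ^ 2)) / 2 - (k - √(k ^ 2 + ε ^ 2)) / 2

/-- In `min x k = (x + k - |x - k|) / 2` the absolute value is regularized, so the derivative is `(1
- τ) / 2` with `|τ| ≤ 1`. The constant subtracted in `softMin` restores the value `0` at `0`. -/
lemma isSmoothTruncation_softMin (k : ℝ) {ε : ℝ} (hε : 0 < ε) :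
    IsSmoothTruncation (softMin k ε) := by
  have hpos : ∀ x : ℝ, 0 < (x - k) ^ 2 + ε ^ 2 := fun x => by positivity
  have hder : ∀ x, deriv (softMin k ε) x = (1 - (x - k) / √((x - k) ^ 2 + ε ^ 2)) / 2 := by
    intro x
    have h1 : HasDerivAt (fun x : ℝ => (x - k) ^ 2 + ε ^ 2) (2 * (x - k)) x := by
      have := (((hasDerivAt_id x).sub_const k).pow 2).add_const (ε ^ 2)
      simpa using this
    have h2 := h1.sqrt (hpos x).ne'
    have h3 := ((((hasDerivAt_id x).add_const k).sub h2).div_const 2).sub_const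
      ((k - √(k ^ 2 + ε ^ 2)) / 2)
    refine h3.deriv.trans ?_
    rw [mul_div_mul_left _ _ two_ne_zero]
  have habs : ∀ x : ℝ, |x - k| ≤ √((x - k) ^ 2 + ε ^ 2) := fun x =>
    Real.abs_le_sqrt (by nlinarith [sq_nonneg ε])
  refine ⟨?_, ?_, ?_, ?_⟩
  · unfold softMin
    refine ContDiff.sub (ContDiff.div_const (ContDiff.sub (by fun_prop) ?_) _) contDiff_const
    exact ContDiff.sqrt (by fun_prop) fun x => (hpos x).ne'
  · simp [softMin]
  · intro x
    rw [hder]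
    have : (x - k) / √((x - k) ^ 2 + ε ^ 2) ≤ 1 :=
      (div_le_one (Real.sqrt_pos.2 (hpos x))).2 ((le_abs_self _).trans (habs x))
    linarith
  · intro x
    rw [hder]
    have : -1 ≤ (x - k) / √((x - k) ^ 2 + ε ^ 2) := by
      rw [le_div_iff₀ (Real.sqrt_pos.2 (hpos x))]
      linarith [neg_abs_le (x - k), habs x]
    linarith

/-- The bounds `|y| ≤ √(y² + ε²) ≤ |y| + ε` are used at `y = x - k` and at `y = k`; each error
enters with a factor `1/2`. -/
lemma abs_softMin_sub_min_le {k ε : ℝ} (hk : 0 ≤ k) (hε : 0 ≤ ε) (x : ℝ) :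
    |softMin k ε x - min x k| ≤ ε := by
  have h1 : ∀ y : ℝ, |y| ≤ √(y ^ 2 + ε ^ 2) ∧ √(y ^ 2 + ε ^ 2) ≤ |y| + ε := fun y => by
    refine ⟨Real.abs_le_sqrt (by nlinarith [sq_nonneg ε]), ?_⟩
    rw [Real.sqrt_le_iff]
    refine ⟨by positivity, ?_⟩
    nlinarith [sq_abs y, abs_nonneg y]
  have h2 := h1 (x - k)
  have h3 := h1 k
  rw [abs_of_nonneg hk] at h3
  have h4 : min x k = (x + k - |x - k|) / 2 := by
    rcases le_total x k with h | h
    · rw [min_eq_left h, abs_of_nonpos (by linarith)]; ring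
    · rw [min_eq_right h, abs_of_nonneg (by linarith)]; ring
  rw [h4, softMin, abs_le]
  constructor <;> linarith [h2.1, h2.2, h3.1, h3.2]

/-- Smooth truncations converging uniformly to `x ↦ min(x, k)`. -/
lemma exists_isSmoothTruncation_seq (k : ℝ≥0) :
    ∃ η : ℕ → ℝ → ℝ, (∀ n, IsSmoothTruncation (η n)) ∧
      ∀ n x, |η n x - min x k| ≤ 1 / ((n : ℝ) + 1) :=
  ⟨fun n => softMin k (1 / ((n : ℝ) + 1)),
    fun n => isSmoothTruncation_softMin k (by positivity),
    fun n x => abs_softMin_sub_min_le k.coe_nonneg (by positivity) x⟩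

/-! ### Truncation in the fractional Sobolev spaces -/

/-- The weighted increment whose square integral is the `H^s` seminorm. -/
def hsIncr (s : ℝ) (w : E d → ℝ) (z : E d × E d) : ℝ :=
  (w z.1 - w z.2) / ‖z.1 - z.2‖ ^ ((d : ℝ) / 2 + s)

lemma aestronglyMeasurable_hsIncr {A : Set (E d)} {w : E d → ℝ}
    (hw : AEStronglyMeasurable w (volume.restrict A)) :
    AEStronglyMeasurable (hsIncr s w) ((volume.restrict A).prod (volume.restrict A)) := by
  have h1 : AEMeasurable (fun z : E d × E d => w z.1 - w z.2)
      ((volume.restrict A).prod (volume.restrict A)) :=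
    (hw.comp_fst.sub hw.comp_snd).aemeasurable
  have h2 : Measurable fun z : E d × E d => ‖z.1 - z.2‖ ^ ((d : ℝ) / 2 + s) :=
    (measurable_fst.sub measurable_snd).norm.pow_const _
  exact (h1.div h2.aemeasurable).aestronglyMeasurable

lemma memHs_iff {A : Set (E d)} {w : E d → ℝ} :
    MemHs A s w ↔ MemLp w 2 (volume.restrict A) ∧
      MemLp (hsIncr s w) 2 ((volume.restrict A).prod (volume.restrict A)) := by
  have hn : (fun z : E d × E d => |w z.1 - w z.2| / ‖z.1 - z.2‖ ^ ((d : ℝ) / 2 + s))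
      = fun z => ‖hsIncr s w z‖ := by
    ext z
    rw [hsIncr, Real.norm_eq_abs, abs_div, abs_of_nonneg (a := ‖z.1 - z.2‖ ^ _) (by positivity)]
  unfold MemHs
  refine and_congr_right fun hw => ?_
  rw [hn]
  exact memLp_norm_iff (aestronglyMeasurable_hsIncr hw.1)

lemma hsInner_eq (A : Set (E d)) (u w : E d → ℝ) :
    hsInner A s u w = (∫ x in A, u x * w x) +
      cds d s / 2 * ∫ z, hsIncr s u z * hsIncr s w z
        ∂((volume.restrict A).prod (volume.restrict A)) := by
  unfold hsInner
  congr 3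
  ext z
  have : ‖z.1 - z.2‖ ^ ((d : ℝ) + 2 * s)
      = ‖z.1 - z.2‖ ^ ((d : ℝ) / 2 + s) * ‖z.1 - z.2‖ ^ ((d : ℝ) / 2 + s) := by
    rw [← sq, ← Real.rpow_mul_natCast (norm_nonneg _)]
    congr 1; push_cast; ring
  rw [this, hsIncr, hsIncr, div_mul_div_comm]

lemma hsIncr_congr {A : Set (E d)} {u w : E d → ℝ} (h : u =ᵐ[volume.restrict A] w) :
    hsIncr s u =ᵐ[(volume.restrict A).prod (volume.restrict A)] hsIncr s w := by
  filter_upwards [Measure.quasiMeasurePreserving_fst.ae h,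
    Measure.quasiMeasurePreserving_snd.ae h] with z h1 h2
  rw [hsIncr, hsIncr, h1, h2]

lemma memHs_congr {A : Set (E d)} {u w : E d → ℝ} (h : u =ᵐ[volume.restrict A] w) :
    MemHs A s u ↔ MemHs A s w := by
  rw [memHs_iff, memHs_iff, memLp_congr_ae h, memLp_congr_ae (hsIncr_congr h)]

/-- A `1`-Lipschitz map fixing `0` shrinks values and increments pointwise. -/
lemma memHs_comp {A : Set (E d)} {w : E d → ℝ} (hw : MemHs A s w) {ζ : ℝ → ℝ}
    (hζ : LipschitzWith 1 ζ) (h0 : ζ 0 = 0) : MemHs A s fun x => ζ (w x) := by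
  rw [memHs_iff] at hw ⊢
  have hm : AEStronglyMeasurable (fun x => ζ (w x)) (volume.restrict A) :=
    hζ.continuous.comp_aestronglyMeasurable hw.1.1
  refine ⟨hw.1.mono hm (ae_of_all _ fun x => ?_),
    hw.2.mono (aestronglyMeasurable_hsIncr hm) (ae_of_all _ fun z => ?_)⟩
  · simpa [h0] using hζ.dist_le_mul (w x) 0
  · rw [hsIncr, hsIncr, norm_div, norm_div]
    gcongr
    simpa [Real.dist_eq] using hζ.dist_le_mul (w z.1) (w z.2)

/-- Pointwise, `a² - (a - t b)² - (2t - t²) b² = 2t b (a - b) ≥ 0`. -/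
lemma integral_sub_smul_add_le {X : Type*} [MeasurableSpace X] {μ : Measure X} {a b : X → ℝ}
    (ha : MemLp a 2 μ) (hb : MemLp b 2 μ) (hab : ∀ x, 0 ≤ b x * (a x - b x)) {t : ℝ}
    (ht : 0 ≤ t) :
    ∫ x, (a x - t * b x) * (a x - t * b x) ∂μ + (2 * t - t ^ 2) * ∫ x, b x * b x ∂μ
      ≤ ∫ x, a x * a x ∂μ := by
  have h1 : MemLp (fun x => a x - t * b x) 2 μ := ha.sub (hb.const_mul t)
  have h2 : Integrable (fun x => (a x - t * b x) * (a x - t * b x)) μ := h1.integrable_mul h1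
  have h3 : Integrable (fun x => (2 * t - t ^ 2) * (b x * b x)) μ :=
    (hb.integrable_mul hb).const_mul _
  rw [← integral_const_mul, ← integral_add h2 h3]
  refine integral_mono (h2.add h3) (ha.integrable_mul ha) fun x => ?_
  have := mul_nonneg ht (hab x)
  change _ ≤ a x * a x
  nlinarith

lemma lipschitzWith_sub_smul_excess (k : ℝ) {t : ℝ} (ht0 : 0 ≤ t) (ht1 : t ≤ 1) :
    LipschitzWith 1 fun x : ℝ => x - t * (x - min x k) := by
  refine LipschitzWith.of_dist_le_mul fun x y => ?_
  rw [Real.dist_eq, Real.dist_eq, NNReal.coe_one, one_mul]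
  have h1 : |min x k - min y k| ≤ |x - y| := by
    simpa [Real.dist_eq] using (lipschitzWith_min_const k).dist_le_mul x y
  calc |x - t * (x - min x k) - (y - t * (y - min y k))|
      = |(1 - t) * (x - y) + t * (min x k - min y k)| := by congr 1; ring
    _ ≤ |(1 - t) * (x - y)| + |t * (min x k - min y k)| := abs_add_le _ _
    _ = (1 - t) * |x - y| + t * |min x k - min y k| := by
        rw [abs_mul, abs_mul, abs_of_nonneg ht0, abs_of_nonneg (sub_nonneg.2 ht1)]
    _ ≤ (1 - t) * |x - y| + t * |x - y| := by gcongr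
    _ = |x - y| := by ring

lemma mul_excess_nonneg (k x y : ℝ) :
    0 ≤ ((x - min x k) - (y - min y k)) * ((x - y) - ((x - min x k) - (y - min y k))) := by
  rcases min_cases x k with h | h <;> rcases min_cases y k with h' | h' <;> rw [h.1, h'.1] <;>
  nlinarith

lemma excess_mul_min_nonneg {k : ℝ} (hk : 0 ≤ k) (x : ℝ) :
    0 ≤ (x - min x k) * (x - (x - min x k)) := by
  rcases min_cases x k with h | h <;> rw [h.1] <;> nlinarith

lemma lipschitzWith_excess (k : ℝ) : LipschitzWith 1 fun x : ℝ => x - min x k := by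
  refine LipschitzWith.of_dist_le_mul fun x y => ?_
  rw [Real.dist_eq, Real.dist_eq, NNReal.coe_one, one_mul]
  rcases min_cases x k with h | h <;> rcases min_cases y k with h' | h' <;> rw [h.1, h'.1] <;>
  rw [abs_le] <;> constructor <;> linarith [neg_abs_le (x - y), le_abs_self (x - y)]

/-- The quadratic inequality is applied twice: to `w` with its excess, where `k ≥ 0` matters, and to
their weighted increments, where monotonicity of excess and truncation gives the sign. -/
lemma hsInner_sub_smul_excess_le {A : Set (E d)} (hs0 : 0 < s) (hs1 : s < 1) {w : E d → ℝ}
    (hw : MemHs A s w) (k : ℝ≥0) {t : ℝ} (ht0 : 0 ≤ t) :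
    hsInner A s (fun x => w x - t * (w x - min (w x) k)) (fun x => w x - t * (w x - min (w x) k))
      + (2 * t - t ^ 2) * hsInner A s (fun x => w x - min (w x) k) (fun x => w x - min (w x) k)
      ≤ hsInner A s w w := by
  have hg := memHs_comp hw (lipschitzWith_excess k) (by simp)
  rw [memHs_iff] at hw hg
  have h1 := integral_sub_smul_add_le hw.1 hg.1
    (fun x => excess_mul_min_nonneg k.coe_nonneg (w x)) ht0
  have h2 := integral_sub_smul_add_le hw.2 hg.2 (fun z => by
    have : hsIncr s (fun x => w x - min (w x) k) z
        * (hsIncr s w z - hsIncr s (fun x => w x - min (w x) k) z) =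
        ((w z.1 - min (w z.1) k - (w z.2 - min (w z.2) k)) *
        ((w z.1 - w z.2) - (w z.1 - min (w z.1) k - (w z.2 - min (w z.2) k)))) /
          (‖z.1 - z.2‖ ^ ((d : ℝ) / 2 + s)) ^ 2 := by
      simp only [hsIncr]
      rw [← sub_div, div_mul_div_comm, sq]
    rw [this]
    exact div_nonneg (mul_excess_nonneg _ _ _) (by positivity)) ht0
  have h3 : hsIncr s (fun x => w x - t * (w x - min (w x) k)) = fun z =>
      hsIncr s w z - t * hsIncr s (fun x => w x - min (w x) k) z := by
    ext z; simp only [hsIncr]; ring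
  rw [hsInner_eq, hsInner_eq, hsInner_eq, h3]
  have h4 := mul_le_mul_of_nonneg_left h2 (div_nonneg (cds_nonneg d hs0 hs1) zero_le_two)
  linarith

lemma splitsTruncation_Hs (hs0 : 0 < s) (hs1 : s < 1) {w : L2 Ω}
    (hw : w ∈ FracSpace.Hs.carrier Ω s) (k : ℝ≥0) : SplitsTruncation .Hs Ω s w k where
  excess_mem := (memHs_congr (coeFn_excess k w)).2
    (memHs_comp hw (lipschitzWith_excess k) (by simp))
  sub_smul_mem t ht0 ht1 := (memHs_congr (coeFn_sub_smul_excess k t w)).2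
    (memHs_comp hw (lipschitzWith_sub_smul_excess k ht0 ht1) (by simp))
  inner_le t ht0 ht1 := by
    simp only [FracSpace.inner]
    rw [hsInner_congr (coeFn_sub_smul_excess k t w) (coeFn_sub_smul_excess k t w),
      hsInner_congr (coeFn_excess k w) (coeFn_excess k w)]
    exact hsInner_sub_smul_excess_le hs0 hs1 hw k ht0

/-- Because `ζ 0 = 0`, composition commutes with extension by zero; this reduces `H̃^s(Ω)` to the
`H^s` argument on the whole space. -/
lemma indicator_ae_of_comp (hΩ : MeasurableSet Ω) {u w : E d → ℝ} {ζ : ℝ → ℝ} (h0 : ζ 0 = 0)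
    (h : u =ᵐ[volume.restrict Ω] fun x => ζ (w x)) :
    Ω.indicator u =ᵐ[volume.restrict univ] fun x => ζ (Ω.indicator w x) := by
  rw [Filter.EventuallyEq, ae_restrict_iff' hΩ] at h
  rw [Measure.restrict_univ]
  filter_upwards [h] with x hx
  by_cases hxΩ : x ∈ Ω
  · simp [indicator_of_mem hxΩ, hx hxΩ]
  · simp [indicator_of_notMem hxΩ, h0]

lemma splitsTruncation_HsTilde (hΩ : MeasurableSet Ω) (hs0 : 0 < s) (hs1 : s < 1) {w : L2 Ω}
    (hw : w ∈ FracSpace.HsTilde.carrier Ω s) (k : ℝ≥0) :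
    SplitsTruncation .HsTilde Ω s w k := by
  have h1 := indicator_ae_of_comp hΩ (ζ := fun x => x - min x (k : ℝ)) (by simp)
    (coeFn_excess k w)
  have h2 := fun t : ℝ => indicator_ae_of_comp hΩ (ζ := fun x => x - t * (x - min x (k : ℝ)))
    (by simp) (coeFn_sub_smul_excess k t w)
  refine ⟨(memHs_congr h1).2 (memHs_comp hw (lipschitzWith_excess k) (by simp)),
    fun t ht0 ht1 => (memHs_congr (h2 t)).2
      (memHs_comp hw (lipschitzWith_sub_smul_excess k ht0 ht1) (by simp)), fun t ht0 ht1 => ?_⟩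
  simp only [FracSpace.inner]
  rw [hsInner_congr (h2 t) (h2 t), hsInner_congr h1 h1]
  exact hsInner_sub_smul_excess_le hs0 hs1 hw k ht0

/-! ### Test functions belong to `H^s(Ω)` -/

lemma IsTestFunction.memLp {v : E d → ℝ} (hv : IsTestFunction Ω v) (p : ℝ≥0∞) (μ : Measure (E d))
    [IsFiniteMeasureOnCompacts μ] : MemLp v p μ :=
  hv.contDiff.continuous.memLp_of_hasCompactSupport hv.hasCompactSupport

/-- In polar coordinates the integrand is `y ^ (a + d - 1)`, integrable at `0` exactly when `a >
-d`. -/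
lemma integrableOn_ball_norm_rpow (hd : 0 < d) {a : ℝ} (ha : -(d : ℝ) < a) (R : ℝ) :
    IntegrableOn (fun z : E d => ‖z‖ ^ a) (Metric.ball 0 R) := by
  have : Nonempty (Fin d) := ⟨⟨0, hd⟩⟩
  have : Nontrivial (E d) := inferInstance
  rw [integrableOn_fun_norm_addHaar volume (f := fun y : ℝ => y ^ a)]
  have hfr : Module.finrank ℝ (E d) = d := by simp
  rw [hfr]
  have h1 : IntegrableOn (fun y : ℝ => y ^ (a + (d - 1 : ℕ))) (Ioo 0 R) := by
    rcases le_total R 0 with hR | hR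
    · rw [Ioo_eq_empty (not_lt.2 hR)]; exact integrableOn_empty
    · rw [← intervalIntegrable_iff_integrableOn_Ioo_of_le hR]
      apply intervalIntegral.intervalIntegrable_rpow'
      rw [Nat.cast_sub hd]; push_cast; linarith
  refine h1.congr_fun (fun y hy => ?_) measurableSet_Ioo
  simp only [smul_eq_mul]
  rw [Real.rpow_add hy.1, Real.rpow_natCast, mul_comm]

/-- For fixed `x` the substitution `z = x - y` maps a ball of radius `R` containing `A` into the
centred ball of radius `2R`, so the inner integral is bounded uniformly in `x`. -/
lemma lintegral_prod_sub_lt_top {A : Set (E d)} (hA : Bornology.IsBounded A) {h : E d → ℝ≥0∞}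
    (hh : Measurable h) (hfin : ∀ R : ℝ, ∫⁻ z in Metric.ball 0 R, h z < ⊤) :
    ∫⁻ z, h (z.1 - z.2) ∂((volume.restrict A).prod (volume.restrict A)) < ⊤ := by
  obtain ⟨R, hR⟩ := hA.subset_ball (0 : E d)
  have hm : Measurable fun z : E d × E d => h (z.1 - z.2) :=
    hh.comp (measurable_fst.sub measurable_snd)
  rw [lintegral_prod _ hm.aemeasurable]
  have h1 : ∀ x ∈ Metric.ball (0 : E d) R, ∫⁻ y in A, h (x - y) ≤
      ∫⁻ z in Metric.ball 0 (R + R), h z := by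
    intro x hx
    calc ∫⁻ y in A, h (x - y) ≤ ∫⁻ y in Metric.ball 0 R, h (x - y) := lintegral_mono_set hR
      _ ≤ ∫⁻ y in (fun y => x - y) ⁻¹' Metric.ball 0 (R + R), h (x - y) := by
          apply lintegral_mono_set
          intro y hy
          rw [mem_preimage, mem_ball_zero_iff]
          rw [mem_ball_zero_iff] at hx hy
          exact (norm_sub_le _ _).trans_lt (add_lt_add hx hy)
      _ = ∫⁻ z in Metric.ball 0 (R + R), h z :=
          (Measure.measurePreserving_sub_left volume x).setLIntegral_comp_preimage
            measurableSet_ball hh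
  calc ∫⁻ x in A, ∫⁻ y in A, h (x - y)
      ≤ ∫⁻ x in Metric.ball 0 R, ∫⁻ y in A, h (x - y) := lintegral_mono_set hR
    _ ≤ ∫⁻ _ in Metric.ball (0 : E d) R, ∫⁻ z in Metric.ball 0 (R + R), h z :=
        setLIntegral_mono' measurableSet_ball h1
    _ < ⊤ := by
        rw [setLIntegral_const]
        exact ENNReal.mul_lt_top (hfin _) measure_ball_lt_top

lemma IsTestFunction.memHs (hd : 0 < d) (hs1 : s < 1) (hΩ : Bornology.IsBounded Ω)
    {v : E d → ℝ} (hv : IsTestFunction Ω v) : MemHs Ω s v := by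
  rw [memHs_iff]
  refine ⟨hv.memLp _ _, ?_⟩
  obtain ⟨K, hK⟩ := hv.contDiff.lipschitzWith_of_hasCompactSupport hv.hasCompactSupport (by simp)
  have hm := aestronglyMeasurable_hsIncr (s := s) (A := Ω)
    hv.contDiff.continuous.aestronglyMeasurable
  refine ⟨hm, ?_⟩
  rw [eLpNorm_lt_top_iff_lintegral_rpow_enorm_lt_top two_ne_zero ENNReal.ofNat_ne_top]
  -- A Lipschitz bound dominates the squared increment by `K² ‖x - y‖ ^ (2 - d - 2s)`, whose
  -- exponent exceeds `-d` because `s < 1`.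
  set a : ℝ := 2 - 2 * ((d : ℝ) / 2 + s) with ha
  have hfin := lintegral_prod_sub_lt_top hΩ
    (h := fun z : E d => ENNReal.ofReal ((K : ℝ) ^ 2 * ‖z‖ ^ a))
    (ENNReal.measurable_ofReal.comp ((measurable_norm.pow_const a).const_mul _))
    (fun R => ((integrableOn_ball_norm_rpow hd (by rw [ha]; linarith) R).const_mul
      ((K : ℝ) ^ 2)).lintegral_lt_top)
  refine lt_of_le_of_lt (lintegral_mono fun z => ?_) hfin
  rw [ENNReal.toReal_ofNat, ENNReal.rpow_ofNat, Real.enorm_eq_ofReal_abs,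
    ← ENNReal.ofReal_pow (abs_nonneg _)]
  apply ENNReal.ofReal_le_ofReal
  rcases eq_or_ne (z.1 - z.2) 0 with h0 | h0
  · rw [hsIncr, sub_eq_zero.1 h0]; simp; positivity
  have hpos : 0 < ‖z.1 - z.2‖ := norm_pos_iff.2 h0
  have h1 : |v z.1 - v z.2| ≤ K * ‖z.1 - z.2‖ := by
    simpa [Real.dist_eq, dist_eq_norm] using hK.dist_le_mul z.1 z.2
  rw [sq_abs, hsIncr, div_pow, div_le_iff₀ (by positivity), ha]
  calc (v z.1 - v z.2) ^ 2 = |v z.1 - v z.2| ^ 2 := (sq_abs _).symm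
    _ ≤ (K * ‖z.1 - z.2‖) ^ 2 := by gcongr
    _ = K ^ 2 * (‖z.1 - z.2‖ ^ (2 - 2 * ((d : ℝ) / 2 + s))
          * (‖z.1 - z.2‖ ^ ((d : ℝ) / 2 + s)) ^ 2) := by
        rw [← Real.rpow_mul_natCast hpos.le, ← Real.rpow_add hpos, mul_pow]
        congr 1
        rw [← Real.rpow_natCast]
        congr 1; push_cast; ring
    _ = _ := by ring

/-! ### Truncation in `H_0^s(Ω)` -/

lemma integral_mul_self_eq_eLpNorm {X : Type*} [MeasurableSpace X] {μ : Measure X} {f : X → ℝ}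
    (hf : MemLp f 2 μ) : ∫ x, f x * f x ∂μ = (eLpNorm f 2 μ).toReal ^ 2 := by
  have h1 : ‖hf.toLp f‖ ^ 2 = ∫ x, f x * f x ∂μ := by
    rw [← real_inner_self_eq_norm_sq, L2.inner_def]
    apply integral_congr_ae
    filter_upwards [hf.coeFn_toLp] with x hx
    rw [hx]; rfl
  rw [← h1, Lp.norm_toLp]

lemma cds_pos (d : ℕ) (hs0 : 0 < s) (hs1 : s < 1) : 0 < cds d s := by
  unfold cds
  have h1 : 0 < Real.Gamma (s + d / 2) := Real.Gamma_pos_of_pos (by positivity)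
  have h2 : 0 < Real.Gamma (1 - s) := Real.Gamma_pos_of_pos (by linarith)
  positivity

lemma hsInner_self_eq {A : Set (E d)} {w : E d → ℝ} (hw : MemHs A s w) :
    hsInner A s w w = (eLpNorm w 2 (volume.restrict A)).toReal ^ 2 + cds d s / 2 *
      (eLpNorm (hsIncr s w) 2 ((volume.restrict A).prod (volume.restrict A))).toReal ^ 2 := by
  rw [memHs_iff] at hw
  rw [hsInner_eq, integral_mul_self_eq_eLpNorm hw.1, integral_mul_self_eq_eLpNorm hw.2]

lemma hsIncr_sub (u w : E d → ℝ) : hsIncr s (u - w) = hsIncr s u - hsIncr s w := by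
  ext z; simp only [hsIncr, Pi.sub_apply]; ring

lemma MemHs.sub {A : Set (E d)} {u w : E d → ℝ} (hu : MemHs A s u) (hw : MemHs A s w) :
    MemHs A s (u - w) := by
  rw [memHs_iff] at *
  rw [hsIncr_sub]
  exact ⟨hu.1.sub hw.1, hu.2.sub hw.2⟩

/-- Convergence in `H^s(A)` is convergence of the functions and of their weighted increments. -/
lemma tendsto_hsNorm_zero_iff {A : Set (E d)} (hs0 : 0 < s) (hs1 : s < 1) {w : ℕ → E d → ℝ}
    (hw : ∀ n, MemHs A s (w n)) :
    Tendsto (fun n => hsNorm A s (w n)) atTop (𝓝 0) ↔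
      Tendsto (fun n => eLpNorm (w n) 2 (volume.restrict A)) atTop (𝓝 0) ∧
      Tendsto (fun n => eLpNorm (hsIncr s (w n)) 2
        ((volume.restrict A).prod (volume.restrict A))) atTop (𝓝 0) := by
  have hc := cds_pos d hs0 hs1
  set a : ℕ → ℝ := fun n => (eLpNorm (w n) 2 (volume.restrict A)).toReal with ha
  set b : ℕ → ℝ := fun n => (eLpNorm (hsIncr s (w n)) 2
        ((volume.restrict A).prod (volume.restrict A))).toReal with hb
  have hn : ∀ n, hsNorm A s (w n) = √(a n ^ 2 + cds d s / 2 * b n ^ 2) := fun n => by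
    rw [hsNorm, hsInner_self_eq (hw n)]
  have ha0 : ∀ n, 0 ≤ a n := fun n => ENNReal.toReal_nonneg
  have hb0 : ∀ n, 0 ≤ b n := fun n => ENNReal.toReal_nonneg
  have e1 : Tendsto (fun n => eLpNorm (w n) 2 (volume.restrict A)) atTop (𝓝 0) ↔
      Tendsto a atTop (𝓝 0) :=
    (ENNReal.tendsto_toReal_zero_iff fun n => ((memHs_iff.1 (hw n)).1).eLpNorm_ne_top).symm
  have e2 : Tendsto (fun n => eLpNorm (hsIncr s (w n)) 2
        ((volume.restrict A).prod (volume.restrict A))) atTop (𝓝 0) ↔ Tendsto b atTop (𝓝 0) :=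
    (ENNReal.tendsto_toReal_zero_iff fun n => ((memHs_iff.1 (hw n)).2).eLpNorm_ne_top).symm
  rw [e1, e2]
  simp_rw [hn]
  constructor
  · intro h
    refine ⟨squeeze_zero ha0 (fun n => ?_) h, ?_⟩
    · apply Real.le_sqrt_of_sq_le
      have := mul_nonneg hc.le (sq_nonneg (b n))
      linarith
    · have h' := h.const_mul ((√(cds d s / 2))⁻¹)
      rw [mul_zero] at h'
      refine squeeze_zero hb0 (fun n => ?_) h'
      rw [le_inv_mul_iff₀ (by positivity)]
      apply Real.le_sqrt_of_sq_le
      rw [mul_pow, Real.sq_sqrt (by positivity)]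
      have := sq_nonneg (a n)
      linarith
  · rintro ⟨h1, h2⟩
    have := (((h1.pow 2).add ((h2.pow 2).const_mul (cds d s / 2)))).sqrt
    simpa using this

lemma unifIntegrable_of_norm_le {X : Type*} [MeasurableSpace X] {μ : Measure X} {p : ℝ≥0∞}
    {f g : ℕ → X → ℝ} (hg : UnifIntegrable g p μ) (h : ∀ n x, ‖f n x‖ ≤ ‖g n x‖) :
    UnifIntegrable f p μ := by
  intro ε hε
  obtain ⟨δ, hδ, H⟩ := hg hε
  refine ⟨δ, hδ, fun n A hA hμ => (eLpNorm_mono fun x => ?_).trans (H n A hA hμ)⟩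
  by_cases hx : x ∈ A
  · simpa [hx] using h n x
  · simp [hx]

/-- A function in `H^s(Ω)` that is an `H^s`-limit of test functions. -/
def MemHs0 (Ω : Set (E d)) (s : ℝ) (w : E d → ℝ) : Prop :=
  MemHs Ω s w ∧ ∀ ε : ℝ, 0 < ε → ∃ v, IsTestFunction Ω v ∧ hsNorm Ω s (fun x => w x - v x) < ε

lemma memHs0_congr {u w : E d → ℝ} (h : u =ᵐ[volume.restrict Ω] w) :
    MemHs0 Ω s u ↔ MemHs0 Ω s w := by
  have h1 : ∀ v : E d → ℝ, hsNorm Ω s (fun x => u x - v x) = hsNorm Ω s (fun x => w x - v x) := by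
    intro v
    have : (fun x => u x - v x) =ᵐ[volume.restrict Ω] fun x => w x - v x :=
      h.mono fun x hx => by simp only [hx]
    rw [hsNorm, hsNorm, hsInner_congr this this]
  simp only [MemHs0, memHs_congr h, h1]

lemma IsTestFunction.comp {v : E d → ℝ} (hv : IsTestFunction Ω v) {ζ : ℝ → ℝ}
    (hζ : ContDiff ℝ ∞ ζ) (h0 : ζ 0 = 0) : IsTestFunction Ω fun x => ζ (v x) where
  contDiff := hζ.comp hv.contDiff
  hasCompactSupport := hv.hasCompactSupport.comp_left h0
  tsupport_subset := (closure_mono (Function.support_comp_subset h0 v)).trans hv.tsupport_subset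

/-- Composition with a `1`-Lipschitz function that is a pointwise limit of smooth `1`-Lipschitz
functions preserves `H_0^s(Ω)`. -/
lemma memHs0_comp (hd : 0 < d) (hs0 : 0 < s) (hs1 : s < 1) (hΩ : Bornology.IsBounded Ω)
    [IsFiniteMeasure ((volume : Measure (E d)).restrict Ω)]
    {w : E d → ℝ} (hw : MemHs0 Ω s w) {ζ : ℝ → ℝ} {ζn : ℕ → ℝ → ℝ}
    (hζ : LipschitzWith 1 ζ) (h0 : ζ 0 = 0) (hζn : ∀ n, ContDiff ℝ ∞ (ζn n))
    (hζL : ∀ n, LipschitzWith 1 (ζn n)) (hζ0 : ∀ n, ζn n 0 = 0)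
    (hlim : ∀ x, Tendsto (fun n => ζn n x) atTop (𝓝 (ζ x))) : MemHs0 Ω s fun x => ζ (w x) := by
  obtain ⟨hwm, happ⟩ := hw
  have hζw := memHs_comp hwm hζ h0
  refine ⟨hζw, fun ε hε => ?_⟩
  choose v hv hvw using fun n : ℕ => happ (1 / ((n : ℝ) + 1)) (by positivity)
  have hvm := fun n => (hv n).memHs hd hs1 hΩ
  have hlim1 : Tendsto (fun n => hsNorm Ω s (w - v n)) atTop (𝓝 0) :=
    squeeze_zero (fun n => Real.sqrt_nonneg _) (fun n => (hvw n).le)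
      tendsto_one_div_add_atTop_nhds_zero_nat
  obtain ⟨hL, hI⟩ := (tendsto_hsNorm_zero_iff hs0 hs1 fun n => hwm.sub (hvm n)).1 hlim1
  have hL' : Tendsto (fun n => eLpNorm (v n - w) 2 (volume.restrict Ω)) atTop (𝓝 0) := by
    simpa only [eLpNorm_sub_comm] using hL
  have hI' : Tendsto (fun n => eLpNorm (hsIncr s (v n) - hsIncr s w) 2
      ((volume.restrict Ω).prod (volume.restrict Ω))) atTop (𝓝 0) := by
    simpa only [hsIncr_sub, eLpNorm_sub_comm] using hI
  have hw2 := memHs_iff.1 hwm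
  have hv2 := fun n => memHs_iff.1 (hvm n)
  -- Composition is not Lipschitz for the `H^s` seminorm, so convergence comes from Vitali's
  -- theorem: uniform integrability of `v n` and its increments passes to the compositions by
  -- domination, and a subsequence supplies convergence a.e.
  have uL := unifIntegrable_of_tendsto_Lp one_le_two ENNReal.ofNat_ne_top (fun n => (hv2 n).1)
    hw2.1 hL'
  have uI := unifIntegrable_of_tendsto_Lp one_le_two ENNReal.ofNat_ne_top (fun n => (hv2 n).2)
    hw2.2 hI'
  obtain ⟨φ, hφ, hae⟩ := (tendstoInMeasure_of_tendsto_eLpNorm two_ne_zero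
    (fun n => (hv2 n).1.1) hw2.1.1 hL').exists_seq_tendsto_ae
  set V : ℕ → E d → ℝ := fun n x => ζn n (v (φ n) x) with hV
  have hVt : ∀ n, IsTestFunction Ω (V n) := fun n => (hv (φ n)).comp (hζn n) (hζ0 n)
  have hVm := fun n => (hVt n).memHs hd hs1 hΩ
  have hV2 := fun n => memHs_iff.1 (hVm n)
  have haeV : ∀ᵐ x ∂(volume.restrict Ω), Tendsto (fun n => V n x) atTop (𝓝 (ζ (w x))) := by
    filter_upwards [hae] with x hx
    -- The common Lipschitz constant separates the two limits: the argument is frozen at `w x`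
    -- before `ζn n → ζ` is used.
    have h1 : Tendsto (fun n => V n x - ζn n (w x)) atTop (𝓝 0) := by
      refine squeeze_zero_norm (fun n => ?_) (tendsto_iff_norm_sub_tendsto_zero.1 hx)
      simpa [dist_eq_norm] using (hζL n).dist_le_mul (v (φ n) x) (w x)
    simpa using h1.add (hlim (w x))
  have haeI : ∀ᵐ z ∂((volume.restrict Ω).prod (volume.restrict Ω)),
      Tendsto (fun n => hsIncr s (V n) z) atTop (𝓝 (hsIncr s (fun x => ζ (w x)) z)) := by
    filter_upwards [Measure.quasiMeasurePreserving_fst.ae haeV,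
      Measure.quasiMeasurePreserving_snd.ae haeV] with z h1 h2
    exact (h1.sub h2).div_const _
  have uL' : UnifIntegrable V 2 (volume.restrict Ω) := by
    refine unifIntegrable_of_norm_le (g := fun n => v (φ n)) (fun ε hε => ?_) fun n x => ?_
    · obtain ⟨δ, hδ, H⟩ := uL hε
      exact ⟨δ, hδ, fun n => H (φ n)⟩
    · simpa [hζ0 n] using (hζL n).dist_le_mul (v (φ n) x) 0
  have uI' : UnifIntegrable (fun n => hsIncr s (V n)) 2
      ((volume.restrict Ω).prod (volume.restrict Ω)) := by
    refine unifIntegrable_of_norm_le (g := fun n => hsIncr s (v (φ n))) (fun ε hε => ?_)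
      fun n z => ?_
    · obtain ⟨δ, hδ, H⟩ := uI hε
      exact ⟨δ, hδ, fun n => H (φ n)⟩
    · rw [hsIncr, hsIncr, norm_div, norm_div]
      gcongr
      simpa [Real.dist_eq] using (hζL n).dist_le_mul (v (φ n) z.1) (v (φ n) z.2)
  have hζw2 := memHs_iff.1 hζw
  have tL := tendsto_Lp_finite_of_tendsto_ae one_le_two ENNReal.ofNat_ne_top
    (fun n => (hV2 n).1.1) hζw2.1 uL' haeV
  have tI := tendsto_Lp_finite_of_tendsto_ae one_le_two ENNReal.ofNat_ne_top
    (fun n => (hV2 n).2.1) hζw2.2 uI' haeI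
  have hfinal := (tendsto_hsNorm_zero_iff hs0 hs1 fun n => hζw.sub (hVm n)).2 ⟨by
    simpa only [eLpNorm_sub_comm] using tL, by
    simpa only [hsIncr_sub, eLpNorm_sub_comm] using tI⟩
  obtain ⟨n, hn⟩ := (hfinal.eventually (gt_mem_nhds hε)).exists
  exact ⟨V n, hVt n, hn⟩

lemma IsSmoothTruncation.lipschitzWith_sub_smul {η : ℝ → ℝ} (h : IsSmoothTruncation η) {t : ℝ}
    (ht0 : 0 ≤ t) (ht1 : t ≤ 1) : LipschitzWith 1 fun x => x - t * (x - η x) := by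
  refine LipschitzWith.of_dist_le_mul fun x y => ?_
  rw [Real.dist_eq, Real.dist_eq, NNReal.coe_one, one_mul]
  have h1 := h.abs_sub_le x y
  calc |x - t * (x - η x) - (y - t * (y - η y))|
      = |(1 - t) * (x - y) + t * (η x - η y)| := by congr 1; ring
    _ ≤ |(1 - t) * (x - y)| + |t * (η x - η y)| := abs_add_le _ _
    _ = (1 - t) * |x - y| + t * |η x - η y| := by
        rw [abs_mul, abs_mul, abs_of_nonneg ht0, abs_of_nonneg (sub_nonneg.2 ht1)]
    _ ≤ (1 - t) * |x - y| + t * |x - y| := by gcongr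
    _ = |x - y| := by ring

lemma IsSmoothTruncation.lipschitzWith_id_sub {η : ℝ → ℝ} (h : IsSmoothTruncation η) :
    LipschitzWith 1 fun x => x - η x := by
  refine LipschitzWith.of_dist_le_mul fun x y => ?_
  rw [Real.dist_eq, Real.dist_eq, NNReal.coe_one, one_mul]
  rcases le_total x y with hxy | hxy
  · have h1 := h.monotone hxy
    have h2 := h.monotone_sub hxy
    simp only at h2
    rw [abs_of_nonpos (by linarith), abs_of_nonpos (by linarith)]
    linarith
  · have h1 := h.monotone hxy
    have h2 := h.monotone_sub hxy
    simp only at h2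
    rw [abs_of_nonneg (by linarith), abs_of_nonneg (by linarith)]
    linarith

/-- The energy inequality is that of `H^s(Ω)`; only membership in the closure of the test functions
is new. -/
lemma splitsTruncation_Hs0 (hd : 0 < d) (hs0 : 0 < s) (hs1 : s < 1) (hΩ : Bornology.IsBounded Ω)
    [IsFiniteMeasure ((volume : Measure (E d)).restrict Ω)] {w : L2 Ω}
    (hw : w ∈ FracSpace.Hs0.carrier Ω s) (k : ℝ≥0) : SplitsTruncation .Hs0 Ω s w k := by
  obtain ⟨η, hη, hηk⟩ := exists_isSmoothTruncation_seq k
  have hlim : ∀ x, Tendsto (fun n => η n x) atTop (𝓝 (min x k)) := fun x =>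
    tendsto_iff_norm_sub_tendsto_zero.2 (squeeze_zero (fun n => norm_nonneg _)
      (fun n => hηk n x) tendsto_one_div_add_atTop_nhds_zero_nat)
  refine ⟨(memHs0_congr (coeFn_excess k w)).2 ?_, fun t ht0 ht1 =>
    (memHs0_congr (coeFn_sub_smul_excess k t w)).2 ?_,
    (splitsTruncation_Hs hs0 hs1 hw.1 k).inner_le⟩
  · exact memHs0_comp hd hs0 hs1 hΩ hw (lipschitzWith_excess k) (by simp)
      (fun n => contDiff_id.sub (hη n).contDiff) (fun n => (hη n).lipschitzWith_id_sub)
      (fun n => by simp [(hη n).map_zero]) (fun x => (hlim x).const_sub x)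
  · exact memHs0_comp hd hs0 hs1 hΩ hw (lipschitzWith_sub_smul_excess k ht0 ht1) (by simp)
      (fun n => contDiff_id.sub (contDiff_const.mul (contDiff_id.sub (hη n).contDiff)))
      (fun n => (hη n).lipschitzWith_sub_smul ht0 ht1)
      (fun n => by simp [(hη n).map_zero])
      (fun x => (((hlim x).const_sub x).const_mul t).const_sub x)

/-! ### Pairings with orthogonal projections -/

lemma inner_starProjection {H : Type*} [NormedAddCommGroup H] [InnerProductSpace ℝ H]
    (K : Submodule ℝ H) [K.HasOrthogonalProjection] (w v : H) :
    ⟪w, K.starProjection v⟫_ℝ = ⟪K.starProjection w, K.starProjection v⟫_ℝ := by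
  rw [Submodule.inner_starProjection_left_eq_right,
    Submodule.starProjection_eq_self_iff.2 (Submodule.starProjection_apply_mem _ _)]

lemma inner_sum_smul {H : Type*} [NormedAddCommGroup H] [InnerProductSpace ℝ H]
    (S : ℝ → Submodule ℝ H) [∀ l, (S l).HasOrthogonalProjection] (w v : H) (b : ℝ → ℝ)
    (F : Finset ℝ) :
    ⟪w, ∑ l ∈ F, b l • (S l).starProjection v⟫_ℝ =
      ∑ l ∈ F, b l * ⟪(S l).starProjection w, (S l).starProjection v⟫_ℝ := by
  rw [inner_sum]
  exact Finset.sum_congr rfl fun l _ => by rw [real_inner_smul_right, inner_starProjection]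

/-! ### Spectral calculus for a compactly embedded form domain -/

section Spectral

variable {H V : Type*} [NormedAddCommGroup H] [InnerProductSpace ℝ H] [CompleteSpace H]
  [NormedAddCommGroup V] [InnerProductSpace ℝ V] [CompleteSpace V]

/-- A compact embedding `ι` of a form domain `V` into `H` with dense range, where the norm of `V`
is the sum of the norm of `H` and the form, together with the eigenspaces `S l` of the operator
associated with the form. -/
structure IsFormSpectrum (ι : V →L[ℝ] H) (S : ℝ → Submodule ℝ H) : Prop where
  compact : IsCompactOperator ι
  dense : DenseRange ι
  norm_le : ∀ z, ‖ι z‖ ≤ ‖z‖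
  mem_iff : ∀ l φ, φ ∈ S l ↔ (1 + l) • ι (ι.adjoint φ) = φ

namespace IsFormSpectrum

variable {ι : V →L[ℝ] H} {S : ℝ → Submodule ℝ H}

/-- With `z = (1 + l) ι* φ` one has `ι z = φ` and `‖z‖² = (1 + l) ‖φ‖²`, so `‖ι z‖ ≤ ‖z‖` says `l
‖φ‖² ≥ 0`. -/
lemma eq_zero_of_neg (h : IsFormSpectrum ι S) {l : ℝ} (hl : l < 0) {φ : H} (hφ : φ ∈ S l) :
    φ = 0 := by
  rw [h.mem_iff] at hφ
  have h1 : ‖(1 + l) • ι.adjoint φ‖ ^ 2 = (1 + l) * ‖φ‖ ^ 2 := by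
    rw [← real_inner_self_eq_norm_sq, real_inner_smul_left, ContinuousLinearMap.adjoint_inner_left,
      map_smul, hφ, real_inner_self_eq_norm_sq]
  have h2 := h.norm_le ((1 + l) • ι.adjoint φ)
  rw [map_smul, hφ] at h2
  have h3 := pow_le_pow_left₀ (norm_nonneg _) h2 2
  rw [h1] at h3
  have h4 : ‖φ‖ ^ 2 ≤ 0 := by nlinarith [sq_nonneg ‖φ‖]
  simpa using h4

lemma inner_eq_zero (h : IsFormSpectrum ι S) {l m : ℝ} (hlm : l ≠ m) {φ ψ : H} (hφ : φ ∈ S l)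
    (hψ : ψ ∈ S m) : ⟪φ, ψ⟫_ℝ = 0 := by
  rw [h.mem_iff] at hφ hψ
  have h1 : ⟪ι (ι.adjoint φ), ψ⟫_ℝ = ⟪φ, ι (ι.adjoint ψ)⟫_ℝ := by
    rw [← ContinuousLinearMap.adjoint_inner_right, ContinuousLinearMap.adjoint_inner_left]
  have h2 : ⟪φ, ψ⟫_ℝ = (1 + l) * ⟪ι (ι.adjoint φ), ψ⟫_ℝ := by
    rw [← real_inner_smul_left, hφ]
  have h3 : ⟪φ, ψ⟫_ℝ = (1 + m) * ⟪ι (ι.adjoint φ), ψ⟫_ℝ := by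
    rw [h1, ← real_inner_smul_right, hψ]
  have h4 : (l - m) * ⟪ι (ι.adjoint φ), ψ⟫_ℝ = 0 := by linarith
  rw [h2, (mul_eq_zero.1 h4).resolve_left (sub_ne_zero.2 hlm), mul_zero]

lemma orthogonalFamily (h : IsFormSpectrum ι S) :
    OrthogonalFamily ℝ (fun l => S l) fun l => (S l).subtypeₗᵢ :=
  fun _ _ hlm φ ψ => h.inner_eq_zero hlm φ.2 ψ.2

/-- The spectral theorem for the compact symmetric operator `ι ι*`; density of the range of `ι`
rules out the eigenvalue `0`. -/
lemma orthogonal_iSup_eq_bot (h : IsFormSpectrum ι S) : (⨆ l, S l)ᗮ = ⊥ := by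
  set R : H →L[ℝ] H := ι ∘L ι.adjoint with hR
  have hc : IsCompactOperator R := h.compact.comp_clm ι.adjoint
  have hs : R.IsSymmetric := fun φ ψ => by
    change ⟪ι (ι.adjoint φ), ψ⟫_ℝ = ⟪φ, ι (ι.adjoint ψ)⟫_ℝ
    rw [← ContinuousLinearMap.adjoint_inner_right, ContinuousLinearMap.adjoint_inner_left]
  rw [eq_bot_iff, ← ContinuousLinearMap.orthogonalComplement_iSup_eigenspaces_eq_bot hc hs]
  apply Submodule.orthogonal_le
  refine iSup_le fun μ => ?_
  intro φ hφ
  rw [Module.End.mem_eigenspace_iff] at hφ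
  change ι (ι.adjoint φ) = μ • φ at hφ
  rcases eq_or_ne μ 0 with h0 | h0
  · rw [h0, zero_smul] at hφ
    have h1 : ι.adjoint φ = 0 := by
      rw [← inner_self_eq_zero (𝕜 := ℝ), ContinuousLinearMap.adjoint_inner_left, hφ,
        inner_zero_right]
    have h2 : φ = 0 := by
      refine h.dense.eq_zero_of_inner_left ℝ fun y => ?_
      rw [← ContinuousLinearMap.adjoint_inner_left, h1, inner_zero_left]
    rw [h2]; exact zero_mem _
  -- An eigenvalue `μ` of `ι ι*` corresponds to `l` through `μ (1 + l) = 1`.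
  · refine Submodule.mem_iSup_of_mem (μ⁻¹ - 1) ?_
    rw [h.mem_iff, hφ, smul_smul]
    rw [add_sub_cancel, inv_mul_cancel₀ h0, one_smul]

variable [∀ l, (S l).HasOrthogonalProjection]

lemma starProjection_eq_zero_of_neg (h : IsFormSpectrum ι S) {l : ℝ} (hl : l < 0) (w : H) :
    (S l).starProjection w = 0 :=
  h.eq_zero_of_neg hl (Submodule.starProjection_apply_mem _ _)

lemma inner_sum_sum (h : IsFormSpectrum ι S) (w v : H) (a b : ℝ → ℝ) (F : Finset ℝ) :
    ⟪∑ l ∈ F, a l • (S l).starProjection w, ∑ l ∈ F, b l • (S l).starProjection v⟫_ℝ =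
      ∑ l ∈ F, a l * b l * ⟪(S l).starProjection w, (S l).starProjection v⟫_ℝ := by
  rw [inner_sum]
  refine Finset.sum_congr rfl fun l hl => ?_
  rw [sum_inner, Finset.sum_eq_single_of_mem l hl fun m _ hml => by
    rw [real_inner_smul_left, real_inner_smul_right,
      h.inner_eq_zero hml (Submodule.starProjection_apply_mem _ _)
      (Submodule.starProjection_apply_mem _ _)]; simp]
  rw [real_inner_smul_left, real_inner_smul_right]; ring

lemma norm_sub_sum_sq (h : IsFormSpectrum ι S) (w : H) (b : ℝ → ℝ) (F : Finset ℝ) :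
    ‖w - ∑ l ∈ F, b l • (S l).starProjection w‖ ^ 2 =
      ‖w‖ ^ 2 + ∑ l ∈ F, (b l ^ 2 - 2 * b l) * ‖(S l).starProjection w‖ ^ 2 := by
  rw [norm_sub_sq_real, inner_sum_smul, ← real_inner_self_eq_norm_sq (∑ l ∈ F, _),
    h.inner_sum_sum, Finset.mul_sum, sub_add, ← Finset.sum_sub_distrib, sub_eq_add_neg,
    ← Finset.sum_neg_distrib]
  congr 1
  refine Finset.sum_congr rfl fun l _ => ?_
  rw [real_inner_self_eq_norm_sq]; ring

lemma sum_norm_sq_le (h : IsFormSpectrum ι S) (w : H) (F : Finset ℝ) :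
    ∑ l ∈ F, ‖(S l).starProjection w‖ ^ 2 ≤ ‖w‖ ^ 2 := by
  have h1 := h.norm_sub_sum_sq w (fun _ => 1) F
  have h2 := sq_nonneg ‖w - ∑ l ∈ F, (1 : ℝ) • (S l).starProjection w‖
  rw [h1] at h2
  have h3 : ∑ l ∈ F, ((1 : ℝ) ^ 2 - 2 * 1) * ‖(S l).starProjection w‖ ^ 2 =
      - ∑ l ∈ F, ‖(S l).starProjection w‖ ^ 2 := by
    rw [← Finset.sum_neg_distrib]
    exact Finset.sum_congr rfl fun l _ => by ring
  linarith

lemma summable_norm_sq (h : IsFormSpectrum ι S) (w : H) :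
    Summable fun l => ‖(S l).starProjection w‖ ^ 2 :=
  summable_of_sum_le (fun _ => sq_nonneg _) (h.sum_norm_sq_le w)

/-- Bessel's inequality makes the orthogonal series converge, and the defect is orthogonal to every
eigenspace, hence zero. -/
lemma hasSum_starProjection (h : IsFormSpectrum ι S) (w : H) :
    HasSum (fun l => (S l).starProjection w) w := by
  have hs : Summable fun l => (S l).starProjection w :=
    (h.orthogonalFamily.summable_iff_norm_sq_summable
      fun l => ⟨(S l).starProjection w, Submodule.starProjection_apply_mem _ _⟩).2
      (h.summable_norm_sq w)
  obtain ⟨y, hy⟩ := hs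
  have h1 : w - y ∈ (⨆ l, S l)ᗮ := by
    rw [← Submodule.iInf_orthogonal, Submodule.mem_iInf]
    intro m
    rw [Submodule.mem_orthogonal]
    intro φ hφ
    have h2 : HasSum (fun l => ⟪φ, (S l).starProjection w⟫_ℝ) ⟪φ, y⟫_ℝ :=
      (innerSL ℝ φ).hasSum hy
    have h3 : HasSum (fun l => ⟪φ, (S l).starProjection w⟫_ℝ) ⟪φ, (S m).starProjection w⟫_ℝ :=
      hasSum_single m fun l hl =>
        h.inner_eq_zero hl.symm hφ (Submodule.starProjection_apply_mem _ _)
    rw [inner_sub_right, h2.unique h3, ← Submodule.inner_starProjection_left_eq_right,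
      Submodule.starProjection_eq_self_iff.2 hφ, sub_self]
  rw [h.orthogonal_iSup_eq_bot, Submodule.mem_bot, sub_eq_zero] at h1
  rwa [← h1] at hy

/-- Lower bound for the form in terms of the spectral projections. -/
lemma sum_mul_norm_sq_le (h : IsFormSpectrum ι S) (z : V) (F : Finset ℝ) :
    ∑ l ∈ F, l * ‖(S l).starProjection (ι z)‖ ^ 2 ≤ ‖z‖ ^ 2 - ‖ι z‖ ^ 2 := by
  set Q : H := ∑ l ∈ F, (1 + l) • (S l).starProjection (ι z) with hQ
  -- On `S l` the operator `ι ι*` is division by `1 + l`, so `y` is the partial spectral sum of `z`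
  -- lifted to `V`. The claim is nonnegativity of the form on `z - y`.
  set y : V := ι.adjoint Q with hy
  have hιy : ι y = ∑ l ∈ F, (1 : ℝ) • (S l).starProjection (ι z) := by
    rw [hy, hQ, map_sum, map_sum]
    refine Finset.sum_congr rfl fun l _ => ?_
    rw [map_smul, map_smul, one_smul]
    exact (h.mem_iff l _).1 (Submodule.starProjection_apply_mem _ _)
  have h1 : ⟪z, y⟫_ℝ = ∑ l ∈ F, (1 + l) * ‖(S l).starProjection (ι z)‖ ^ 2 := by
    rw [hy, ContinuousLinearMap.adjoint_inner_right, hQ, inner_sum_smul]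
    simp_rw [real_inner_self_eq_norm_sq]
  have h2 : ‖y‖ ^ 2 = ∑ l ∈ F, (1 + l) * ‖(S l).starProjection (ι z)‖ ^ 2 := by
    rw [← real_inner_self_eq_norm_sq]
    nth_rw 2 [hy]
    rw [ContinuousLinearMap.adjoint_inner_right, hιy, hQ, h.inner_sum_sum]
    simp_rw [real_inner_self_eq_norm_sq, one_mul]
  have h3 := h.norm_le (z - y)
  have h4 := pow_le_pow_left₀ (norm_nonneg _) h3 2
  rw [map_sub, hιy, h.norm_sub_sum_sq, norm_sub_sq_real, h1, h2] at h4
  have h5 : ∑ l ∈ F, l * ‖(S l).starProjection (ι z)‖ ^ 2 =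
      ∑ l ∈ F, (1 + l) * ‖(S l).starProjection (ι z)‖ ^ 2 +
      ∑ l ∈ F, ((1 : ℝ) ^ 2 - 2 * 1) * ‖(S l).starProjection (ι z)‖ ^ 2 := by
    rw [← Finset.sum_add_distrib]
    exact Finset.sum_congr rfl fun l _ => by ring
  linarith

/-- The resolvent energy is a lower bound of the regularized distance to the form domain. -/
lemma sum_div_mul_norm_sq_le (h : IsFormSpectrum ι S) (w : H) (z : V) {t : ℝ} (ht : 0 < t)
    (F : Finset ℝ) :
    ∑ l ∈ F, l / (t + l) * ‖(S l).starProjection w‖ ^ 2 ≤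
      ‖w - ι z‖ ^ 2 + t⁻¹ * (‖z‖ ^ 2 - ‖ι z‖ ^ 2) := by
  have h1 := h.sum_norm_sq_le (w - ι z) F
  have h2 := mul_le_mul_of_nonneg_left (h.sum_mul_norm_sq_le z F) (inv_pos.2 ht).le
  refine le_trans ?_ (add_le_add h1 h2)
  rw [Finset.mul_sum, ← Finset.sum_add_distrib]
  refine Finset.sum_le_sum fun l _ => ?_
  rcases lt_or_ge l 0 with hl | hl
  · simp [h.starProjection_eq_zero_of_neg hl]
  rw [map_sub]
  set a := (S l).starProjection w
  set b := (S l).starProjection (ι z)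
  have h3 : ‖a‖ ≤ ‖a - b‖ + ‖b‖ := by simpa using norm_add_le (a - b) b
  have h4 : ‖a‖ ^ 2 ≤ (‖a - b‖ + ‖b‖) ^ 2 := pow_le_pow_left₀ (norm_nonneg _) h3 2
  have htl : 0 < t + l := by linarith
  calc l / (t + l) * ‖a‖ ^ 2 ≤ l / (t + l) * (‖a - b‖ + ‖b‖) ^ 2 := by gcongr
    _ ≤ ‖a - b‖ ^ 2 + t⁻¹ * (l * ‖b‖ ^ 2) := by
      rw [div_mul_eq_mul_div, div_le_iff₀ htl, ← sub_nonneg]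
      -- The square vanishes at the optimal splitting `t ‖a - b‖ = l ‖b‖`, so the weight `l / (t +
      -- l)` is sharp.
      have : (‖a - b‖ ^ 2 + t⁻¹ * (l * ‖b‖ ^ 2)) * (t + l) - l * (‖a - b‖ + ‖b‖) ^ 2
          = t⁻¹ * (t * ‖a - b‖ - l * ‖b‖) ^ 2 := by
        field_simp
        ring
      rw [this]
      positivity

/-- The resolvent energy is attained up to `ε` by the regularized distance to the form domain. -/
lemma exists_form_le (h : IsFormSpectrum ι S) (w : H) {t ε : ℝ} (ht : 0 < t) (hε : 0 < ε) :
    ∃ (z : V) (F : Finset ℝ), ‖w - ι z‖ ^ 2 + t⁻¹ * (‖z‖ ^ 2 - ‖ι z‖ ^ 2) ≤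
      ∑ l ∈ F, l / (t + l) * ‖(S l).starProjection w‖ ^ 2 + ε := by
  obtain ⟨F, hF⟩ : ∃ F : Finset ℝ, ‖w - ∑ l ∈ F, (S l).starProjection w‖ ^ 2 < ε := by
    have h1 : Tendsto (fun F : Finset ℝ => ‖w - ∑ l ∈ F, (S l).starProjection w‖ ^ 2) atTop
        (𝓝 0) := by
      simpa using ((tendsto_const_nhds (x := w)).sub (h.hasSum_starProjection w)).norm.pow 2
    exact (h1.eventually (gt_mem_nhds hε)).exists
  -- The minimizer is the resolvent `(1 + A/t)⁻¹ w`, with `A` the operator of the form, truncated to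
  -- finitely many eigenvalues; the factor `1 + l` in `Q` is undone by `ι ι*`.
  set κ : ℝ → ℝ := fun l => t / (t + l) with hκ
  set Q : H := ∑ l ∈ F, (κ l * (1 + l)) • (S l).starProjection w with hQ
  refine ⟨ι.adjoint Q, F, ?_⟩
  have hι : ι (ι.adjoint Q) = ∑ l ∈ F, κ l • (S l).starProjection w := by
    rw [hQ, map_sum, map_sum]
    refine Finset.sum_congr rfl fun l _ => ?_
    rw [map_smul, map_smul, mul_smul]
    congr 1
    exact (h.mem_iff l _).1 (Submodule.starProjection_apply_mem _ _)
  have h1 : ‖ι.adjoint Q‖ ^ 2 = ∑ l ∈ F, κ l ^ 2 * (1 + l) * ‖(S l).starProjection w‖ ^ 2 := by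
    rw [← real_inner_self_eq_norm_sq, ContinuousLinearMap.adjoint_inner_right, hι, hQ,
      h.inner_sum_sum]
    refine Finset.sum_congr rfl fun l _ => ?_
    rw [real_inner_self_eq_norm_sq]; ring
  have h2 : ‖ι (ι.adjoint Q)‖ ^ 2 = ∑ l ∈ F, κ l ^ 2 * ‖(S l).starProjection w‖ ^ 2 := by
    rw [← real_inner_self_eq_norm_sq, hι, h.inner_sum_sum]
    refine Finset.sum_congr rfl fun l _ => ?_
    rw [real_inner_self_eq_norm_sq]; ring
  have h3 := h.norm_sub_sum_sq w (fun _ => 1) F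
  simp only [one_smul] at h3
  rw [h3] at hF
  rw [h1, h2, hι, h.norm_sub_sum_sq]
  -- Termwise `κ² - 2κ + l κ² / t = -κ = l / (t + l) - 1`; the `-1` combines with `‖w‖²` into the
  -- tail bounded by `ε`.
  have h4 : ∑ l ∈ F, (κ l ^ 2 - 2 * κ l) * ‖(S l).starProjection w‖ ^ 2 +
      t⁻¹ * (∑ l ∈ F, κ l ^ 2 * (1 + l) * ‖(S l).starProjection w‖ ^ 2 -
        ∑ l ∈ F, κ l ^ 2 * ‖(S l).starProjection w‖ ^ 2) =
      ∑ l ∈ F, l / (t + l) * ‖(S l).starProjection w‖ ^ 2 +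
      ∑ l ∈ F, ((1 : ℝ) ^ 2 - 2 * 1) * ‖(S l).starProjection w‖ ^ 2 := by
    rw [← Finset.sum_sub_distrib, Finset.mul_sum, ← Finset.sum_add_distrib,
      ← Finset.sum_add_distrib]
    refine Finset.sum_congr rfl fun l _ => ?_
    rcases lt_or_ge l 0 with hl | hl
    · simp [h.starProjection_eq_zero_of_neg hl]
    have htl : t + l ≠ 0 := by linarith
    simp only [hκ]
    field_simp
    ring
  rw [add_assoc, h4, add_left_comm]
  exact add_le_add le_rfl hF.le

end IsFormSpectrum

end Spectral

/-! ### Fractional powers as integrals of resolvents -/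

/-- Inequalities for resolvent energies integrate to inequalities for fractional powers. -/
lemma sum_rpow_le_tsum_of_resolvent {s : ℝ} (hs0 : 0 < s) (hs1 : s < 1) {a b : ℝ → ℝ}
    (ha : ∀ l, 0 ≤ a l) (hb : ∀ l, 0 ≤ b l) (ha0 : ∀ l < 0, a l = 0) (hb0 : ∀ l < 0, b l = 0)
    (hbc : (Function.support b).Countable) (F : Finset ℝ)
    (h : ∀ t : ℝ, 0 < t → ∑ l ∈ F, ENNReal.ofReal (l / (t + l) * a l) ≤
      ∑' l, ENNReal.ofReal (l / (t + l) * b l)) :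
    ∑ l ∈ F, ENNReal.ofReal (l ^ s * a l) ≤ ∑' l, ENNReal.ofReal (l ^ s * b l) := by
  -- For `0 < s < 1`, `l ^ s` is the integral over `t > 0` of `t ^ (s - 1) * l / (t + l)` against a
  -- fixed measure.
  obtain ⟨μ, hμ⟩ := Real.exists_measure_rpow_eq_integral_rpowIntegrand₀₁ (p := s) ⟨hs0, hs1⟩
  set ν := μ.restrict (Ioi 0) with hν
  have hm : ∀ l : ℝ, 0 ≤ l → AEMeasurable (fun t => Real.rpowIntegrand₀₁ s t l) ν :=
    fun l hl => (hμ l hl).1.aemeasurable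
  have key : ∀ (c : ℝ → ℝ), (∀ l, 0 ≤ c l) → (∀ l < 0, c l = 0) → ∀ l,
      AEMeasurable (fun t => ENNReal.ofReal (Real.rpowIntegrand₀₁ s t l * c l)) ν ∧
      ENNReal.ofReal (l ^ s * c l) =
        ∫⁻ t, ENNReal.ofReal (Real.rpowIntegrand₀₁ s t l * c l) ∂ν := by
    intro c hc hc0 l
    rcases lt_or_ge l 0 with hl | hl
    · simp [hc0 l hl]
    refine ⟨((hm l hl).mul_const _).ennreal_ofReal, ?_⟩
    rw [(hμ l hl).2, ← integral_mul_const]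
    refine ofReal_integral_eq_lintegral_ofReal ((hμ l hl).1.mul_const _) ?_
    rw [Filter.EventuallyLE, ae_restrict_iff' measurableSet_Ioi]
    exact ae_of_all _ fun t ht =>
      mul_nonneg (Real.rpowIntegrand₀₁_nonneg hs0 (le_of_lt ht) hl) (hc l)
  have hpt : ∀ (c : ℝ → ℝ), (∀ l < 0, c l = 0) → ∀ t ∈ Ioi (0 : ℝ), ∀ l,
      ENNReal.ofReal (Real.rpowIntegrand₀₁ s t l * c l) =
      ENNReal.ofReal (t ^ (s - 1)) * ENNReal.ofReal (l / (t + l) * c l) := by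
    intro c hc0 t ht l
    rcases lt_or_ge l 0 with hl | hl
    · simp [hc0 l hl]
    rw [Real.rpowIntegrand₀₁_eq_pow_div ⟨hs0, hs1⟩ (le_of_lt ht) hl,
      ← ENNReal.ofReal_mul (Real.rpow_nonneg (le_of_lt ht) _)]
    congr 1; ring
  -- The sum runs over all reals; restricting it to the countable support of `b` allows the exchange
  -- with the integral in `t`.
  have hbs : ∀ g : ℝ → ℝ, ∑' l, ENNReal.ofReal (g l * b l) =
      ∑' l : Function.support b, ENNReal.ofReal (g l * b l) := fun g =>
    (tsum_subtype_eq_of_support_subset fun l hl => by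
      rw [Function.mem_support] at hl ⊢
      intro h0
      rw [h0] at hl
      simp at hl).symm
  have : Countable (Function.support b) := hbc.to_subtype
  calc ∑ l ∈ F, ENNReal.ofReal (l ^ s * a l)
      = ∑ l ∈ F, ∫⁻ t, ENNReal.ofReal (Real.rpowIntegrand₀₁ s t l * a l) ∂ν :=
        Finset.sum_congr rfl fun l _ => (key a ha ha0 l).2
    _ = ∫⁻ t, ∑ l ∈ F, ENNReal.ofReal (Real.rpowIntegrand₀₁ s t l * a l) ∂ν :=
        (lintegral_finsetSum' _ fun l _ => (key a ha ha0 l).1).symm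
    _ ≤ ∫⁻ t, ∑' l : Function.support b,
          ENNReal.ofReal (Real.rpowIntegrand₀₁ s t l * b l) ∂ν := by
        apply lintegral_mono_ae
        rw [ae_restrict_iff' measurableSet_Ioi]
        refine ae_of_all _ fun t ht => ?_
        rw [← hbs]
        simp_rw [hpt a ha0 t ht, hpt b hb0 t ht]
        rw [← Finset.mul_sum, ENNReal.tsum_mul_left]
        exact mul_le_mul_right (h t ht) _
    _ = ∑' l : Function.support b, ∫⁻ t, ENNReal.ofReal (Real.rpowIntegrand₀₁ s t l * b l) ∂ν :=
        lintegral_tsum fun l => (key b hb hb0 l).1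
    _ = ∑' l : Function.support b, ENNReal.ofReal ((l : ℝ) ^ s * b l) :=
        tsum_congr fun l => ((key b hb hb0 l).2).symm
    _ = _ := (hbs fun l => l ^ s).symm

/-! ### Approximation by local averages -/

lemma sq_lintegral_le {X : Type*} [MeasurableSpace X] {P : Measure X} [IsProbabilityMeasure P]
    {f : X → ℝ≥0∞} (hf : AEMeasurable f P) : (∫⁻ x, f x ∂P) ^ 2 ≤ ∫⁻ x, f x ^ 2 ∂P := by
  have h := ENNReal.lintegral_mul_le_Lp_mul_Lq P Real.HolderConjugate.two_two hf
    (aemeasurable_const (b := (1 : ℝ≥0∞)))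
  simp only [Pi.mul_apply, mul_one, ENNReal.one_rpow, lintegral_const, measure_univ] at h
  have h2 := pow_le_pow_left' h 2
  refine h2.trans (le_of_eq ?_)
  rw [← ENNReal.rpow_natCast, ← ENNReal.rpow_mul]
  simp

lemma continuous_gradient {v : E d → ℝ} (hv : ContDiff ℝ 1 v) : Continuous (gradient v) :=
  (InnerProductSpace.toDual ℝ (E d)).symm.continuous.comp (hv.continuous_fderiv one_ne_zero)

/-- The fundamental theorem of calculus along the segment from `x` to `x + z`, with Cauchy-Schwarz
for the directional derivative. -/
lemma enorm_translate_sub_le {v : E d → ℝ} (hv : ContDiff ℝ 1 v) (x z : E d) :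
    ‖v (x + z) - v x‖ₑ ≤ ∫⁻ τ in Ioc (0 : ℝ) 1, ‖gradient v (x + τ • z)‖ₑ * ‖z‖ₑ := by
  have hcont : Continuous fun τ : ℝ => fderiv ℝ v (x + τ • z) z :=
    ((hv.continuous_fderiv one_ne_zero).comp (by fun_prop)).clm_apply continuous_const
  have h1 : ∫ τ in (0 : ℝ)..1, fderiv ℝ v (x + τ • z) z = v (x + z) - v x := by
    have h2 : ∀ τ ∈ uIcc (0 : ℝ) 1,
        HasDerivAt (fun τ : ℝ => v (x + τ • z)) (fderiv ℝ v (x + τ • z) z) τ := fun τ _ => by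
      have h3 : HasDerivAt (fun τ : ℝ => x + τ • z) z τ := by
        simpa using ((hasDerivAt_id τ).smul_const z).const_add x
      exact ((hv.differentiable one_ne_zero).differentiableAt.hasFDerivAt).comp_hasDerivAt τ h3
    have h4 := intervalIntegral.integral_eq_sub_of_hasDerivAt h2 (hcont.intervalIntegrable _ _)
    simpa using h4
  rw [← h1, intervalIntegral.integral_of_le zero_le_one]
  refine (enorm_integral_le_lintegral_enorm _).trans (lintegral_mono fun τ => ?_)
  rw [← inner_gradient_left, ← enorm_norm (gradient v _), ← enorm_norm z, ← enorm_mul,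
    enorm_le_iff_norm_le]
  rw [norm_mul, norm_norm, norm_norm]
  exact norm_inner_le_norm _ _

/-- Difference quotients are controlled by the gradient in `L²`. -/
lemma lintegral_translate_sub_sq_le {v : E d → ℝ} (hv : ContDiff ℝ 1 v) (z : E d) :
    ∫⁻ x, ‖v (x + z) - v x‖ₑ ^ 2 ≤ ‖z‖ₑ ^ 2 * ∫⁻ x, ‖gradient v x‖ₑ ^ 2 := by
  have hP : IsProbabilityMeasure ((volume : Measure ℝ).restrict (Ioc 0 1)) := ⟨by simp⟩
  have hg := continuous_gradient hv
  have hm : Measurable fun y : E d × ℝ => ‖gradient v (y.1 + y.2 • z)‖ₑ ^ 2 :=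
    ((hg.comp (by fun_prop : Continuous fun y : E d × ℝ => y.1 + y.2 • z)).measurable).enorm.pow_const
      2
  calc ∫⁻ x, ‖v (x + z) - v x‖ₑ ^ 2
      ≤ ∫⁻ x, ∫⁻ τ in Ioc (0 : ℝ) 1, ‖gradient v (x + τ • z)‖ₑ ^ 2 * ‖z‖ₑ ^ 2 := by
        refine lintegral_mono fun x => ?_
        refine (pow_le_pow_left' (enorm_translate_sub_le hv x z) 2).trans ?_
        refine (sq_lintegral_le ?_).trans (lintegral_mono fun τ => (mul_pow _ _ 2).le)
        exact (((hg.comp (by fun_prop : Continuous fun τ : ℝ => x + τ • z)).measurable).enorm.mul_const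
          _).aemeasurable
    _ = ∫⁻ τ in Ioc (0 : ℝ) 1, ∫⁻ x, ‖gradient v (x + τ • z)‖ₑ ^ 2 * ‖z‖ₑ ^ 2 :=
        lintegral_lintegral_swap (hm.mul_const _).aemeasurable
    _ = ∫⁻ _ in Ioc (0 : ℝ) 1, ‖z‖ₑ ^ 2 * ∫⁻ x, ‖gradient v x‖ₑ ^ 2 := by
        refine lintegral_congr fun τ => ?_
        rw [lintegral_mul_const' _ _ (by finiteness), mul_comm,
          lintegral_add_right_eq_self (fun x => ‖gradient v x‖ₑ ^ 2) (τ • z)]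
    _ = _ := by rw [lintegral_const, measure_univ, mul_one]

/-- Jensen's inequality for the normalized measure on the ball; for `x` and `y` in a ball of radius
`h` the difference `y - x` lies in the centred ball of radius `2h`. -/
lemma enorm_sub_average_sq_le {v : E d → ℝ} (hv : Continuous v) {c x : E d} {h : ℝ} (hh : 0 < h)
    (hx : x ∈ Metric.ball c h) :
    ‖v x - (volume (Metric.ball c h)).toReal⁻¹ * ∫ y in Metric.ball c h, v y‖ₑ ^ 2 ≤
      (volume (Metric.ball (0 : E d) h))⁻¹ *
        ∫⁻ z in Metric.ball (0 : E d) (2 * h), ‖v (x + z) - v x‖ₑ ^ 2 := by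
  set B := Metric.ball c h with hB
  have hB0 : volume B ≠ 0 := (Metric.measure_ball_pos volume c hh).ne'
  have hBt : volume B ≠ ⊤ := measure_ball_lt_top.ne
  set P : Measure (E d) := (volume B)⁻¹ • volume.restrict B with hPdef
  have hP : IsProbabilityMeasure P := ⟨by simp [hPdef, ENNReal.inv_mul_cancel hB0 hBt]⟩
  have hi : IntegrableOn v B :=
    (hv.continuousOn.integrableOn_compact (isCompact_closedBall c h)).mono_set
      Metric.ball_subset_closedBall
  have hiP : Integrable v P := hi.smul_measure (ENNReal.inv_ne_top.2 hB0)
  have hav : (volume B).toReal⁻¹ * ∫ y in B, v y = ∫ y, v y ∂P := by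
    rw [hPdef, integral_smul_measure, ENNReal.toReal_inv, smul_eq_mul]
  have h1 : v x - ∫ y, v y ∂P = ∫ y, (v x - v y) ∂P := by
    rw [integral_sub (integrable_const _) hiP]; simp
  have hBv : volume B = volume (Metric.ball (0 : E d) h) := Measure.addHaar_ball_center volume c h
  rw [hav, h1]
  calc ‖∫ y, (v x - v y) ∂P‖ₑ ^ 2 ≤ (∫⁻ y, ‖v x - v y‖ₑ ∂P) ^ 2 :=
        pow_le_pow_left' (enorm_integral_le_lintegral_enorm _) 2
    _ ≤ ∫⁻ y, ‖v x - v y‖ₑ ^ 2 ∂P :=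
        sq_lintegral_le (continuous_const.sub hv).measurable.enorm.aemeasurable
    _ = (volume (Metric.ball (0 : E d) h))⁻¹ * ∫⁻ y in B, ‖v x - v y‖ₑ ^ 2 := by
        rw [hPdef, lintegral_smul_measure, hBv, smul_eq_mul]
    _ ≤ _ := by
        refine mul_le_mul_right ?_ _
        calc ∫⁻ y in B, ‖v x - v y‖ₑ ^ 2
            ≤ ∫⁻ y in (fun y => y - x) ⁻¹' Metric.ball 0 (2 * h), ‖v x - v y‖ₑ ^ 2 := by
              apply lintegral_mono_set
              intro y hy
              rw [mem_preimage, mem_ball_zero_iff, ← dist_eq_norm]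
              rw [hB, Metric.mem_ball] at hx hy
              linarith [dist_triangle_right y x c]
          _ = ∫⁻ y in (fun y => y - x) ⁻¹' Metric.ball 0 (2 * h),
                ‖v (x + (y - x)) - v x‖ₑ ^ 2 := by
              congr 1; ext y
              rw [add_sub_cancel, ← enorm_neg, neg_sub]
          _ = _ := (measurePreserving_sub_right volume x).setLIntegral_comp_preimage
                (f := fun z => ‖v (x + z) - v x‖ₑ ^ 2) measurableSet_ball (by
                  exact (((hv.comp (by fun_prop)).sub continuous_const).measurable).enorm.pow_const
                    2)

/-- Averaging a translation estimate over a ball. -/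
lemma lintegral_average_translate_le {v : E d → ℝ} (hv : ContDiff ℝ 1 v) {h : ℝ} (hh : 0 < h) :
    ∫⁻ x, (volume (Metric.ball (0 : E d) h))⁻¹ *
        ∫⁻ z in Metric.ball (0 : E d) (2 * h), ‖v (x + z) - v x‖ₑ ^ 2 ≤
      ENNReal.ofReal (2 ^ d * (2 * h) ^ 2) * ∫⁻ x, ‖gradient v x‖ₑ ^ 2 := by
  have hB0 : volume (Metric.ball (0 : E d) h) ≠ 0 := (Metric.measure_ball_pos volume _ hh).ne'
  have hBt : volume (Metric.ball (0 : E d) h) ≠ ⊤ := measure_ball_lt_top.ne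
  have hc := hv.continuous
  have hm : Measurable fun y : E d × E d => ‖v (y.1 + y.2) - v y.1‖ₑ ^ 2 :=
    (((hc.comp (by fun_prop)).sub (hc.comp continuous_fst)).measurable).enorm.pow_const 2
  rw [lintegral_const_mul' _ _ (ENNReal.inv_ne_top.2 hB0),
    lintegral_lintegral_swap hm.aemeasurable]
  have h1 : ∫⁻ z in Metric.ball (0 : E d) (2 * h), ∫⁻ x, ‖v (x + z) - v x‖ₑ ^ 2 ≤
      ∫⁻ _ in Metric.ball (0 : E d) (2 * h),
        ENNReal.ofReal ((2 * h) ^ 2) * ∫⁻ x, ‖gradient v x‖ₑ ^ 2 := by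
    refine setLIntegral_mono' measurableSet_ball fun z hz => ?_
    refine (lintegral_translate_sub_sq_le hv z).trans (mul_le_mul_left ?_ _)
    rw [mem_ball_zero_iff] at hz
    rw [← ofReal_norm, ← ENNReal.ofReal_pow (norm_nonneg _)]
    exact ENNReal.ofReal_le_ofReal (pow_le_pow_left₀ (norm_nonneg _) hz.le 2)
  refine (mul_le_mul_right h1 _).trans (le_of_eq ?_)
  rw [setLIntegral_const, Measure.addHaar_ball_mul_of_pos volume (0 : E d) two_pos h,
    finrank_euclideanSpace, Fintype.card_fin, ENNReal.ofReal_mul (by positivity)]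
  -- The factor `2 ^ d` is the volume ratio of the balls of radii `2h` and `h`.
  have h2 : (volume (Metric.ball (0 : E d) h))⁻¹ *
      (ENNReal.ofReal (2 ^ d) * volume (Metric.ball (0 : E d) h)) = ENNReal.ofReal (2 ^ d) := by
    rw [mul_left_comm, ENNReal.inv_mul_cancel hB0 hBt, mul_one]
  rw [mul_left_comm, h2]
  ring

/-! ### Compactness through finite-rank approximation -/

lemma norm_sq_le_of_enorm_sq_le {F G : Type*} [NormedAddCommGroup F] [NormedAddCommGroup G]
    {a : F} {b : G} {c : ℝ} (hc : 0 ≤ c) (h : ‖a‖ₑ ^ 2 ≤ ENNReal.ofReal c * ‖b‖ₑ ^ 2) :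
    ‖a‖ ^ 2 ≤ c * ‖b‖ ^ 2 := by
  have h1 := ENNReal.toReal_mono (by finiteness) h
  simpa [ENNReal.toReal_mul, ENNReal.toReal_ofReal hc] using h1

lemma enorm_Lp_two_sq {X F : Type*} [MeasurableSpace X] {μ : Measure X} [NormedAddCommGroup F]
    (f : Lp F 2 μ) : ‖f‖ₑ ^ 2 = ∫⁻ x, ‖f x‖ₑ ^ 2 ∂μ := by
  rw [Lp.enorm_def, eLpNorm_eq_lintegral_rpow_enorm_toReal two_ne_zero ENNReal.ofNat_ne_top,
    ← ENNReal.rpow_natCast, ← ENNReal.rpow_mul]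
  simp

lemma isCompactOperator_sum_rankOne {H : Type*} [NormedAddCommGroup H] [InnerProductSpace ℝ H]
    {N : ℕ} (k e : Fin N → H) :
    IsCompactOperator (∑ j, (innerSL ℝ (k j)).smulRight (e j) : H →L[ℝ] H) := by
  have : ∀ F : Finset (Fin N),
      IsCompactOperator (∑ j ∈ F, (innerSL ℝ (k j)).smulRight (e j) : H →L[ℝ] H) := by
    intro F
    refine Submodule.sum_mem (compactOperator (RingHom.id ℝ) H H) fun j _ => ?_
    exact (isCompactOperator_of_locallyCompactSpace_dom (innerSL ℝ (k j)) :
      IsCompactOperator (innerSL ℝ (k j))).clm_comp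
      (ContinuousLinearMap.toSpanSingleton ℝ (e j))
  exact this _

lemma isCompactOperator_of_norm_sub_le {V H : Type*} [NormedAddCommGroup V] [NormedSpace ℝ V]
    [NormedAddCommGroup H] [NormedSpace ℝ H] [CompleteSpace H] {S : V →L[ℝ] H}
    {A : ℕ → V →L[ℝ] H} (hA : ∀ n, IsCompactOperator (A n)) {c : ℕ → ℝ} (hc0 : ∀ n, 0 ≤ c n)
    (hc : Tendsto c atTop (𝓝 0)) (h : ∀ n z, ‖S z - A n z‖ ≤ c n * ‖z‖) :
    IsCompactOperator S := by
  refine isCompactOperator_of_tendsto (l := atTop) (F := A) ?_ (Eventually.of_forall hA)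
  rw [tendsto_iff_norm_sub_tendsto_zero]
  refine squeeze_zero (fun _ => norm_nonneg _) (fun n => ?_) hc
  refine ContinuousLinearMap.opNorm_le_bound _ (hc0 n) fun z => ?_
  rw [sub_apply, norm_sub_rev]
  exact h n z

lemma IsTestFunction.setIntegral_restrict {v : E d → ℝ} (hv : IsTestFunction Ω v)
    (hΩm : MeasurableSet Ω) {B : Set (E d)} (hB : MeasurableSet B) :
    ∫ y in B, v y ∂(volume.restrict Ω) = ∫ y in B, v y := by
  rw [Measure.restrict_restrict hB, inter_comm, ← Measure.restrict_restrict hΩm]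
  refine setIntegral_eq_integral_of_forall_compl_eq_zero fun x hx => ?_
  by_contra h0
  exact hx (hv.tsupport_subset (subset_tsupport _ h0))

lemma inner_indicatorConstLp_real {X : Type*} [MeasurableSpace X] {μ : Measure X} {B : Set X}
    (hB : MeasurableSet B) (hμ : μ B ≠ ⊤) (c : ℝ) (φ : Lp ℝ 2 μ) :
    ⟪indicatorConstLp 2 hB hμ c, φ⟫_ℝ = c * ∫ x in B, φ x ∂μ := by
  rw [L2.inner_indicatorConstLp_eq_setIntegral_inner ℝ φ hB, ← integral_const_mul]
  congr 1; ext x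
  rw [real_inner_comm]; rfl

lemma coeFn_sub_sum_smul_indicatorConstLp {X : Type*} [MeasurableSpace X] {μ : Measure X}
    [IsFiniteMeasure μ] {N : ℕ} {D : Fin N → Set X} (hD : ∀ j, MeasurableSet (D j))
    (a : Fin N → ℝ) (φ : Lp ℝ 2 μ) :
    (φ - ∑ j, a j • indicatorConstLp 2 (hD j) (measure_ne_top μ _) (1 : ℝ) : Lp ℝ 2 μ) =ᵐ[μ]
      fun x => φ x - ∑ j, a j * (D j).indicator (fun _ => (1 : ℝ)) x := by
  have h1 : ∀ᵐ x ∂μ, ∀ j, (a j • indicatorConstLp 2 (hD j) (measure_ne_top μ _) (1 : ℝ)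
      : Lp ℝ 2 μ) x = a j * (D j).indicator (fun _ => (1 : ℝ)) x := by
    rw [ae_all_iff]
    intro j
    filter_upwards [Lp.coeFn_smul (a j) (indicatorConstLp 2 (hD j) (measure_ne_top μ _) (1 : ℝ)),
      indicatorConstLp_coeFn (p := 2) (hs := hD j) (hμs := measure_ne_top μ _)
        (c := (1 : ℝ))] with x h2 h3
    rw [h2, Pi.smul_apply, h3, smul_eq_mul]
  filter_upwards [Lp.coeFn_sub φ (∑ j, a j • indicatorConstLp 2 (hD j) (measure_ne_top μ _) (1 : ℝ)),
    Lp.coeFn_fun_finsetSum Finset.univ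
      fun j => a j • indicatorConstLp 2 (hD j) (measure_ne_top μ _) (1 : ℝ), h1] with x h2 h3 h4
  rw [h2, Pi.sub_apply, h3]
  congr 1
  exact Finset.sum_congr rfl fun j _ => h4 j

/-- A bounded set is covered by finitely many disjoint measurable subsets of balls of given radius. -/
lemma exists_partition_subset_ball (hΩ : Bornology.IsBounded Ω) {h : ℝ} (hh : 0 < h) :
    ∃ (N : ℕ) (c : Fin N → E d) (D : Fin N → Set (E d)), (∀ j, MeasurableSet (D j)) ∧
      (∀ j, D j ⊆ Metric.ball (c j) h) ∧ Pairwise (Function.onFun Disjoint D) ∧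
      ∀ x ∈ Ω, ∃ j, x ∈ D j := by
  obtain ⟨s, hsf, hcov⟩ := Metric.totallyBounded_iff.1
    (hΩ.isCompact_closure.totallyBounded.subset subset_closure) h hh
  set N := hsf.toFinset.card
  set c : Fin N → E d := fun j => (hsf.toFinset.equivFin.symm j).1 with hc
  set D : Fin N → Set (E d) := disjointed fun j => Metric.ball (c j) h with hD
  have hDm : ∀ j, MeasurableSet (D j) := fun j =>
    disjointedRec (fun _ _ ht => ht.diff measurableSet_ball) measurableSet_ball
  have hDsub : ∀ j, D j ⊆ Metric.ball (c j) h := fun j => disjointed_subset _ j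
  have hDdisj : Pairwise (Function.onFun Disjoint D) := disjoint_disjointed _
  have hDcov : ∀ x ∈ Ω, ∃ j, x ∈ D j := by
    intro x hx
    obtain ⟨y, hy, hxy⟩ := mem_iUnion₂.1 (hcov hx)
    have : x ∈ ⋃ j, Metric.ball (c j) h := mem_iUnion.2
      ⟨hsf.toFinset.equivFin ⟨y, hsf.mem_toFinset.2 hy⟩, by simpa [hc] using hxy⟩
    rw [← iUnion_disjointed] at this
    exact mem_iUnion.1 this
  exact ⟨N, c, D, hDm, hDsub, hDdisj, hDcov⟩

/-- Finite rank approximation of the identity of `L²(Ω)` by local averages. -/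
lemma exists_compact_approx (hΩm : MeasurableSet Ω) (hΩ : Bornology.IsBounded Ω)
    [IsFiniteMeasure ((volume : Measure (E d)).restrict Ω)] {h : ℝ} (hh : 0 < h) :
    ∃ B : L2 Ω →L[ℝ] L2 Ω, IsCompactOperator B ∧
      ∀ (v : E d → ℝ) (φ : L2 Ω), IsTestFunction Ω v → φ =ᵐ[volume.restrict Ω] v →
        ‖φ - B φ‖ₑ ^ 2 ≤ ENNReal.ofReal (2 ^ d * (2 * h) ^ 2) * ∫⁻ x, ‖gradient v x‖ₑ ^ 2 := by
  obtain ⟨N, c, D, hDm, hDsub, hDdisj, hDcov⟩ := exists_partition_subset_ball hΩ hh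
  -- Averages are taken over full balls, while the values are placed on the disjoint cells `D j`. A
  -- ball may leave `Ω`, but a test function vanishes there, so dividing by the full volume gives
  -- its true average.
  set k : Fin N → L2 Ω := fun j => indicatorConstLp 2 (measurableSet_ball (x := c j) (ε := h))
    (measure_ne_top _ _) ((volume (Metric.ball (c j) h)).toReal⁻¹) with hk
  set e : Fin N → L2 Ω := fun j => indicatorConstLp 2 (hDm j) (measure_ne_top _ _) (1 : ℝ) with he
  refine ⟨∑ j, (innerSL ℝ (k j)).smulRight (e j), isCompactOperator_sum_rankOne k e,
    fun v φ hv hφ => ?_⟩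
  have hvc : ContDiff ℝ 1 v := hv.contDiff.of_le (by simp)
  have havg : ∀ j, ⟪k j, φ⟫_ℝ =
      (volume (Metric.ball (c j) h)).toReal⁻¹ * ∫ y in Metric.ball (c j) h, v y := by
    intro j
    rw [hk, inner_indicatorConstLp_real, integral_congr_ae (ae_restrict_of_ae hφ),
      hv.setIntegral_restrict hΩm measurableSet_ball]
  have hcoe := coeFn_sub_sum_smul_indicatorConstLp hDm (fun j => ⟪k j, φ⟫_ℝ) φ
  have hB : (∑ j, (innerSL ℝ (k j)).smulRight (e j) : L2 Ω →L[ℝ] L2 Ω) φ =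
      ∑ j, ⟪k j, φ⟫_ℝ • e j := by
    simp
  have hpt : ∀ x ∈ Ω, ‖v x - ∑ j, ⟪k j, φ⟫_ℝ * (D j).indicator (fun _ => (1 : ℝ)) x‖ₑ ^ 2 ≤
      (volume (Metric.ball (0 : E d) h))⁻¹ *
        ∫⁻ z in Metric.ball (0 : E d) (2 * h), ‖v (x + z) - v x‖ₑ ^ 2 := by
    intro x hx
    obtain ⟨i, hi⟩ := hDcov x hx
    have h1 : ∑ j, ⟪k j, φ⟫_ℝ * (D j).indicator (fun _ => (1 : ℝ)) x = ⟪k i, φ⟫_ℝ := by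
      rw [Finset.sum_eq_single_of_mem i (Finset.mem_univ i) fun j _ hji => by
        rw [indicator_of_notMem (fun hj => (hDdisj hji).le_bot ⟨hj, hi⟩), mul_zero],
        indicator_of_mem hi, mul_one]
    rw [h1, havg]
    exact enorm_sub_average_sq_le hvc.continuous hh (hDsub i hi)
  rw [hB, enorm_Lp_two_sq]
  have hae : ∀ᵐ x ∂(volume.restrict Ω), ‖(φ - ∑ j, ⟪k j, φ⟫_ℝ • e j : L2 Ω) x‖ₑ ^ 2 ≤
      (volume (Metric.ball (0 : E d) h))⁻¹ *
        ∫⁻ z in Metric.ball (0 : E d) (2 * h), ‖v (x + z) - v x‖ₑ ^ 2 := by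
    filter_upwards [hcoe, hφ, ae_restrict_mem hΩm] with x h1 h2 h3
    rw [h1, h2]
    exact hpt x h3
  calc _ ≤ ∫⁻ x in Ω, (volume (Metric.ball (0 : E d) h))⁻¹ *
        ∫⁻ z in Metric.ball (0 : E d) (2 * h), ‖v (x + z) - v x‖ₑ ^ 2 :=
        lintegral_mono_ae hae
    _ ≤ _ := (setLIntegral_le_lintegral _ _).trans (lintegral_average_translate_le hvc hh)

/-! ### The space `H_0^1(Ω)` -/

/-- `L²(Ω)` vector fields. -/
abbrev L2Field (Ω : Set (E d)) := Lp (E d) 2 ((volume : Measure (E d)).restrict Ω)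

lemma IsTestFunction.hasGradientAt {v : E d → ℝ} (hv : IsTestFunction Ω v) (x : E d) :
    HasGradientAt v (gradient v x) x :=
  ((hv.contDiff.differentiable (by simp)) x).hasGradientAt

lemma IsTestFunction.zero : IsTestFunction Ω fun _ => 0 where
  contDiff := contDiff_const
  hasCompactSupport := HasCompactSupport.zero
  tsupport_subset := by simp [tsupport]

lemma IsTestFunction.add {v w : E d → ℝ} (hv : IsTestFunction Ω v) (hw : IsTestFunction Ω w) :
    IsTestFunction Ω fun x => v x + w x where
  contDiff := hv.contDiff.add hw.contDiff
  hasCompactSupport := hv.hasCompactSupport.add hw.hasCompactSupport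
  tsupport_subset := (tsupport_add v w).trans (union_subset hv.tsupport_subset hw.tsupport_subset)

lemma IsTestFunction.const_mul {v : E d → ℝ} (hv : IsTestFunction Ω v) (a : ℝ) :
    IsTestFunction Ω fun x => a * v x :=
  hv.comp (ζ := fun y => a * y) (by fun_prop) (by simp)

lemma IsTestFunction.memLp_gradient {v : E d → ℝ} (hv : IsTestFunction Ω v) (p : ℝ≥0∞)
    (μ : Measure (E d)) [IsFiniteMeasureOnCompacts μ] : MemLp (gradient v) p μ := by
  refine (continuous_gradient (hv.contDiff.of_le (by simp))).memLp_of_hasCompactSupport ?_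
  exact (hv.hasCompactSupport.fderiv (𝕜 := ℝ)).comp_left
    (g := (InnerProductSpace.toDual ℝ (E d)).symm) (map_zero _)

/-- The graph of the gradient on test functions. -/
def testGraph (Ω : Set (E d)) : Submodule ℝ (WithLp 2 (L2 Ω × L2Field Ω)) where
  carrier := {z | ∃ v, IsTestFunction Ω v ∧ z.fst =ᵐ[volume.restrict Ω] v ∧
    z.snd =ᵐ[volume.restrict Ω] gradient v}
  zero_mem' := by
    refine ⟨_, IsTestFunction.zero, Lp.coeFn_zero _ _ _, ?_⟩
    filter_upwards [Lp.coeFn_zero (E d) 2 ((volume : Measure (E d)).restrict Ω)] with x hx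
    rw [WithLp.zero_snd, hx, gradient_fun_const]; rfl
  add_mem' := by
    rintro z y ⟨v, hv, h1, h2⟩ ⟨w, hw, h3, h4⟩
    refine ⟨_, hv.add hw, ?_, ?_⟩
    · filter_upwards [Lp.coeFn_add z.fst y.fst, h1, h3] with x h5 h6 h7
      rw [WithLp.add_fst, h5, Pi.add_apply, h6, h7]
    · filter_upwards [Lp.coeFn_add z.snd y.snd, h2, h4] with x h5 h6 h7
      rw [WithLp.add_snd, h5, Pi.add_apply, h6, h7]
      refine (HasGradientAt.gradient ?_).symm
      rw [hasGradientAt_iff_hasFDerivAt, map_add]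
      exact (hv.hasGradientAt x).hasFDerivAt.add (hw.hasGradientAt x).hasFDerivAt
  smul_mem' := by
    rintro a z ⟨v, hv, h1, h2⟩
    refine ⟨_, hv.const_mul a, ?_, ?_⟩
    · filter_upwards [Lp.coeFn_smul a z.fst, h1] with x h5 h6
      rw [WithLp.smul_fst, h5, Pi.smul_apply, h6, smul_eq_mul]
    · filter_upwards [Lp.coeFn_smul a z.snd, h2] with x h5 h6
      rw [WithLp.smul_snd, h5, Pi.smul_apply, h6]
      refine (HasGradientAt.gradient ?_).symm
      rw [hasGradientAt_iff_hasFDerivAt, map_smul]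
      exact (hv.hasGradientAt x).hasFDerivAt.const_mul a

/-- `H_0^1(Ω)` as a closed subspace of pairs of a function and its weak gradient. -/
def H01 (Ω : Set (E d)) : Type := (testGraph Ω).topologicalClosure

instance : NormedAddCommGroup (H01 Ω) :=
  inferInstanceAs (NormedAddCommGroup (testGraph Ω).topologicalClosure)

instance : InnerProductSpace ℝ (H01 Ω) :=
  inferInstanceAs (InnerProductSpace ℝ (testGraph Ω).topologicalClosure)

instance : CompleteSpace (H01 Ω) :=
  inferInstanceAs (CompleteSpace (testGraph Ω).topologicalClosure)

/-- The embedding of `H_0^1(Ω)` into `L²(Ω)`. -/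
def h01Embed (Ω : Set (E d)) : H01 Ω →L[ℝ] L2 Ω :=
  (WithLp.fstL 2 ℝ (L2 Ω) (L2Field Ω)).comp (testGraph Ω).topologicalClosure.subtypeL

/-- The weak gradient on `H_0^1(Ω)`. -/
def h01Grad (Ω : Set (E d)) : H01 Ω →L[ℝ] L2Field Ω :=
  (WithLp.sndL 2 ℝ (L2 Ω) (L2Field Ω)).comp (testGraph Ω).topologicalClosure.subtypeL

lemma h01_inner (z y : H01 Ω) :
    ⟪z, y⟫_ℝ = ⟪h01Embed Ω z, h01Embed Ω y⟫_ℝ + ⟪h01Grad Ω z, h01Grad Ω y⟫_ℝ :=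
  WithLp.prod_inner_apply _ _

lemma h01_norm_sq (z : H01 Ω) : ‖z‖ ^ 2 = ‖h01Embed Ω z‖ ^ 2 + ‖h01Grad Ω z‖ ^ 2 := by
  rw [← real_inner_self_eq_norm_sq, h01_inner, real_inner_self_eq_norm_sq,
    real_inner_self_eq_norm_sq]

lemma norm_h01Embed_le (z : H01 Ω) : ‖h01Embed Ω z‖ ≤ ‖z‖ := by
  rw [← sq_le_sq₀ (norm_nonneg _) (norm_nonneg _), h01_norm_sq]
  exact le_add_of_nonneg_right (sq_nonneg _)

lemma norm_h01Grad_le (z : H01 Ω) : ‖h01Grad Ω z‖ ≤ ‖z‖ := by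
  rw [← sq_le_sq₀ (norm_nonneg _) (norm_nonneg _), h01_norm_sq]
  exact le_add_of_nonneg_left (sq_nonneg _)

lemma exists_h01_iff (φ : L2 Ω) (G : L2Field Ω) :
    (∃ z : H01 Ω, h01Embed Ω z = φ ∧ h01Grad Ω z = G) ↔
      WithLp.toLp 2 (φ, G) ∈ closure (testGraph Ω : Set (WithLp 2 (L2 Ω × L2Field Ω))) := by
  constructor
  · rintro ⟨z, rfl, rfl⟩
    exact z.2
  · intro h
    exact ⟨⟨_, h⟩, rfl, rfl⟩

/-- A test function as an element of `H_0^1(Ω)`. -/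
def testElem {v : E d → ℝ} (hv : IsTestFunction Ω v) : H01 Ω :=
  ⟨WithLp.toLp 2 ((hv.memLp 2 _).toLp v, (hv.memLp_gradient 2 _).toLp (gradient v)),
    (testGraph Ω).le_topologicalClosure
      ⟨v, hv, (hv.memLp 2 _).coeFn_toLp, (hv.memLp_gradient 2 _).coeFn_toLp⟩⟩

lemma coeFn_h01Embed_testElem {v : E d → ℝ} (hv : IsTestFunction Ω v) :
    h01Embed Ω (testElem hv) =ᵐ[volume.restrict Ω] v := (hv.memLp 2 _).coeFn_toLp

lemma coeFn_h01Grad_testElem {v : E d → ℝ} (hv : IsTestFunction Ω v) :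
    h01Grad Ω (testElem hv) =ᵐ[volume.restrict Ω] gradient v :=
  (hv.memLp_gradient 2 _).coeFn_toLp

lemma denseRange_testElem (z : H01 Ω) {ε : ℝ} (hε : 0 < ε) :
    ∃ (v : E d → ℝ) (hv : IsTestFunction Ω v), ‖z - testElem hv‖ < ε := by
  obtain ⟨y, ⟨v, hv, h1, h2⟩, hzy⟩ := Metric.mem_closure_iff.1 z.2 ε hε
  refine ⟨v, hv, ?_⟩
  have : (testElem hv).1 = y := by
    apply WithLp.ofLp_injective
    apply Prod.ext
    · exact Lp.ext ((coeFn_h01Embed_testElem hv).trans h1.symm)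
    · exact Lp.ext ((coeFn_h01Grad_testElem hv).trans h2.symm)
  rw [dist_eq_norm, ← this] at hzy
  exact hzy

/-- A closed condition on `H_0^1(Ω)` may be checked on test functions. -/
lemma h01_induction {P : H01 Ω → Prop} (hP : IsClosed {z | P z})
    (h : ∀ v (hv : IsTestFunction Ω v), P (testElem hv)) (z : H01 Ω) : P z := by
  have hz : z ∈ closure {z | P z} := by
    rw [Metric.mem_closure_iff]
    intro ε hε
    obtain ⟨v, hv, hz⟩ := denseRange_testElem z hε
    exact ⟨testElem hv, h v hv, by rwa [dist_eq_norm]⟩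
  rwa [hP.closure_eq] at hz

lemma gradient_eq_zero_of_notMem {v : E d → ℝ} (hv : IsTestFunction Ω v) {x : E d} (hx : x ∉ Ω) :
    gradient v x = 0 := by
  have : x ∉ tsupport v := fun h => hx (hv.tsupport_subset h)
  rw [notMem_tsupport_iff_eventuallyEq] at this
  rw [this.gradient_eq]
  exact gradient_const x 0

/-- The gradient of a test function vanishes off `Ω`, so the whole-space translation estimate is
controlled by the `H_0^1(Ω)` norm. -/
lemma lintegral_gradient_sq {v : E d → ℝ} (hv : IsTestFunction Ω v) (hΩ : MeasurableSet Ω) :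
    ∫⁻ x, ‖gradient v x‖ₑ ^ 2 = ‖h01Grad Ω (testElem hv)‖ₑ ^ 2 := by
  rw [enorm_Lp_two_sq, lintegral_congr_ae ((coeFn_h01Grad_testElem hv).mono fun x hx =>
    congrArg (fun y => ‖y‖ₑ ^ 2) hx)]
  rw [← lintegral_indicator hΩ]
  refine lintegral_congr fun x => ?_
  by_cases hx : x ∈ Ω
  · rw [indicator_of_mem hx]
  · rw [indicator_of_notMem hx, gradient_eq_zero_of_notMem hv hx]; simp

lemma norm_testElem_approx_le {B : L2 Ω →L[ℝ] L2 Ω} {c : ℝ} (hc : 0 ≤ c) (hΩm : MeasurableSet Ω)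
    (hB : ∀ (v : E d → ℝ) (φ : L2 Ω), IsTestFunction Ω v → φ =ᵐ[volume.restrict Ω] v →
      ‖φ - B φ‖ₑ ^ 2 ≤ ENNReal.ofReal (c ^ 2) * ∫⁻ x, ‖gradient v x‖ₑ ^ 2)
    {v : E d → ℝ} (hv : IsTestFunction Ω v) :
    ‖h01Embed Ω (testElem hv) - B (h01Embed Ω (testElem hv))‖ ≤ c * ‖testElem hv‖ := by
  have h1 := hB v _ hv (coeFn_h01Embed_testElem hv)
  rw [lintegral_gradient_sq hv hΩm] at h1
  replace h1 := norm_sq_le_of_enorm_sq_le (sq_nonneg c) h1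
  rw [← sq_le_sq₀ (norm_nonneg _) (mul_nonneg hc (norm_nonneg _)), mul_pow]
  refine h1.trans (mul_le_mul_of_nonneg_left ?_ (sq_nonneg c))
  exact pow_le_pow_left₀ (norm_nonneg _) (norm_h01Grad_le _) 2

lemma norm_h01_approx_le {B : L2 Ω →L[ℝ] L2 Ω} {c : ℝ} (hc : 0 ≤ c) (hΩm : MeasurableSet Ω)
    (hB : ∀ (v : E d → ℝ) (φ : L2 Ω), IsTestFunction Ω v → φ =ᵐ[volume.restrict Ω] v →
      ‖φ - B φ‖ₑ ^ 2 ≤ ENNReal.ofReal (c ^ 2) * ∫⁻ x, ‖gradient v x‖ₑ ^ 2) (z : H01 Ω) :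
    ‖h01Embed Ω z - B (h01Embed Ω z)‖ ≤ c * ‖z‖ := by
  have hc1 : Continuous fun z : H01 Ω => ‖h01Embed Ω z - B (h01Embed Ω z)‖ :=
    ((h01Embed Ω).continuous.sub (B.continuous.comp (h01Embed Ω).continuous)).norm
  have hc2 : Continuous fun z : H01 Ω => c * ‖z‖ := continuous_const.mul continuous_norm
  exact h01_induction (P := fun z => ‖h01Embed Ω z - B (h01Embed Ω z)‖ ≤ c * ‖z‖)
    (isClosed_le hc1 hc2) (fun v hv => norm_testElem_approx_le hc hΩm hB hv) z

/-- Rellich's theorem: `H_0^1(Ω)` embeds compactly into `L²(Ω)` for bounded `Ω`. -/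
theorem isCompactOperator_h01Embed (hΩm : MeasurableSet Ω) (hΩ : Bornology.IsBounded Ω)
    [IsFiniteMeasure ((volume : Measure (E d)).restrict Ω)] :
    IsCompactOperator (h01Embed Ω) := by
  choose B hB hBest using fun n : ℕ =>
    exists_compact_approx hΩm hΩ (h := 1 / ((n : ℝ) + 1)) (by positivity)
  have hest : ∀ n (z : H01 Ω), ‖h01Embed Ω z - B n (h01Embed Ω z)‖ ≤
      √(2 ^ d) * 2 * (1 / ((n : ℝ) + 1)) * ‖z‖ := by
    intro n
    have h5 : (√((2 : ℝ) ^ d) * 2 * (1 / ((n : ℝ) + 1))) ^ 2 =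
        2 ^ d * (2 * (1 / ((n : ℝ) + 1))) ^ 2 := by
      rw [mul_assoc, mul_pow, Real.sq_sqrt (by positivity)]
    refine norm_h01_approx_le (by positivity) hΩm ?_
    rw [h5]
    exact hBest n
  refine isCompactOperator_of_norm_sub_le (A := fun n => (B n).comp (h01Embed Ω))
    (fun n => (hB n).comp_clm (h01Embed Ω)) (fun n => by positivity) ?_ hest
  simpa using tendsto_one_div_add_atTop_nhds_zero_nat.const_mul (√((2 : ℝ) ^ d) * 2)

/-! ### The Dirichlet eigenspaces -/

lemma h01_inner_testElem (z : H01 Ω) {v : E d → ℝ} (hv : IsTestFunction Ω v) :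
    ⟪z, testElem hv⟫_ℝ = ⟪h01Embed Ω z, h01Embed Ω (testElem hv)⟫_ℝ +
      ∫ x in Ω, ⟪(h01Grad Ω z : L2Field Ω) x, gradient v x⟫_ℝ := by
  rw [h01_inner, L2.inner_def (𝕜 := ℝ) (h01Grad Ω z)]
  congr 1
  refine integral_congr_ae ?_
  filter_upwards [coeFn_h01Grad_testElem hv] with x hx
  rw [hx]

lemma inner_h01Embed_testElem (φ : L2 Ω) {v : E d → ℝ} (hv : IsTestFunction Ω v) :
    ⟪φ, h01Embed Ω (testElem hv)⟫_ℝ = ∫ x in Ω, φ x * v x := by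
  rw [L2.inner_def (𝕜 := ℝ)]
  refine integral_congr_ae ?_
  filter_upwards [coeFn_h01Embed_testElem hv] with x hx
  rw [hx]
  simp [mul_comm]

lemma norm_toLp_prod_le {F G : Type*} [NormedAddCommGroup F] [NormedAddCommGroup G] (a : F)
    (b : G) : ‖WithLp.toLp 2 (a, b)‖ ≤ ‖a‖ + ‖b‖ := by
  rw [← sq_le_sq₀ (norm_nonneg _) (by positivity), WithLp.prod_norm_sq_eq_of_L2]
  change ‖a‖ ^ 2 + ‖b‖ ^ 2 ≤ _
  nlinarith [norm_nonneg a, norm_nonneg b]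

lemma Lp_enorm_sub_eq {X F : Type*} [MeasurableSpace X] {μ : Measure X} [NormedAddCommGroup F]
    {φ ψ : Lp F 2 μ} {v : X → F} (h : ψ =ᵐ[μ] v) :
    eLpNorm (fun x => φ x - v x) 2 μ = ‖φ - ψ‖ₑ := by
  rw [Lp.enorm_def]
  refine eLpNorm_congr_ae ?_
  filter_upwards [Lp.coeFn_sub φ ψ, h] with x h1 h2
  rw [h1, Pi.sub_apply, h2]

lemma memH01_h01 (z : H01 Ω) : MemH01 Ω (h01Embed Ω z) (h01Grad Ω z) := by
  refine ⟨Lp.memLp _, Lp.memLp _, fun ε hε => ?_⟩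
  obtain ⟨δ, hδ, hδε⟩ : ∃ δ : ℝ, 0 < δ ∧ ENNReal.ofReal δ ≤ ε := by
    obtain ⟨δ, hδ, hlt⟩ := ENNReal.lt_iff_exists_nnreal_btwn.1 hε
    exact ⟨δ, by exact_mod_cast hδ, by simpa using hlt.le⟩
  obtain ⟨v, hv, hd⟩ := denseRange_testElem z hδ
  refine ⟨v, hv, ?_, ?_⟩
  · rw [Lp_enorm_sub_eq (coeFn_h01Embed_testElem hv), ← ofReal_norm, ← map_sub]
    refine lt_of_lt_of_le ?_ hδε
    rw [ENNReal.ofReal_lt_ofReal_iff hδ]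
    exact (norm_h01Embed_le _).trans_lt hd
  · rw [Lp_enorm_sub_eq (coeFn_h01Grad_testElem hv), ← ofReal_norm, ← map_sub]
    refine lt_of_lt_of_le ?_ hδε
    rw [ENNReal.ofReal_lt_ofReal_iff hδ]
    exact (norm_h01Grad_le _).trans_lt hd

lemma MemH01.exists_h01 {φ : L2 Ω} {G : E d → E d} (hG : MemH01 Ω φ G) :
    ∃ z : H01 Ω, h01Embed Ω z = φ ∧ h01Grad Ω z =ᵐ[volume.restrict Ω] G := by
  obtain ⟨-, hG2, h⟩ := hG
  suffices hz : ∃ z : H01 Ω, h01Embed Ω z = φ ∧ h01Grad Ω z = hG2.toLp G by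
    obtain ⟨z, h1, h2⟩ := hz
    exact ⟨z, h1, h2 ▸ hG2.coeFn_toLp⟩
  rw [exists_h01_iff]
  refine Metric.mem_closure_iff.2 fun ε hε => ?_
  obtain ⟨v, hv, h1, h2⟩ := h (ENNReal.ofReal (ε / 2)) (by simpa using hε)
  refine ⟨WithLp.toLp 2 (h01Embed Ω (testElem hv), h01Grad Ω (testElem hv)),
    ⟨v, hv, coeFn_h01Embed_testElem hv, coeFn_h01Grad_testElem hv⟩, ?_⟩
  rw [Lp_enorm_sub_eq (coeFn_h01Embed_testElem hv), ← ofReal_norm,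
    ENNReal.ofReal_lt_ofReal_iff (by positivity)] at h1
  have h3 : eLpNorm (fun x => hG2.toLp G x - gradient v x) 2 (volume.restrict Ω) <
      ENNReal.ofReal (ε / 2) :=
    (eLpNorm_congr_ae (hG2.coeFn_toLp.sub (ae_eq_refl (gradient v)))).trans_lt h2
  rw [Lp_enorm_sub_eq (coeFn_h01Grad_testElem hv), ← ofReal_norm,
    ENNReal.ofReal_lt_ofReal_iff (by positivity)] at h3
  rw [dist_eq_norm, ← WithLp.toLp_sub]
  refine (norm_toLp_prod_le _ _).trans_lt ?_
  rw [← add_halves ε]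
  exact add_lt_add h1 h3

lemma eq_smul_adjoint_iff {H V : Type*} [NormedAddCommGroup H] [InnerProductSpace ℝ H]
    [CompleteSpace H] [NormedAddCommGroup V] [InnerProductSpace ℝ V] [CompleteSpace V] (ι : V →L[ℝ] H) (z : V) (φ : H) (c : ℝ) :
    z = c • ι.adjoint φ ↔ ∀ y, ⟪z, y⟫_ℝ = c * ⟪φ, ι y⟫_ℝ := by
  have h : ∀ y, ⟪c • ι.adjoint φ, y⟫_ℝ = c * ⟪φ, ι y⟫_ℝ := fun y => by
    rw [real_inner_smul_left, ContinuousLinearMap.adjoint_inner_left]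
  refine ⟨fun hz y => by rw [hz, h], fun hz => ext_inner_right ℝ fun y => by rw [hz, h]⟩

lemma smul_map_eq_of_eq_smul {H V : Type*} [NormedAddCommGroup H] [NormedSpace ℝ H]
    [NormedAddCommGroup V] [NormedSpace ℝ V] (ι : V →L[ℝ] H) {z y : V} {c : ℝ} (h : z = c • y) :
    c • ι y = ι z := by
  rw [h, map_smul]

lemma isClosed_inner_eq {H V : Type*} [NormedAddCommGroup H] [InnerProductSpace ℝ H]
    [NormedAddCommGroup V] [InnerProductSpace ℝ V] (ι : V →L[ℝ] H) (z : V) (φ : H) (c : ℝ) :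
    IsClosed {y | ⟪z, y⟫_ℝ = c * ⟪φ, ι y⟫_ℝ} :=
  isClosed_eq (continuous_const.inner continuous_id)
    (continuous_const.mul (continuous_const.inner ι.continuous))

/-- The fixed points of a bounded operator already form a closed subspace, so neither the span nor
the closure adds anything. -/
lemma mem_topologicalClosure_span_iff {H : Type*} [NormedAddCommGroup H] [InnerProductSpace ℝ H]
    (B : H →L[ℝ] H) {S : Set H} (hS : ∀ φ, φ ∈ S ↔ B φ = φ)
    (φ : H) : φ ∈ (Submodule.span ℝ S).topologicalClosure ↔ B φ = φ := by
  set K : Submodule ℝ H := LinearMap.ker (B - ContinuousLinearMap.id ℝ H).toLinearMap with hK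
  have hker : ∀ φ, φ ∈ K ↔ B φ = φ := fun φ => by
    rw [← sub_eq_zero (b := φ)]; rfl
  have hspan : Submodule.span ℝ S = K :=
    le_antisymm (Submodule.span_le.2 fun φ hφ => (hker φ).2 ((hS φ).1 hφ))
      fun φ hφ => Submodule.subset_span ((hS φ).2 ((hker φ).1 hφ))
  have hcl : IsClosed (K : Set H) :=
    isClosed_singleton.preimage (B - ContinuousLinearMap.id ℝ H).continuous
  rw [hspan, hcl.submodule_topologicalClosure_eq, hker]

lemma h01_inner_eq_iff (z : H01 Ω) (c : ℝ) (φ : L2 Ω) :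
    z = c • (h01Embed Ω).adjoint φ ↔
      ∀ v (hv : IsTestFunction Ω v), ⟪z, testElem hv⟫_ℝ = c * ∫ x in Ω, φ x * v x := by
  rw [eq_smul_adjoint_iff]
  constructor
  · intro h v hv
    rw [h, inner_h01Embed_testElem]
  · intro h y
    refine h01_induction (isClosed_inner_eq (h01Embed Ω) z φ c) (fun v hv => ?_) y
    rw [h v hv, inner_h01Embed_testElem]

/-- Adding the `L²` pairing to both sides of the weak equation `-Δz = l z` makes the left side the
inner product of `H_0^1(Ω)`; the right side is then represented by the adjoint of the embedding. -/
lemma eq_smul_adjoint_of_weak {l : ℝ} {z : H01 Ω} {G : E d → E d}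
    (hzG : h01Grad Ω z =ᵐ[volume.restrict Ω] G)
    (hweak : ∀ v, IsTestFunction Ω v →
      ∫ x in Ω, ⟪G x, gradient v x⟫_ℝ = l * ∫ x in Ω, h01Embed Ω z x * v x) :
    z = (1 + l) • (h01Embed Ω).adjoint (h01Embed Ω z) := by
  rw [h01_inner_eq_iff]
  intro v hv
  have h2 : ∫ x in Ω, ⟪(h01Grad Ω z : L2Field Ω) x, gradient v x⟫_ℝ =
      ∫ x in Ω, ⟪G x, gradient v x⟫_ℝ := by
    refine integral_congr_ae ?_
    filter_upwards [hzG] with x hx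
    rw [hx]
  have h3 := hweak v hv
  rw [h01_inner_testElem, inner_h01Embed_testElem, h2]
  linarith

lemma IsDirichletEigen.smul_eq {l : ℝ} {φ : L2 Ω} (h : IsDirichletEigen Ω l φ) :
    (1 + l) • h01Embed Ω ((h01Embed Ω).adjoint φ) = φ := by
  obtain ⟨G, hG, hweak⟩ := h
  obtain ⟨z, rfl, hzG⟩ := hG.exists_h01
  exact smul_map_eq_of_eq_smul (h01Embed Ω) (eq_smul_adjoint_of_weak hzG hweak)

lemma isDirichletEigen_of_smul_eq {l : ℝ} {φ : L2 Ω}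
    (h : (1 + l) • h01Embed Ω ((h01Embed Ω).adjoint φ) = φ) : IsDirichletEigen Ω l φ := by
  obtain ⟨z, hz⟩ : ∃ z, z = (1 + l) • (h01Embed Ω).adjoint φ := ⟨_, rfl⟩
  have hzφ : h01Embed Ω z = φ := by rw [hz, map_smul, h]
  rw [h01_inner_eq_iff] at hz
  refine ⟨h01Grad Ω z, ?_, fun v hv => ?_⟩
  · rw [← hzφ]
    exact memH01_h01 z
  · have h1 := hz v hv
    rw [h01_inner_testElem, hzφ, inner_h01Embed_testElem] at h1
    linarith

lemma mem_eigenspace_iff (l : ℝ) (φ : L2 Ω) :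
    φ ∈ eigenspace Ω l ↔ (1 + l) • h01Embed Ω ((h01Embed Ω).adjoint φ) = φ :=
  mem_topologicalClosure_span_iff ((1 + l) • (h01Embed Ω).comp (h01Embed Ω).adjoint)
    (S := {φ | IsDirichletEigen Ω l φ})
    (fun _ => ⟨fun h => h.smul_eq, fun h => isDirichletEigen_of_smul_eq h⟩) φ

/-- A function orthogonal to the range is orthogonal to all test functions, hence zero by the
fundamental lemma of the calculus of variations. -/
lemma denseRange_h01Embed (hΩ : IsOpen Ω) : DenseRange (h01Embed Ω) := by
  have h : (LinearMap.range (h01Embed Ω).toLinearMap)ᗮ = ⊥ := by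
    rw [eq_bot_iff]
    intro φ hφ
    rw [Submodule.mem_bot, Lp.eq_zero_iff_ae_eq_zero]
    have hloc : LocallyIntegrableOn φ Ω volume := by
      have h1 : LocallyIntegrable φ (volume.restrict Ω) :=
        (Lp.memLp φ).locallyIntegrable (by norm_num)
      exact locallyIntegrableOn_of_locallyIntegrable_restrict h1
    have h2 := hΩ.ae_eq_zero_of_integral_contDiff_smul_eq_zero hloc fun g hg hgc hgt => by
      have hv : IsTestFunction Ω g := ⟨hg, hgc, hgt⟩
      have h3 := (Submodule.mem_orthogonal' _ _).1 hφ _ (LinearMap.mem_range_self _ (testElem hv))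
      change ⟪φ, h01Embed Ω (testElem hv)⟫_ℝ = 0 at h3
      rw [inner_h01Embed_testElem] at h3
      rw [← h3, setIntegral_eq_integral_of_forall_compl_eq_zero]
      · simp_rw [smul_eq_mul, mul_comm]
      · intro x hx
        rw [image_eq_zero_of_notMem_tsupport fun h => hx (hgt h), mul_zero]
    exact (ae_restrict_iff' hΩ.measurableSet).2 h2
  have h1 := Submodule.dense_iff_topologicalClosure_eq_top.2
    (Submodule.topologicalClosure_eq_top_iff.2 h)
  exact h1

lemma isFormSpectrum_h01Embed (hΩ : IsOpen Ω) (hb : Bornology.IsBounded Ω)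
    [IsFiniteMeasure ((volume : Measure (E d)).restrict Ω)] :
    IsFormSpectrum (h01Embed Ω) (eigenspace Ω) where
  compact := isCompactOperator_h01Embed hΩ.measurableSet hb
  dense := denseRange_h01Embed hΩ
  norm_le := norm_h01Embed_le
  mem_iff := mem_eigenspace_iff

/-! ### Truncation in the spectral space -/

lemma Lp_norm_sq_add_le {X F : Type*} [MeasurableSpace X] {μ : Measure X} [NormedAddCommGroup F]
    [InnerProductSpace ℝ F] {f g h : Lp F 2 μ}
    (hae : ∀ᵐ x ∂μ, ‖f x‖ ^ 2 + ‖g x‖ ^ 2 ≤ ‖h x‖ ^ 2) : ‖f‖ ^ 2 + ‖g‖ ^ 2 ≤ ‖h‖ ^ 2 := by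
  have e : ∀ f : Lp F 2 μ, ‖f‖ ^ 2 = ∫ x, ‖f x‖ ^ 2 ∂μ := fun f => by
    rw [← real_inner_self_eq_norm_sq, L2.inner_def (𝕜 := ℝ)]
    simp_rw [real_inner_self_eq_norm_sq]
  have i : ∀ f : Lp F 2 μ, Integrable (fun x => ‖f x‖ ^ 2) μ := fun f =>
    (Lp.memLp f).integrable_norm_pow two_ne_zero
  rw [e, e, e, ← integral_add (i f) (i g)]
  exact integral_mono_ae ((i f).add (i g)) (i h) hae

section Truncation

variable {η : ℝ → ℝ}

/-- Composition with a smooth truncation in `L²(Ω)`. -/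
def IsSmoothTruncation.compL2 (hη : IsSmoothTruncation η) (w : L2 Ω) : L2 Ω :=
  hη.lipschitzWith.compLp hη.map_zero w

lemma IsSmoothTruncation.coeFn_compL2 (hη : IsSmoothTruncation η) (w : L2 Ω) :
    hη.compL2 w =ᵐ[volume.restrict Ω] fun x => η (w x) :=
  hη.lipschitzWith.coeFn_compLp _ _

lemma IsSmoothTruncation.isTestFunction_comp (hη : IsSmoothTruncation η) {v : E d → ℝ}
    (hv : IsTestFunction Ω v) : IsTestFunction Ω fun x => η (v x) :=
  hv.comp hη.contDiff hη.map_zero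

lemma IsSmoothTruncation.isTestFunction_sub (hη : IsSmoothTruncation η) {v : E d → ℝ}
    (hv : IsTestFunction Ω v) : IsTestFunction Ω fun x => v x - η (v x) :=
  hv.comp (ζ := fun y => y - η y) (contDiff_id.sub hη.contDiff) (by simp [hη.map_zero])

lemma IsTestFunction.gradient_comp {v : E d → ℝ} (hv : IsTestFunction Ω v) {ζ : ℝ → ℝ}
    {c : ℝ} {x : E d} (hζ : HasDerivAt ζ c (v x)) :
    gradient (fun y => ζ (v y)) x = c • gradient v x := by
  refine HasGradientAt.gradient ?_
  rw [hasGradientAt_iff_hasFDerivAt, map_smul]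
  exact hζ.comp_hasFDerivAt x (hv.hasGradientAt x).hasFDerivAt

/-- By the chain rule the two gradients are `c ∇v` and `(1 - c) ∇v` with `c = η'(v) ∈ [0, 1]`, and
`c² + (1 - c)² ≤ 1`. -/
lemma IsSmoothTruncation.norm_h01Grad_sq_add_le (hη : IsSmoothTruncation η) {v : E d → ℝ}
    (hv : IsTestFunction Ω v) :
    ‖h01Grad Ω (testElem (hη.isTestFunction_comp hv))‖ ^ 2 +
      ‖h01Grad Ω (testElem (hη.isTestFunction_sub hv))‖ ^ 2 ≤ ‖h01Grad Ω (testElem hv)‖ ^ 2 := by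
  refine Lp_norm_sq_add_le ?_
  filter_upwards [coeFn_h01Grad_testElem (hη.isTestFunction_comp hv),
    coeFn_h01Grad_testElem (hη.isTestFunction_sub hv), coeFn_h01Grad_testElem hv] with x h1 h2 h3
  have hd := (hη.differentiable (v x)).hasDerivAt
  rw [h1, h2, h3, hv.gradient_comp hd,
    hv.gradient_comp (ζ := fun y => y - η y) ((hasDerivAt_id _).sub hd), norm_smul, norm_smul,
    mul_pow, mul_pow, Real.norm_eq_abs, Real.norm_eq_abs, sq_abs, sq_abs, ← add_mul]
  refine mul_le_of_le_one_left (sq_nonneg _) ?_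
  nlinarith [hη.deriv_nonneg (v x), hη.deriv_le_one (v x)]

lemma IsSmoothTruncation.norm_sub_h01Embed_sq_add_le (hη : IsSmoothTruncation η) (w : L2 Ω)
    {v : E d → ℝ} (hv : IsTestFunction Ω v) :
    ‖hη.compL2 w - h01Embed Ω (testElem (hη.isTestFunction_comp hv))‖ ^ 2 +
      ‖w - hη.compL2 w - h01Embed Ω (testElem (hη.isTestFunction_sub hv))‖ ^ 2 ≤
      ‖w - h01Embed Ω (testElem hv)‖ ^ 2 := by
  refine Lp_norm_sq_add_le ?_
  filter_upwards [Lp.coeFn_sub (hη.compL2 w) (h01Embed Ω (testElem (hη.isTestFunction_comp hv))),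
    Lp.coeFn_sub (w - hη.compL2 w) (h01Embed Ω (testElem (hη.isTestFunction_sub hv))),
    Lp.coeFn_sub w (hη.compL2 w), Lp.coeFn_sub w (h01Embed Ω (testElem hv)), hη.coeFn_compL2 w,
    coeFn_h01Embed_testElem (hη.isTestFunction_comp hv),
    coeFn_h01Embed_testElem (hη.isTestFunction_sub hv),
    coeFn_h01Embed_testElem hv] with x h1 h2 h3 h4 h5 h6 h7 h8
  rw [h1, h2, h4, Pi.sub_apply, Pi.sub_apply, Pi.sub_apply, h3, Pi.sub_apply, h5, h6, h7, h8]
  simp only [Real.norm_eq_abs, sq_abs]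
  nlinarith [hη.mul_sub_nonneg (w x) (v x)]

variable [IsFiniteMeasure ((volume : Measure (E d)).restrict Ω)]

/-- Each part of `w` is tested with the corresponding part of a test function `v`; both the `L²`
cost and the gradient cost split. The general `z` follows by density, so no chain rule in `H_0^1(Ω)`
is needed. -/
lemma IsSmoothTruncation.sum_div_mul_le (hη : IsSmoothTruncation η) (hΩ : IsOpen Ω)
    (hb : Bornology.IsBounded Ω) (w : L2 Ω) {t : ℝ} (ht : 0 < t) (F : Finset ℝ) (z : H01 Ω) :
    ∑ l ∈ F, l / (t + l) * (‖eigenProj Ω l (hη.compL2 w)‖ ^ 2 +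
      ‖eigenProj Ω l (w - hη.compL2 w)‖ ^ 2) ≤
      ‖w - h01Embed Ω z‖ ^ 2 + t⁻¹ * ‖h01Grad Ω z‖ ^ 2 := by
  have h := isFormSpectrum_h01Embed hΩ hb
  refine h01_induction (isClosed_le continuous_const
    (((continuous_const.sub (h01Embed Ω).continuous).norm.pow 2).add
      (continuous_const.mul ((h01Grad Ω).continuous.norm.pow 2)))) (fun v hv => ?_) z
  have h1 := h.sum_div_mul_norm_sq_le (hη.compL2 w) (testElem (hη.isTestFunction_comp hv)) ht F
  have h2 := h.sum_div_mul_norm_sq_le (w - hη.compL2 w)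
    (testElem (hη.isTestFunction_sub hv)) ht F
  rw [h01_norm_sq, add_sub_cancel_left] at h1 h2
  have h3 := hη.norm_sub_h01Embed_sq_add_le w hv
  have h4 := mul_le_mul_of_nonneg_left (hη.norm_h01Grad_sq_add_le hv) (inv_pos.2 ht).le
  simp_rw [mul_add, Finset.sum_add_distrib]
  rw [mul_add] at h4
  refine (add_le_add h1 h2).trans ?_
  change _ ≤ ‖w - h01Embed Ω (testElem hv)‖ ^ 2 + t⁻¹ * ‖h01Grad Ω (testElem hv)‖ ^ 2
  linarith

end Truncation

lemma continuous_eigenProj (l : ℝ) : Continuous (eigenProj Ω l) :=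
  (eigenspace Ω l).starProjection.continuous

lemma spectralInner_self (w : L2 Ω) :
    spectralInner Ω s w w = ∑' l, l ^ s * ‖eigenProj Ω l w‖ ^ 2 := by
  simp_rw [spectralInner, real_inner_self_eq_norm_sq]

/-- Since `w - t g = (1 - t) w + t (w - g)`, this is the identity `‖(1 - t) a + t b‖² = (1 - t)‖a‖²
+ t‖b‖² - t(1 - t)‖a - b‖²`. -/
lemma norm_sq_eigenProj_sub_smul (l t : ℝ) (k : ℝ≥0) (w : L2 Ω) :
    l ^ s * ‖eigenProj Ω l (w - t • excess k w)‖ ^ 2 = (1 - t) * (l ^ s * ‖eigenProj Ω l w‖ ^ 2) +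
      t * (l ^ s * ‖eigenProj Ω l (truncAbove k w)‖ ^ 2) +
      (t ^ 2 - t) * (l ^ s * ‖eigenProj Ω l (excess k w)‖ ^ 2) := by
  have h1 : truncAbove k w = w - excess k w := by rw [excess]; abel
  simp only [h1, eigenProj, map_sub, map_smul]
  rw [norm_sub_sq_real, norm_sub_sq_real, real_inner_smul_right, norm_smul, mul_pow,
    Real.norm_eq_abs, sq_abs]
  ring

section

variable [IsFiniteMeasure ((volume : Measure (E d)).restrict Ω)]

lemma eigenProj_of_neg (hΩ : IsOpen Ω) (hb : Bornology.IsBounded Ω) {l : ℝ} (hl : l < 0)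
    (w : L2 Ω) : eigenProj Ω l w = 0 :=
  (isFormSpectrum_h01Embed hΩ hb).starProjection_eq_zero_of_neg hl w

/-- The real power of a negative `l` has no useful sign, but the projection vanishes there. -/
lemma rpow_mul_eigenProj_nonneg (hΩ : IsOpen Ω) (hb : Bornology.IsBounded Ω) (l : ℝ) (w : L2 Ω) :
    0 ≤ l ^ s * ‖eigenProj Ω l w‖ ^ 2 := by
  rcases lt_or_ge l 0 with hl | hl
  · rw [eigenProj_of_neg hΩ hb hl]; simp
  · positivity

lemma IsSmoothTruncation.sum_rpow_le (hs0 : 0 < s) (hs1 : s < 1) {η : ℝ → ℝ}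
    (hη : IsSmoothTruncation η) (hΩ : IsOpen Ω) (hb : Bornology.IsBounded Ω) (w : L2 Ω)
    (F : Finset ℝ) :
    ∑ l ∈ F, ENNReal.ofReal (l ^ s * (‖eigenProj Ω l (hη.compL2 w)‖ ^ 2 +
      ‖eigenProj Ω l (w - hη.compL2 w)‖ ^ 2)) ≤
      ∑' l, ENNReal.ofReal (l ^ s * ‖eigenProj Ω l w‖ ^ 2) := by
  have h := isFormSpectrum_h01Embed hΩ hb
  refine sum_rpow_le_tsum_of_resolvent hs0 hs1 (fun l => by positivity) (fun l => by positivity)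
    (fun l hl => ?_) (fun l hl => ?_) (h.summable_norm_sq w).countable_support F fun t ht => ?_
  · rw [eigenProj_of_neg hΩ hb hl, eigenProj_of_neg hΩ hb hl]; simp
  · rw [h.starProjection_eq_zero_of_neg hl]; simp
  · refine ENNReal.le_of_forall_pos_le_add fun ε hε _ => ?_
    -- A near-minimizer for `w` serves as the common competitor for the two truncated parts.
    obtain ⟨z, F', hF'⟩ := h.exists_form_le w ht (NNReal.coe_pos.2 hε)
    rw [h01_norm_sq, add_sub_cancel_left] at hF'
    have h1 := (hη.sum_div_mul_le hΩ hb w ht F z).trans hF'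
    rw [← ENNReal.ofReal_sum_of_nonneg fun l _ => ?_]
    · refine (ENNReal.ofReal_le_ofReal h1).trans ?_
      refine ENNReal.ofReal_add_le.trans ?_
      rw [ENNReal.ofReal_coe_nnreal]
      gcongr
      rw [ENNReal.ofReal_sum_of_nonneg fun l _ => ?_]
      · exact ENNReal.sum_le_tsum F'
      · rcases lt_or_ge l 0 with hl | hl
        · rw [h.starProjection_eq_zero_of_neg hl]; simp
        · positivity
    · rcases lt_or_ge l 0 with hl | hl
      · rw [eigenProj_of_neg hΩ hb hl, eigenProj_of_neg hΩ hb hl]; simp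
      · positivity

/-- Uniform convergence implies `L²` convergence because the measure is finite. -/
lemma tendsto_compL2 {k : ℝ≥0} {η : ℕ → ℝ → ℝ} (hη : ∀ n, IsSmoothTruncation (η n))
    (hηk : ∀ n x, |η n x - min x k| ≤ 1 / ((n : ℝ) + 1)) (w : L2 Ω) :
    Tendsto (fun n => (hη n).compL2 w) atTop (𝓝 (truncAbove k w)) := by
  rw [tendsto_iff_norm_sub_tendsto_zero]
  have h1 : ∀ n, ‖(hη n).compL2 w - truncAbove k w‖ ≤
      (measureUnivNNReal ((volume : Measure (E d)).restrict Ω) : ℝ) ^ (2 : ℝ≥0∞).toReal⁻¹ * (1 / ((n : ℝ) + 1)) := by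
    intro n
    have h2 := Lp.norm_le_of_ae_bound (p := 2) (f := (hη n).compL2 w - truncAbove k w)
      (C := 1 / ((n : ℝ) + 1)) (by positivity) (by
        filter_upwards [Lp.coeFn_sub ((hη n).compL2 w) (truncAbove k w), (hη n).coeFn_compL2 w,
          coeFn_truncAbove k w] with x h3 h4 h5
        rw [h3, Pi.sub_apply, h4, h5]
        exact hηk n _)
    exact h2
  refine squeeze_zero (fun _ => norm_nonneg _) h1 ?_
  simpa using tendsto_one_div_add_atTop_nhds_zero_nat.const_mul
    ((measureUnivNNReal ((volume : Measure (E d)).restrict Ω) : ℝ) ^ (2 : ℝ≥0∞).toReal⁻¹)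

/-- The spectral energy splits under truncation: for every finite set of eigenvalues. -/
lemma sum_rpow_truncAbove_le (hs0 : 0 < s) (hs1 : s < 1) (hΩ : IsOpen Ω)
    (hb : Bornology.IsBounded Ω) {w : L2 Ω} (hw : MemSpectral Ω s w) (k : ℝ≥0) (F : Finset ℝ) :
    ∑ l ∈ F, (l ^ s * ‖eigenProj Ω l (truncAbove k w)‖ ^ 2 +
      l ^ s * ‖eigenProj Ω l (excess k w)‖ ^ 2) ≤ ∑' l, l ^ s * ‖eigenProj Ω l w‖ ^ 2 := by
  obtain ⟨η, hη, hηk⟩ := exists_isSmoothTruncation_seq k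
  have hlim := tendsto_compL2 hη hηk w
  -- Finiteness of `F` lets the limit of smooth truncations pass through continuity of each
  -- projection.
  have h1 : Tendsto (fun n => ∑ l ∈ F, (l ^ s * ‖eigenProj Ω l ((hη n).compL2 w)‖ ^ 2 +
      l ^ s * ‖eigenProj Ω l (w - (hη n).compL2 w)‖ ^ 2)) atTop
      (𝓝 (∑ l ∈ F, (l ^ s * ‖eigenProj Ω l (truncAbove k w)‖ ^ 2 +
        l ^ s * ‖eigenProj Ω l (excess k w)‖ ^ 2))) := by
    refine tendsto_finsetSum F fun l _ => ?_
    exact ((((continuous_eigenProj l).tendsto _).comp hlim).norm.pow 2 |>.const_mul _).add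
      ((((continuous_eigenProj l).tendsto _).comp (hlim.const_sub w)).norm.pow 2 |>.const_mul _)
  refine le_of_tendsto h1 (Eventually.of_forall fun n => ?_)
  have h2 := (hη n).sum_rpow_le hs0 hs1 hΩ hb w F
  rw [← ENNReal.ofReal_tsum_of_nonneg (rpow_mul_eigenProj_nonneg hΩ hb · w) hw,
    ← ENNReal.ofReal_sum_of_nonneg fun l _ => ?_,
    ENNReal.ofReal_le_ofReal_iff (tsum_nonneg (rpow_mul_eigenProj_nonneg hΩ hb · w))] at h2
  · simpa only [mul_add] using h2
  · rw [mul_add]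
    exact add_nonneg (rpow_mul_eigenProj_nonneg hΩ hb _ _) (rpow_mul_eigenProj_nonneg hΩ hb _ _)

/-- Truncation splits the energy of `ℍ^s(Ω)`. -/
theorem splitsTruncation_spectral (hs0 : 0 < s) (hs1 : s < 1) (hΩ : IsOpen Ω)
    (hb : Bornology.IsBounded Ω) {w : L2 Ω} (hw : MemSpectral Ω s w) (k : ℝ≥0) :
    SplitsTruncation .spectral Ω s w k := by
  have hsum := sum_rpow_truncAbove_le hs0 hs1 hΩ hb hw k
  have hnn := fun w => (rpow_mul_eigenProj_nonneg (s := s) hΩ hb · w)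
  have hS := summable_of_sum_le (fun l => add_nonneg (hnn (truncAbove k w) l) (hnn (excess k w) l))
    hsum
  have hm : MemSpectral Ω s (truncAbove k w) :=
    hS.of_nonneg_of_le (hnn _) fun l => le_add_of_nonneg_right (hnn _ l)
  have hg : MemSpectral Ω s (excess k w) :=
    hS.of_nonneg_of_le (hnn _) fun l => le_add_of_nonneg_left (hnn _ l)
  have hle := hS.tsum_le_of_sum_le hsum
  rw [hm.tsum_add hg] at hle
  have hcomb := fun t : ℝ => ((hw.mul_left (1 - t)).add (hm.mul_left t)).add (hg.mul_left (t ^ 2 - t))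
  refine ⟨hg, fun t _ _ => ?_, fun t ht0 ht1 => ?_⟩
  · refine (hcomb t).congr fun l => ?_
    rw [norm_sq_eigenProj_sub_smul]
  · change spectralInner Ω s _ _ + _ * spectralInner Ω s _ _ ≤ spectralInner Ω s w w
    rw [spectralInner_self, spectralInner_self, spectralInner_self]
    simp_rw [norm_sq_eigenProj_sub_smul]
    rw [((hw.mul_left (1 - t)).add (hm.mul_left t)).tsum_add (hg.mul_left (t ^ 2 - t)),
      (hw.mul_left (1 - t)).tsum_add (hm.mul_left t), tsum_mul_left, tsum_mul_left, tsum_mul_left]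
    -- The excess terms combine to `t` times its energy, leaving `(1 - t)` times the energy of `w`
    -- plus `t` times the sum of the two parts, which is at most the energy of `w`.
    nlinarith

/-! ### All spaces -/

theorem FracSpace.inner_self_nonneg (hs0 : 0 < s) (hs1 : s < 1) (hΩ : IsOpen Ω)
    (hb : Bornology.IsBounded Ω) (W : FracSpace) (w : L2 Ω) : 0 ≤ W.inner Ω s w w := by
  cases W with
  | Hs => exact hsInner_self_nonneg _ hs0 hs1 _
  | Hs0 => exact hsInner_self_nonneg _ hs0 hs1 _
  | HsTilde => exact hsInner_self_nonneg _ hs0 hs1 _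
  | spectral =>
    change 0 ≤ spectralInner Ω s w w
    rw [spectralInner_self]
    exact tsum_nonneg (rpow_mul_eigenProj_nonneg hΩ hb · w)

theorem splitsTruncation (hd : 0 < d) (hs0 : 0 < s) (hs1 : s < 1) (hΩ : IsOpen Ω)
    (hb : Bornology.IsBounded Ω) (W : FracSpace) {w : L2 Ω} (hw : w ∈ W.carrier Ω s) (k : ℝ≥0) :
    SplitsTruncation W Ω s w k := by
  cases W with
  | Hs => exact splitsTruncation_Hs hs0 hs1 hw k
  | Hs0 => exact splitsTruncation_Hs0 hd hs0 hs1 hb hw k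
  | HsTilde => exact splitsTruncation_HsTilde hΩ.measurableSet hs0 hs1 hw k
  | spectral => exact splitsTruncation_spectral hs0 hs1 hΩ hb hw k

end

end FracControl
end

/-! ### The main theorem -/

theorem mainTheorem4
    {d : ℕ} (hd : 0 < d)
    (Ω : Set (FracControl.E d)) (hΩ : FracControl.IsBoundedLipschitzDomain Ω)
    (T : ℝ) (hT : 0 < T)
    (s : ℝ) (hs0 : 0 < s) (hs1 : s < 1) (W : FracControl.FracSpace)
    (f : FracControl.U T Ω → ℝ)
    (hf_lsc : FracControl.WeaklyLSC f)
    (hf_bdd : ∃ (g : FracControl.U T Ω →L[ℝ] ℝ) (c : ℝ), ∀ u, g u + c ≤ f u)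
    (hf_diff : ContDiff ℝ 1 f)
    (α β γ p : ℝ) (hα : 0 < α) (hβ : 0 < β) (hγ : 0 < γ) (hp0 : 0 < p) (hp1 : p < 1)
    (u₀ : FracControl.U T Ω) (w₀ : FracControl.L2 Ω)
    (hsol : FracControl.IsLocalSolution W Ω s T f α β γ p u₀ w₀)
    (r q : ℝ≥0∞) (hr : 1 < r) (hq : 2 < q) (hrq : 1 / r + 2 / q < 1)
    (hemb : W.EmbedsLp Ω s q)
    (hreg : MemLp (fun x => ∫ t in Ioo 0 T, |gradient f u₀ (t, x)|) r (volume.restrict Ω)) :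
    MemLp w₀ ∞ (volume.restrict Ω) ∧ MemLp u₀ ∞ (FracControl.cylMeasure T Ω) := by
  have hb := hΩ.isBounded
  have hfin : IsFiniteMeasure ((volume : Measure (FracControl.E d)).restrict Ω) :=
    isFiniteMeasure_restrict.2 hb.measure_lt_top.ne
  exact FracControl.memLp_top_of_splitsTruncation hΩ.isOpen.measurableSet hT
    (fun w => W.inner_self_nonneg hs0 hs1 hΩ.isOpen hb w)
    (fun _ hw k => FracControl.splitsTruncation hd hs0 hs1 hΩ.isOpen hb W hw k)
    hα hβ hγ hp0 hp1 (hf_diff.differentiable one_ne_zero u₀) hsol hq hrq hemb hreg
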